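/- Let $p$ be an odd prime, $\Bbbk$ a field of characteristic $p$, $1\le t<\theta$ integers, and $\mathbf a=(a_{hj})_{t<h\le\theta,\,1\le j\le t}$ a family with entries in $\mathbb F_p$. Let $\mathscr G_{hj}\in\{0,1,\dots,p-1\}$ be the integer with $\mathscr G_{hj}\equiv-2a_{hj}\pmod p$. Let $f$ be a positive multiple of $p$ and $\Gamma=(\mathbb Z/f)^\theta$, with generators $g_1,\dots,g_\theta$ of order $f$. Let $\mathcal V=\mathcal V(\mathbf 1,\mathbf a)$ be the Yetter–Drinfeld module over $\Bbbk\Gamma$ with basis $x_1,\dots,x_\theta,y_1,\dots,y_t$, where $\deg x_i=g_i$ and $\deg y_j=g_j$, the group $\Gamma$ fixes every $x_i$, and $$g_j\cdot y_j=y_j+x_j,\qquad g_i\cdot y_j=y_j\quad(1\le i\le t,\ i\ne j),\qquad g_h\cdot y_j=y_j+a_{hj}x_j\quad(t<h\le\theta).$$ Let $\mathfrak B(\mathcal V)$ be its Nichols algebra and $H=\mathfrak B(\mathcal V)\#\Bbbk\Gamma$ its bosonization, so that $\Delta(x_i)=x_i\otimes1+g_i\otimes x_i$, $\Delta(y_j)=y_j\otimes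 1+g_j\otimes y_j$ and $\Delta(g_i)=g_i\otimes g_i$. Let $K=\Bbbk\langle x_1,\dots,x_t,g_1,\dots,g_\theta\rangle\subseteq H$, a Hopf subalgebra, with inclusion $\iota\colon K\to H$. Let $V(\mathscr G)$ be the vector space with basis $v_{h,\mathbf m}$, for $t<h\le\theta$ and $\mathbf m=(m_1,\dots,m_t)\in\mathbb Z^t$ with $0\le m_j\le\mathscr G_{hj}$ for all $j$. Let $\mathfrak n$ be the vector space with basis $E_1,\dots,E_t$, and let it act on $V(\mathscr G)$ by $$E_j\cdot v_{h,\mathbf m}=v_{h,\mathbf m+\mathbf e_j}\ \text{ if } m_j<\mathscr G_{hj},\qquad E_j\cdot v_{h,\mathbf m}=0\ \text{ if } m_j=\mathscr G_{hj},$$ where $\mathbf e_j$ is the $j$-th unit vector. Let $\mathfrak l=V(\mathscr G)\rtimes\mathfrak n$ be the semidirect product of the abelian Lie algebras $V(\mathscr G)$ and $\mathfrak n$. It is a restricted Lie algebra for the $p$-operation that is zero on $V(\mathscr G)$ and on $\mathfrak n$, i.e. $(v+e)^{[p]}=e^{p-1}\cdot v$ for $v\in V(\mathscr G)$ and $e\in\mathfrak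 n$. Let $L=\mathfrak u(\mathfrak l)$ be its restricted enveloping algebra, a Hopf algebra in which the elements of $\mathfrak l$ are primitive, and put $v_h=v_{h,\mathbf 0}$. Then there is a Hopf algebra map $\pi\colon H\to L$ such that $$\pi(g_i)=1\ (1\le i\le\theta),\quad \pi(x_j)=0,\ \ \pi(y_j)=E_j\ (1\le j\le t),\quad \pi(x_h)=v_h\ (t<h\le\theta),$$ it is the only algebra map with these values, and $$\Bbbk\to K\xrightarrow{\ \iota\ }H\xrightarrow{\ \pi\ }L\to\Bbbk$$ is a split abelian exact sequence of Hopf algebras. That is: * (exact) $\iota$ is injective, $\pi$ is surjective, $\ker\pi=H\,\iota(K)^+$ where $K^+=\ker\varepsilon_K$, and $\iota(K)=\{c\in H:(\mathrm{id}\otimes\pi)\Delta(c)=c\otimes1\}$; * (abelian) $K$ is commutative and $L$ is cocommutative; * (split) there are a right $L$-colinear section $s\colon L\to H$ of $\pi$ that is an algebra map and a left $K$-linear retraction $r\colon H\to K$ of $\iota$ that is a coalgebra map, both invertible for the convolution product, with $r\,s=\varepsilon_L1_K$. -/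

import Mathlib

open scoped TensorProduct

noncomputable section

section Generators

open Coalgebra

variable {k A : Type*} [CommRing k] [Ring A] [Bialgebra k A]

/-- A bialgebra generated by a set `s` is a Hopf algebra as soon as it has an algebra
antimorphism that satisfies the antipode identities on `s`. -/
@[reducible] def hopfOfGenerators (S : A →ₐ[k] Aᵐᵒᵖ) (s : Set A)
    (hs : Algebra.adjoin k s = ⊤)
    (hl : ∀ x ∈ s, LinearMap.mul' k A ((((MulOpposite.opLinearEquiv k).symm.toLinearMap ∘ₗ
      S.toLinearMap).rTensor A) (comul x)) = algebraMap k A (counit x))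
    (hr : ∀ x ∈ s, LinearMap.mul' k A ((((MulOpposite.opLinearEquiv k).symm.toLinearMap ∘ₗ
      S.toLinearMap).lTensor A) (comul x)) = algebraMap k A (counit x)) :
    HopfAlgebra k A where
  antipode := (MulOpposite.opLinearEquiv k).symm.toLinearMap ∘ₗ S.toLinearMap
  mul_antipode_rTensor_comul := by
    set S' : A →ₗ[k] A := (MulOpposite.opLinearEquiv k).symm.toLinearMap ∘ₗ S.toLinearMap with hS'
    have hmul : ∀ a b, S' (a * b) = S' b * S' a := fun a b => by simp [hS']
    have hone : S' 1 = 1 := by simp [hS']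
    have key : ∀ (a b : A) (u : A ⊗[k] A), LinearMap.mul' k A (S'.rTensor A ((a ⊗ₜ b) * u)) =
        LinearMap.mul' k A (S'.rTensor A (((1 : A) ⊗ₜ[k]
          LinearMap.mul' k A (S'.rTensor A (a ⊗ₜ b))) * u)) := by
      intro a b u
      induction u using TensorProduct.induction_on with
      | zero => simp
      | tmul c d => simp [hmul, mul_assoc]
      | add x y hx hy => simp only [mul_add, map_add, hx, hy]
    have key' : ∀ (t u : A ⊗[k] A), LinearMap.mul' k A (S'.rTensor A (t * u)) =
        LinearMap.mul' k A (S'.rTensor A (((1 : A) ⊗ₜ[k]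
          LinearMap.mul' k A (S'.rTensor A t)) * u)) := by
      intro t u
      induction t using TensorProduct.induction_on with
      | zero => simp
      | tmul c d => exact key c d u
      | add x y hx hy => simp only [add_mul, map_add, hx, hy, TensorProduct.tmul_add]
    ext a
    have ha : a ∈ Algebra.adjoin k s := by rw [hs]; trivial
    simp only [LinearMap.coe_comp, Function.comp_apply, Algebra.linearMap_apply]
    induction ha using Algebra.adjoin_induction with
    | mem x hx => exact hl x hx
    | algebraMap r => simp [Algebra.algebraMap_eq_smul_one, Algebra.TensorProduct.one_def, hone]
    | add x y _ _ hx hy => simp only [map_add, hx, hy]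
    | mul x y _ _ hx hy =>
      rw [Bialgebra.comul_mul, key', hx, Bialgebra.counit_mul,
        Algebra.algebraMap_eq_smul_one (counit x), TensorProduct.tmul_smul,
        ← Algebra.TensorProduct.one_def, smul_mul_assoc, one_mul, map_smul, map_smul, hy,
        map_mul, ← Algebra.smul_def]
  mul_antipode_lTensor_comul := by
    set S' : A →ₗ[k] A := (MulOpposite.opLinearEquiv k).symm.toLinearMap ∘ₗ S.toLinearMap with hS'
    have hmul : ∀ a b, S' (a * b) = S' b * S' a := fun a b => by simp [hS']
    have hone : S' 1 = 1 := by simp [hS']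
    have key' : ∀ (t u : A ⊗[k] A), LinearMap.mul' k A (S'.lTensor A (t * u)) =
        LinearMap.mul' k A (S'.lTensor A (t *
          ((LinearMap.mul' k A (S'.lTensor A u)) ⊗ₜ[k] (1 : A)))) := by
      intro t u
      induction t using TensorProduct.induction_on with
      | zero => simp
      | tmul c d =>
        induction u using TensorProduct.induction_on with
        | zero => simp
        | tmul c' d' => simp [hmul, mul_assoc]
        | add x y hx hy => simp only [mul_add, map_add, hx, hy, TensorProduct.add_tmul]
      | add x y hx hy => simp only [add_mul, map_add, hx, hy]
    ext a
    have ha : a ∈ Algebra.adjoin k s := by rw [hs]; trivial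
    simp only [LinearMap.coe_comp, Function.comp_apply, Algebra.linearMap_apply]
    induction ha using Algebra.adjoin_induction with
    | mem x hx => exact hr x hx
    | algebraMap r => simp [Algebra.algebraMap_eq_smul_one, Algebra.TensorProduct.one_def, hone]
    | add x y _ _ hx hy => simp only [map_add, hx, hy]
    | mul x y _ _ hx hy =>
      rw [Bialgebra.comul_mul, key', hy, Bialgebra.counit_mul,
        Algebra.algebraMap_eq_smul_one (counit y), ← TensorProduct.smul_tmul',
        ← Algebra.TensorProduct.one_def, mul_smul_comm, mul_one, map_smul, map_smul, hx,
        mul_comm, map_mul, ← Algebra.smul_def]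

end Generators

section SmashProducts

open Coalgebra SkewMonoidAlgebra

variable {k Γ X : Type*} [Field k] [CommGroup Γ]

variable (k) in
/-- Data from which the smash product `R # kΓ` becomes a Hopf algebra.  Here `R` is an algebra
on which `Γ` acts by algebra automorphisms, generated by elements `gen x` of degree `deg x`, and
`R # kΓ = SkewMonoidAlgebra R Γ` has multiplication `(r # g) (s # h) = r (g • s) # g h`. -/
structure SmashData (deg : X → Γ) (R : Type*) [Ring R] [Algebra k R] [MulSemiringAction Γ R]
    [SMulCommClass Γ k R] where
  gen : X → R
  adjoin_gen : Algebra.adjoin k (Set.range gen) = ⊤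
  smul_gen_mem : ∀ (γ : Γ) (x : X), γ • gen x ∈ Submodule.span k (gen '' {y | deg y = deg x})
  comul : R →ₐ[k] SkewMonoidAlgebra R Γ ⊗[k] SkewMonoidAlgebra R Γ
  comul_gen : ∀ x, comul (gen x) = single 1 (gen x) ⊗ₜ 1 + of R Γ (deg x) ⊗ₜ single 1 (gen x)
  counit : R →ₐ[k] k
  counit_gen : ∀ x, counit (gen x) = 0
  anti : R →ₐ[k] (SkewMonoidAlgebra R Γ)ᵐᵒᵖ
  anti_gen : ∀ x, anti (gen x) = MulOpposite.op (-(of R Γ (deg x)⁻¹ * single 1 (gen x)))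

namespace SmashData

variable {deg : X → Γ} {R : Type*} [Ring R] [Algebra k R] [MulSemiringAction Γ R]
  [SMulCommClass Γ k R]

variable (k Γ R) in
/-- The inclusion `r ↦ r # 1` of `R` in `R # kΓ`. -/
def incl : R →ₐ[k] SkewMonoidAlgebra R Γ where
  __ := singleOneRingHom
  commutes' _ := rfl

@[simp] lemma incl_apply (r : R) : incl k Γ R r = single 1 r := rfl

variable (k) in
lemma of_mul_incl (g : Γ) (r : R) :
    of R Γ g * incl k Γ R r = incl k Γ R (g • r) * of R Γ g := by
  simp [of_apply, single_mul_single]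

lemma algHom_ext_smash {B : Type*} [Semiring B] [Algebra k B]
    {φ ψ : SkewMonoidAlgebra R Γ →ₐ[k] B}
    (h₁ : φ.comp (incl k Γ R) = ψ.comp (incl k Γ R)) (h₂ : ∀ g, φ (of R Γ g) = ψ (of R Γ g)) :
    φ = ψ := by
  ext a
  induction a using SkewMonoidAlgebra.induction_on with
  | zero => simp
  | single g r =>
    have : single g r = incl k Γ R r * of R Γ g := by simp [of_apply, single_mul_single]
    rw [this, map_mul, map_mul, h₂]
    congr 1
    exact DFunLike.congr_fun h₁ r
  | add a b ha hb => rw [map_add, map_add, ha, hb]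

variable (D : SmashData k deg R)

lemma algHom_ext_gen {B : Type*} [Semiring B] [Algebra k B] {φ ψ : SkewMonoidAlgebra R Γ →ₐ[k] B}
    (h₁ : ∀ x, φ (single 1 (D.gen x)) = ψ (single 1 (D.gen x)))
    (h₂ : ∀ g : Γ, φ (of R Γ g) = ψ (of R Γ g)) : φ = ψ := by
  refine algHom_ext_smash (AlgHom.ext_of_adjoin_eq_top D.adjoin_gen ?_) h₂
  rintro _ ⟨x, rfl⟩
  exact h₁ x

lemma comul_smul (g : Γ) (r : R) :
    D.comul (g • r) * (of R Γ g ⊗ₜ of R Γ g) = (of R Γ g ⊗ₜ of R Γ g) * D.comul r := by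
  have hr : r ∈ Algebra.adjoin k (Set.range D.gen) := by rw [D.adjoin_gen]; trivial
  induction hr using Algebra.adjoin_induction with
  | mem x hx =>
    obtain ⟨x, rfl⟩ := hx
    have h : ∀ z ∈ Submodule.span k (D.gen '' {y | deg y = deg x}),
        D.comul z = incl k Γ R z ⊗ₜ 1 + of R Γ (deg x) ⊗ₜ incl k Γ R z := by
      intro z hz
      induction hz using Submodule.span_induction with
      | mem z hz =>
        obtain ⟨y, hy, rfl⟩ := hz
        rw [D.comul_gen, show deg y = deg x from hy]; rfl
      | zero => simp
      | add a b _ _ ha hb =>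
        rw [map_add, ha, hb, map_add, TensorProduct.add_tmul, TensorProduct.tmul_add]; abel
      | smul c a _ ha =>
        rw [map_smul, ha, map_smul, TensorProduct.tmul_smul, ← TensorProduct.smul_tmul', smul_add]
    rw [h _ (D.smul_gen_mem g x), D.comul_gen, ← incl_apply (k := k) (D.gen x)]
    rw [add_mul, mul_add]
    simp only [Algebra.TensorProduct.tmul_mul_tmul, of_mul_incl k, one_mul, mul_one, ← map_mul,
      mul_comm]
  | algebraMap c =>
    rw [smul_algebraMap, AlgHom.commutes, Algebra.commutes]
  | add a b _ _ ha hb => rw [smul_add, map_add, map_add, add_mul, mul_add, ha, hb]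
  | mul a b _ _ ha hb =>
    rw [smul_mul', map_mul, map_mul, mul_assoc, hb, ← mul_assoc, ha, mul_assoc]

lemma counit_smul (g : Γ) (r : R) : D.counit (g • r) = D.counit r := by
  have hr : r ∈ Algebra.adjoin k (Set.range D.gen) := by rw [D.adjoin_gen]; trivial
  induction hr using Algebra.adjoin_induction with
  | mem x hx =>
    obtain ⟨x, rfl⟩ := hx
    have h : Submodule.span k (D.gen '' {y | deg y = deg x}) ≤ LinearMap.ker D.counit.toLinearMap := by
      rw [Submodule.span_le]
      rintro _ ⟨y, _, rfl⟩
      exact D.counit_gen y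
    rw [D.counit_gen]
    exact h (D.smul_gen_mem g x)
  | algebraMap c => rw [smul_algebraMap]
  | add a b _ _ ha hb => rw [smul_add, map_add, map_add, ha, hb]
  | mul a b _ _ ha hb => rw [smul_mul', map_mul, map_mul, ha, hb]

lemma anti_smul (g : Γ) (r : R) :
    D.anti (g • r) * MulOpposite.op (of R Γ g⁻¹) = MulOpposite.op (of R Γ g⁻¹) * D.anti r := by
  have hr : r ∈ Algebra.adjoin k (Set.range D.gen) := by rw [D.adjoin_gen]; trivial
  induction hr using Algebra.adjoin_induction with
  | mem x hx =>
    obtain ⟨x, rfl⟩ := hx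
    have h : ∀ z ∈ Submodule.span k (D.gen '' {y | deg y = deg x}),
        D.anti z = MulOpposite.op (-(of R Γ (deg x)⁻¹ * incl k Γ R z)) := by
      intro z hz
      induction hz using Submodule.span_induction with
      | mem z hz =>
        obtain ⟨y, hy, rfl⟩ := hz
        rw [D.anti_gen, show deg y = deg x from hy]; rfl
      | zero => simp
      | add a b _ _ ha hb =>
        rw [map_add, ha, hb, map_add, mul_add, neg_add, MulOpposite.op_add]
      | smul c a _ ha =>
        rw [map_smul, ha, map_smul, mul_smul_comm, ← smul_neg, MulOpposite.op_smul]
    rw [h _ (D.smul_gen_mem g x), D.anti_gen, ← incl_apply (k := k) (D.gen x)]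
    rw [← MulOpposite.op_mul, ← MulOpposite.op_mul]
    congr 1
    rw [mul_neg, neg_mul]
    congr 1
    have e : incl k Γ R (g • D.gen x) = of R Γ g * incl k Γ R (D.gen x) * of R Γ g⁻¹ := by
      rw [of_mul_incl k, mul_assoc, ← map_mul, mul_inv_cancel, map_one, mul_one]
    rw [e]
    simp only [← mul_assoc, ← map_mul]
    congr 3
    rw [mul_comm g⁻¹, inv_mul_cancel_right]
  | algebraMap c =>
    rw [smul_algebraMap, AlgHom.commutes, Algebra.commutes]
  | add a b _ _ ha hb => rw [smul_add, map_add, map_add, add_mul, mul_add, ha, hb]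
  | mul a b _ _ ha hb =>
    rw [smul_mul', map_mul, map_mul, mul_assoc, hb, ← mul_assoc, ha, mul_assoc]

/-- The comultiplication of `R # kΓ`: `γ ↦ γ ⊗ γ` and `gen x ↦ gen x ⊗ 1 + deg x ⊗ gen x`. -/
def comulHom : SkewMonoidAlgebra R Γ →ₐ[k] SkewMonoidAlgebra R Γ ⊗[k] SkewMonoidAlgebra R Γ :=
  liftNCAlgHom D.comul
    { toFun := fun g => of R Γ g ⊗ₜ of R Γ g
      map_one' := by simp [Algebra.TensorProduct.one_def]
      map_mul' := fun g h => by simp [Algebra.TensorProduct.tmul_mul_tmul] }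
    (fun {x y} => D.comul_smul y x)

/-- The counit of `R # kΓ`: `γ ↦ 1` and `gen x ↦ 0`. -/
def counitHom : SkewMonoidAlgebra R Γ →ₐ[k] k :=
  liftNCAlgHom D.counit 1 (fun {x y} => by simp [D.counit_smul])

/-- The antipode of `R # kΓ`: `γ ↦ γ⁻¹` and `gen x ↦ -(deg x)⁻¹ gen x`. -/
def antiHom : SkewMonoidAlgebra R Γ →ₐ[k] (SkewMonoidAlgebra R Γ)ᵐᵒᵖ :=
  liftNCAlgHom D.anti
    { toFun := fun g => MulOpposite.op (of R Γ g⁻¹)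
      map_one' := by simp
      map_mul' := fun g h => by rw [← MulOpposite.op_mul, ← map_mul, mul_inv_rev] }
    (fun {x y} => D.anti_smul y x)

@[simp] lemma comulHom_single_one (g : Γ) : D.comulHom (single g 1) = single g 1 ⊗ₜ single g 1 := by
  simp [comulHom, liftNCAlgHom, liftNCRingHom, of_apply]

lemma comulHom_of (g : Γ) : D.comulHom (of R Γ g) = of R Γ g ⊗ₜ of R Γ g := by
  simp [comulHom, liftNCAlgHom, liftNCRingHom, of_apply]

@[simp] lemma comulHom_single (r : R) : D.comulHom (single 1 r) = D.comul r := by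
  simp [comulHom, liftNCAlgHom, liftNCRingHom, ← Algebra.TensorProduct.one_def]

@[simp] lemma counitHom_single_one (g : Γ) : D.counitHom (single g 1) = 1 := by
  simp [counitHom, liftNCAlgHom, liftNCRingHom]

lemma counitHom_of (g : Γ) : D.counitHom (of R Γ g) = 1 := by
  simp [counitHom, liftNCAlgHom, liftNCRingHom]

@[simp] lemma counitHom_single (r : R) : D.counitHom (single 1 r) = D.counit r := by
  simp [counitHom, liftNCAlgHom, liftNCRingHom]

@[simp] lemma antiHom_single_one (g : Γ) : D.antiHom (single g 1) = MulOpposite.op (single g⁻¹ 1) := by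
  simp [antiHom, liftNCAlgHom, liftNCRingHom, of_apply]

lemma antiHom_of (g : Γ) : D.antiHom (of R Γ g) = MulOpposite.op (of R Γ g⁻¹) := by
  simp [antiHom, liftNCAlgHom, liftNCRingHom, of_apply]

@[simp] lemma antiHom_single (r : R) : D.antiHom (single 1 r) = D.anti r := by
  simp [antiHom, liftNCAlgHom, liftNCRingHom]

lemma adjoin_smash : Algebra.adjoin k (Set.range (fun x => (single 1 (D.gen x) :
    SkewMonoidAlgebra R Γ)) ∪ Set.range (of R Γ)) = ⊤ := by
  set T := Algebra.adjoin k (Set.range (fun x => (single 1 (D.gen x) :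
    SkewMonoidAlgebra R Γ)) ∪ Set.range (of R Γ))
  have h1 : ∀ r, incl k Γ R r ∈ T := by
    have : (⊤ : Subalgebra k R) ≤ T.comap (incl k Γ R) := by
      rw [← D.adjoin_gen, Algebra.adjoin_le_iff]
      rintro _ ⟨x, rfl⟩
      exact Algebra.subset_adjoin (Or.inl ⟨x, rfl⟩)
    exact fun r => this trivial
  refine eq_top_iff.2 fun a _ => ?_
  induction a using SkewMonoidAlgebra.induction_on with
  | zero => exact T.zero_mem
  | single g r =>
    have : single g r = incl k Γ R r * of R Γ g := by simp [of_apply, single_mul_single]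
    rw [this]
    exact T.mul_mem (h1 r) (Algebra.subset_adjoin (Or.inr ⟨g, rfl⟩))
  | add a b ha hb => exact T.add_mem (ha trivial) (hb trivial)

/-- The bialgebra `R # kΓ`. -/
@[reducible] def bialgebra : Bialgebra k (SkewMonoidAlgebra R Γ) :=
  Bialgebra.ofAlgHom D.comulHom D.counitHom
    (D.algHom_ext_gen
      (fun x => by
        simp [D.comul_gen, TensorProduct.add_tmul, TensorProduct.tmul_add,
          Algebra.TensorProduct.one_def, add_assoc])
      (fun g => by simp))
    (D.algHom_ext_gen (fun x => by simp [D.comul_gen, D.counit_gen]) (fun g => by simp))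
    (D.algHom_ext_gen (fun x => by simp [D.comul_gen, D.counit_gen]) (fun g => by simp))

/-- The Hopf algebra `R # kΓ`. -/
@[reducible] def hopfAlgebra : HopfAlgebra k (SkewMonoidAlgebra R Γ) :=
  letI := D.bialgebra
  hopfOfGenerators D.antiHom _ D.adjoin_smash
    (by
      have h : ∀ a : SkewMonoidAlgebra R Γ, Coalgebra.comul (R := k) a = D.comulHom a := fun _ => rfl
      have h' : ∀ a : SkewMonoidAlgebra R Γ, Coalgebra.counit (R := k) a = D.counitHom a :=
        fun _ => rfl
      rintro _ (⟨x, rfl⟩ | ⟨g, rfl⟩)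
      · simp only [h, h', comulHom_single, D.comul_gen, counitHom_single, D.counit_gen]
        simp [D.anti_gen, single_mul_single]
      · simp only [h, h', comulHom_of, counitHom_of, map_one]
        simp only [LinearMap.rTensor_tmul, LinearMap.mul'_apply, LinearMap.comp_apply,
          AlgHom.toLinearMap_apply, antiHom_of]
        simp [single_mul_single])
    (by
      have h : ∀ a : SkewMonoidAlgebra R Γ, Coalgebra.comul (R := k) a = D.comulHom a := fun _ => rfl
      have h' : ∀ a : SkewMonoidAlgebra R Γ, Coalgebra.counit (R := k) a = D.counitHom a :=
        fun _ => rfl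
      rintro _ (⟨x, rfl⟩ | ⟨g, rfl⟩)
      · simp only [h, h', comulHom_single, D.comul_gen, counitHom_single, D.counit_gen]
        simp [D.anti_gen, single_mul_single]
      · simp only [h, h', comulHom_of, counitHom_of, map_one]
        simp only [LinearMap.lTensor_tmul, LinearMap.mul'_apply, LinearMap.comp_apply,
          AlgHom.toLinearMap_apply, antiHom_of]
        simp [single_mul_single])

end SmashData

end SmashProducts

section Nichols

open Coalgebra SkewMonoidAlgebra

/-- A Yetter-Drinfeld module `V` over the group algebra `kΓ` of an abelian group `Γ`, given by a
homogeneous basis `X`, so that `V = X →₀ k`: a representation of `Γ` on `V` and a grading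
`deg x ∈ Γ` (the coaction is `x ↦ deg x ⊗ x`), such that the action preserves the homogeneous
components. Its braiding is `c (x ⊗ v) = (deg x • v) ⊗ x`. -/
structure YetterDrinfeld (k Γ X : Type*) [Field k] [CommGroup Γ] where
  action : Representation k Γ (X →₀ k)
  deg : X → Γ
  deg_eq : ∀ γ x y, action γ (Finsupp.single x 1) y ≠ 0 → deg y = deg x

namespace YetterDrinfeld

variable {k Γ X : Type*} [Field k] [CommGroup Γ] (M : YetterDrinfeld k Γ X)

/-- The braiding `c (v ⊗ w) = v_(-1) • w ⊗ v_(0)` of a Yetter-Drinfeld module. -/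
def braiding : (X →₀ k) ⊗[k] (X →₀ k) →ₗ[k] (X →₀ k) ⊗[k] (X →₀ k) :=
  TensorProduct.lift (Finsupp.lsum k fun x => LinearMap.toSpanSingleton k _
    ((TensorProduct.mk k _ _).flip (Finsupp.single x 1) ∘ₗ M.action (M.deg x)))

lemma braiding_single (x : X) (w : X →₀ k) :
    M.braiding (Finsupp.single x 1 ⊗ₜ w) = M.action (M.deg x) w ⊗ₜ Finsupp.single x 1 := by
  simp [braiding]

/-- The tensor algebra `T(V)`. -/
def Tensor (_ : YetterDrinfeld k Γ X) : Type _ := TensorAlgebra k (X →₀ k)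

instance : Ring M.Tensor := inferInstanceAs (Ring (TensorAlgebra k (X →₀ k)))

instance : Algebra k M.Tensor := inferInstanceAs (Algebra k (TensorAlgebra k (X →₀ k)))

/-- The inclusion of `V` in `T(V)`. -/
def ι : (X →₀ k) →ₗ[k] M.Tensor := TensorAlgebra.ι k

/-- The grading of `T(V)` by the subspaces `T^n(V)`. -/
def tensorGrading (n : ℕ) : Submodule k M.Tensor := LinearMap.range M.ι ^ n

instance : GradedAlgebra M.tensorGrading :=
  inferInstanceAs (GradedAlgebra
    ((LinearMap.range (TensorAlgebra.ι k : (X →₀ k) →ₗ[k] TensorAlgebra k (X →₀ k)) ^ ·) :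
      ℕ → Submodule k _))

/-- The universal property of `T(V)`. -/
def tensorLift {A : Type*} [Ring A] [Algebra k A] (f : (X →₀ k) →ₗ[k] A) : M.Tensor →ₐ[k] A :=
  TensorAlgebra.lift k f

@[simp] lemma tensorLift_ι {A : Type*} [Ring A] [Algebra k A] (f : (X →₀ k) →ₗ[k] A)
    (v : X →₀ k) : M.tensorLift f (M.ι v) = f v :=
  TensorAlgebra.lift_ι_apply f v

lemma tensor_hom_ext {A : Type*} [Ring A] [Algebra k A] {f g : M.Tensor →ₐ[k] A}
    (h : ∀ v, f (M.ι v) = g (M.ι v)) : f = g :=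
  TensorAlgebra.hom_ext (LinearMap.ext h)

/-- `Γ` acts on `T(V)` by the algebra automorphisms that extend its action on `V`. -/
def tensorAct (γ : Γ) : M.Tensor →ₐ[k] M.Tensor := M.tensorLift (M.ι ∘ₗ M.action γ)

instance : MulSemiringAction Γ M.Tensor where
  smul γ t := M.tensorAct γ t
  one_smul t := by
    have : M.tensorAct 1 = AlgHom.id k _ := M.tensor_hom_ext fun v => by simp [tensorAct]
    exact DFunLike.congr_fun this t
  mul_smul γ δ t := by
    have : M.tensorAct (γ * δ) = (M.tensorAct γ).comp (M.tensorAct δ) :=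
      M.tensor_hom_ext fun v => by simp [tensorAct]
    exact DFunLike.congr_fun this t
  smul_zero γ := map_zero (M.tensorAct γ)
  smul_add γ := map_add (M.tensorAct γ)
  smul_one γ := map_one (M.tensorAct γ)
  smul_mul γ := map_mul (M.tensorAct γ)

lemma smul_tensor (γ : Γ) (t : M.Tensor) : γ • t = M.tensorAct γ t := rfl

lemma smul_ι (γ : Γ) (v : X →₀ k) : γ • M.ι v = M.ι (M.action γ v) := by
  simp [smul_tensor, tensorAct]

instance : SMulCommClass Γ k M.Tensor where
  smul_comm γ c t := map_smul (M.tensorAct γ) c t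

lemma adjoin_ι_single :
    Algebra.adjoin k (Set.range fun x => M.ι (Finsupp.single x 1)) = ⊤ := by
  have h : Algebra.adjoin k (Set.range M.ι) = ⊤ := TensorAlgebra.adjoin_range_ι
  rw [eq_top_iff, ← h, Algebra.adjoin_le_iff]
  rintro _ ⟨v, rfl⟩
  induction v using Finsupp.induction_linear with
  | zero => simp
  | add v w hv hw => rw [map_add]; exact add_mem hv hw
  | single x c =>
    rw [← mul_one c, ← smul_eq_mul, ← Finsupp.smul_single, map_smul]
    exact Subalgebra.smul_mem _ (Algebra.subset_adjoin (Set.mem_range_self x)) c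

lemma action_mem (γ : Γ) (x : X) : M.action γ (Finsupp.single x 1) ∈
    Submodule.span k ((fun y => Finsupp.single y (1 : k)) '' {y | M.deg y = M.deg x}) := by
  rw [← Finsupp.sum_single (M.action γ (Finsupp.single x 1))]
  refine Submodule.sum_mem _ fun y hy => ?_
  rw [← mul_one (M.action γ (Finsupp.single x 1) y), ← smul_eq_mul, ← Finsupp.smul_single]
  exact Submodule.smul_mem _ _ (Submodule.subset_span
    ⟨y, M.deg_eq γ x y (Finsupp.mem_support_iff.1 hy), rfl⟩)

/-- The data defining the Hopf algebra `T(V) # kΓ`. -/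
def tensorData : SmashData k M.deg M.Tensor where
  gen x := M.ι (Finsupp.single x 1)
  adjoin_gen := M.adjoin_ι_single
  smul_gen_mem γ x := by
    rw [smul_ι]
    have := Submodule.mem_map_of_mem (f := M.ι) (M.action_mem γ x)
    rwa [Submodule.map_span, Set.image_image] at this
  comul := M.tensorLift (Finsupp.lsum k fun x => LinearMap.toSpanSingleton k _
    (single 1 (M.ι (Finsupp.single x 1)) ⊗ₜ 1 +
      of M.Tensor Γ (M.deg x) ⊗ₜ single 1 (M.ι (Finsupp.single x 1))))
  comul_gen x := by simp
  counit := M.tensorLift 0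
  counit_gen x := by simp
  anti := M.tensorLift (Finsupp.lsum k fun x => LinearMap.toSpanSingleton k _
    (MulOpposite.op (-(of M.Tensor Γ (M.deg x)⁻¹ * single 1 (M.ι (Finsupp.single x 1))))))
  anti_gen x := by simp

/-- The bosonization `T(V) # kΓ`, with `Δ v = v ⊗ 1 + v_(-1) ⊗ v_(0)` for `v ∈ V` and
`Δ γ = γ ⊗ γ` for `γ ∈ Γ`. -/
instance : HopfAlgebra k (SkewMonoidAlgebra M.Tensor Γ) := M.tensorData.hopfAlgebra

/-- The subspace `I # kΓ` of `T(V) # kΓ`. -/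
def smashIdeal (I : Ideal M.Tensor) : Submodule k (SkewMonoidAlgebra M.Tensor Γ) where
  carrier := {a | ∀ γ, a.coeff γ ∈ I}
  add_mem' ha hb γ := by rw [coeff_add]; exact I.add_mem (ha γ) (hb γ)
  zero_mem' γ := by simp
  smul_mem' c a ha γ := by
    rw [coeff_smul, Finsupp.smul_apply, Algebra.smul_def]
    exact I.mul_mem_left _ (ha γ)

/-- The ideals `I` of `T(V)` by which one may divide to get a pre-Nichols algebra of `V`: the
homogeneous two-sided ideals generated in degrees at least `2`, that are Yetter-Drinfeld
submodules and Hopf ideals of the braided Hopf algebra `T(V)`, i.e., that are `Γ`-stable and such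
that `I # kΓ` is a Hopf ideal of the Hopf algebra `T(V) # kΓ`. -/
structure IsPreNicholsIdeal (I : Ideal M.Tensor) : Prop where
  isTwoSided : I.IsTwoSided
  isHomogeneous : I.IsHomogeneous M.tensorGrading
  two_le_degree : ∀ u ∈ I, ∀ n < 2, GradedRing.proj M.tensorGrading n u = 0
  smul_mem : ∀ (γ : Γ), ∀ u ∈ I, γ • u ∈ I
  isCoideal : (M.smashIdeal I).IsCoideal
  antipode_mem : ∀ a ∈ M.smashIdeal I, HopfAlgebra.antipode k a ∈ M.smashIdeal I

/-- The defining ideal of the Nichols algebra: the largest ideal as in `IsPreNicholsIdeal`. -/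
def nicholsIdeal : Ideal M.Tensor := sSup {I | M.IsPreNicholsIdeal I}

lemma le_nicholsIdeal {I : Ideal M.Tensor} (hI : M.IsPreNicholsIdeal I) : I ≤ M.nicholsIdeal :=
  le_sSup hI

instance : M.nicholsIdeal.IsTwoSided where
  mul_mem_of_left {a} b ha := by
    let N : Submodule M.Tensor M.Tensor :=
      { carrier := {x | ∀ b, x * b ∈ M.nicholsIdeal}
        add_mem' := fun hx hy b => by rw [add_mul]; exact Ideal.add_mem _ (hx b) (hy b)
        zero_mem' := fun b => by simp
        smul_mem' := fun c x hx b => by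
          rw [smul_eq_mul, mul_assoc]; exact Ideal.mul_mem_left _ _ (hx b) }
    have : M.nicholsIdeal ≤ N := sSup_le fun I hI x hx b => by
      have := hI.isTwoSided
      exact M.le_nicholsIdeal hI (I.mul_mem_right b hx)
    exact this ha b

lemma smul_mem_nicholsIdeal (γ : Γ) {u : M.Tensor} (hu : u ∈ M.nicholsIdeal) :
    γ • u ∈ M.nicholsIdeal := by
  have : M.nicholsIdeal ≤ M.nicholsIdeal.comap (M.tensorAct γ) :=
    sSup_le fun I hI x hx => M.le_nicholsIdeal hI (hI.smul_mem γ x hx)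
  exact this hu

/-- The Nichols algebra `𝔅(V)`. -/
abbrev NicholsAlgebra : Type _ := M.Tensor ⧸ M.nicholsIdeal

/-- The quotient map from `T(V)` to the Nichols algebra. -/
def toNichols : M.Tensor →ₐ[k] M.NicholsAlgebra := Ideal.Quotient.mkₐ k M.nicholsIdeal

lemma toNichols_surjective : Function.Surjective M.toNichols := Ideal.Quotient.mkₐ_surjective k _

lemma toNichols_eq_zero {u : M.Tensor} : M.toNichols u = 0 ↔ u ∈ M.nicholsIdeal :=
  Ideal.Quotient.eq_zero_iff_mem

/-- The action of `Γ` on the Nichols algebra. -/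
def nicholsAct (γ : Γ) : M.NicholsAlgebra →ₐ[k] M.NicholsAlgebra :=
  Ideal.Quotient.liftₐ M.nicholsIdeal (M.toNichols.comp (M.tensorAct γ))
    fun _ hu => M.toNichols_eq_zero.2 (M.smul_mem_nicholsIdeal γ hu)

lemma nicholsAct_mk (γ : Γ) (u : M.Tensor) : M.nicholsAct γ (M.toNichols u) = M.toNichols (γ • u) := rfl

instance : MulSemiringAction Γ M.NicholsAlgebra where
  smul γ t := M.nicholsAct γ t
  one_smul t := by
    obtain ⟨u, rfl⟩ := M.toNichols_surjective t
    exact (M.nicholsAct_mk 1 u).trans (by rw [one_smul])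
  mul_smul γ δ t := by
    obtain ⟨u, rfl⟩ := M.toNichols_surjective t
    exact (M.nicholsAct_mk (γ * δ) u).trans (by rw [mul_smul]; rfl)
  smul_zero γ := map_zero (M.nicholsAct γ)
  smul_add γ := map_add (M.nicholsAct γ)
  smul_one γ := map_one (M.nicholsAct γ)
  smul_mul γ := map_mul (M.nicholsAct γ)

lemma smul_toNichols (γ : Γ) (u : M.Tensor) : γ • M.toNichols u = M.toNichols (γ • u) := rfl

instance : SMulCommClass Γ k M.NicholsAlgebra where
  smul_comm γ c t := map_smul (M.nicholsAct γ) c t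

/-- The algebra map from `T(V) # kΓ` to `𝔅(V) # kΓ`. -/
def smashMk : SkewMonoidAlgebra M.Tensor Γ →ₐ[k] SkewMonoidAlgebra M.NicholsAlgebra Γ :=
  liftNCAlgHom ((SmashData.incl k Γ M.NicholsAlgebra).comp M.toNichols) (of M.NicholsAlgebra Γ)
    (fun {x y} => by
      rw [AlgHom.comp_apply, ← smul_toNichols, AlgHom.comp_apply, SmashData.of_mul_incl k])

@[simp] lemma smashMk_single (g : Γ) (u : M.Tensor) :
    M.smashMk (single g u) = single g (M.toNichols u) := by
  simp [smashMk, liftNCAlgHom, liftNCRingHom, single_mul_single]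

lemma smashMk_eq_zero {I : Ideal M.Tensor} (hI : M.IsPreNicholsIdeal I)
    {a : SkewMonoidAlgebra M.Tensor Γ} (ha : a ∈ M.smashIdeal I) : M.smashMk a = 0 := by
  rw [← sum_single a, sum_def', _root_.map_sum]
  refine Finset.sum_eq_zero fun g _ => ?_
  rw [smashMk_single, M.toNichols_eq_zero.2 (M.le_nicholsIdeal hI (ha g)), single_zero]

lemma single_mem_smashIdeal {I : Ideal M.Tensor} {u : M.Tensor} (hu : u ∈ I) :
    single 1 u ∈ M.smashIdeal I := by
  classical
  intro γ
  rw [coeff_single_apply]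
  split_ifs
  · exact hu
  · exact I.zero_mem

lemma nicholsIdeal_le_ker {B : Type*} [Ring B] [Algebra k B] (f : M.Tensor →ₐ[k] B)
    (hf : ∀ I, M.IsPreNicholsIdeal I → ∀ u ∈ I, f u = 0) : ∀ u ∈ M.nicholsIdeal, f u = 0 := by
  have : M.nicholsIdeal ≤ RingHom.ker f := sSup_le fun I hI u hu => hf I hI u hu
  exact this

/-- The data defining the Hopf algebra `𝔅(V) # kΓ`. -/
def nicholsData : SmashData k M.deg M.NicholsAlgebra where
  gen x := M.toNichols (M.ι (Finsupp.single x 1))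
  adjoin_gen := by
    have h : M.toNichols.range = ⊤ := (AlgHom.range_eq_top _).2 M.toNichols_surjective
    rw [← h, ← Algebra.map_top, ← M.adjoin_ι_single, AlgHom.map_adjoin, ← Set.range_comp]
    rfl
  smul_gen_mem γ x := by
    rw [smul_toNichols]
    have := Submodule.mem_map_of_mem (f := M.toNichols.toLinearMap) (M.tensorData.smul_gen_mem γ x)
    rw [Submodule.map_span, Set.image_image] at this
    exact this
  comul := Ideal.Quotient.liftₐ M.nicholsIdeal
    ((Algebra.TensorProduct.map M.smashMk M.smashMk).comp M.tensorData.comul) (by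
      refine M.nicholsIdeal_le_ker _ fun I hI u hu => ?_
      have h := hI.isCoideal.map_mkQ_comul_eq_zero (M.single_mem_smashIdeal hu)
      have hle : M.smashIdeal I ≤ LinearMap.ker M.smashMk.toLinearMap :=
        fun a ha => M.smashMk_eq_zero hI ha
      have h' := congrArg (TensorProduct.map ((M.smashIdeal I).liftQ _ hle)
        ((M.smashIdeal I).liftQ _ hle)) h
      rw [← LinearMap.comp_apply, ← TensorProduct.map_comp, Submodule.liftQ_mkQ, map_zero] at h'
      have e : Coalgebra.comul (R := k) (single 1 u : SkewMonoidAlgebra M.Tensor Γ) =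
        M.tensorData.comul u := M.tensorData.comulHom_single u
      rw [e] at h'
      exact h')
  comul_gen x := by
    refine (congrArg (Algebra.TensorProduct.map M.smashMk M.smashMk)
      (M.tensorData.comul_gen x)).trans ?_
    simp only [map_add, Algebra.TensorProduct.map_tmul, smashMk_single, map_one, of_apply]
    rfl
  counit := Ideal.Quotient.liftₐ M.nicholsIdeal M.tensorData.counit (by
      refine M.nicholsIdeal_le_ker _ fun I hI u hu => ?_
      have h := hI.isCoideal.counit_eq_zero (M.single_mem_smashIdeal hu)
      exact (M.tensorData.counitHom_single u).symm.trans h)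
  counit_gen x := M.tensorData.counit_gen x
  anti := Ideal.Quotient.liftₐ M.nicholsIdeal
    ((AlgHom.op M.smashMk).comp M.tensorData.anti) (by
      refine M.nicholsIdeal_le_ker _ fun I hI u hu => ?_
      have h := M.smashMk_eq_zero hI (hI.antipode_mem _ (M.single_mem_smashIdeal hu))
      have e : HopfAlgebra.antipode k (single 1 u : SkewMonoidAlgebra M.Tensor Γ) =
        MulOpposite.unop (M.tensorData.anti u) := by
        rw [← M.tensorData.antiHom_single u]; rfl
      rw [e] at h
      exact MulOpposite.unop_injective h)
  anti_gen x := by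
    refine (congrArg (AlgHom.op M.smashMk) (M.tensorData.anti_gen x)).trans ?_
    rw [AlgHom.op_apply_apply]
    simp only [MulOpposite.unop_op, map_neg, map_mul, of_apply, smashMk_single, map_one]
    rfl

/-- The bosonization `𝔅(V) # kΓ` of the Nichols algebra of `V`. -/
def Bosonization : Type _ := SkewMonoidAlgebra M.NicholsAlgebra Γ

instance : Ring M.Bosonization := inferInstanceAs (Ring (SkewMonoidAlgebra M.NicholsAlgebra Γ))

/-- The Hopf algebra structure of `𝔅(V) # kΓ`, with `Δ v = v ⊗ 1 + v_(-1) ⊗ v_(0)` for `v ∈ V`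
and `Δ γ = γ ⊗ γ` for `γ ∈ Γ`. -/
instance : HopfAlgebra k M.Bosonization := M.nicholsData.hopfAlgebra

/-- The element `v # 1` of `𝔅(V) # kΓ` given by the basis element `x` of `V`. -/
def bosonGen (x : X) : M.Bosonization :=
  (single 1 (M.toNichols (M.ι (Finsupp.single x 1))) : SkewMonoidAlgebra M.NicholsAlgebra Γ)

/-- The element `1 # γ` of `𝔅(V) # kΓ`. -/
def bosonGroup (γ : Γ) : M.Bosonization :=
  (single γ 1 : SkewMonoidAlgebra M.NicholsAlgebra Γ)

lemma comul_bosonGen (x : X) : comul (R := k) (M.bosonGen x) =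
    M.bosonGen x ⊗ₜ 1 + M.bosonGroup (M.deg x) ⊗ₜ M.bosonGen x :=
  (M.nicholsData.comulHom_single _).trans (M.nicholsData.comul_gen x)

lemma comul_bosonGroup (γ : Γ) : comul (R := k) (M.bosonGroup γ) =
    M.bosonGroup γ ⊗ₜ M.bosonGroup γ :=
  M.nicholsData.comulHom_of γ

lemma antipode_bosonGen (x : X) : HopfAlgebra.antipode k (M.bosonGen x) =
    -(M.bosonGroup (M.deg x)⁻¹ * M.bosonGen x) := by
  have := (M.nicholsData.antiHom_single _).trans (M.nicholsData.anti_gen x)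
  exact congrArg MulOpposite.unop this

lemma antipode_bosonGroup (γ : Γ) : HopfAlgebra.antipode k (M.bosonGroup γ) = M.bosonGroup γ⁻¹ :=
  congrArg MulOpposite.unop (M.nicholsData.antiHom_of γ)

end YetterDrinfeld

end Nichols

section RestrictedLie

open Coalgebra

attribute [local instance] LieRing.ofAssociativeRing

/-- For `s, t` in a Lie algebra, `jacobsonCoeff s t n j` is the coefficient of `X ^ j` in
`ad (X s + t) ^ n (s)`, where `X` is a formal variable. -/
def jacobsonCoeff {L : Type*} [LieRing L] (s t : L) : ℕ → ℕ → L
  | 0, 0 => s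
  | 0, _ + 1 => 0
  | n + 1, 0 => ⁅t, jacobsonCoeff s t n 0⁆
  | n + 1, j + 1 => ⁅s, jacobsonCoeff s t n j⁆ + ⁅t, jacobsonCoeff s t n (j + 1)⁆

/-- A restricted Lie algebra over a field of characteristic `p`: a Lie algebra with a
`p`-operation `x ↦ x^[p]`. -/
class RestrictedLieAlgebra (k L : Type*) (p : outParam ℕ) [Field k] [LieRing L]
    [LieAlgebra k L] where
  pMap : L → L
  pMap_smul : ∀ (c : k) (x : L), pMap (c • x) = c ^ p • pMap x
  ad_pMap : ∀ x : L, LieAlgebra.ad k L (pMap x) = LieAlgebra.ad k L x ^ p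
  pMap_add : ∀ x y : L, pMap (x + y) = pMap x + pMap y +
    ∑ i ∈ Finset.Ico 1 p, (i : k)⁻¹ • jacobsonCoeff x y (p - 1) (i - 1)

variable (k L : Type*) {p : ℕ} [Field k] [LieRing L] [LieAlgebra k L]
  [RestrictedLieAlgebra k L p]

/-- The relations `x ^ p = x^[p]`, `x ∈ L`, in the enveloping algebra `U(L)`. -/
inductive RestrictedEnveloping.Rel :
    UniversalEnvelopingAlgebra k L → UniversalEnvelopingAlgebra k L → Prop
  | pow (x : L) : Rel (UniversalEnvelopingAlgebra.ι k x ^ p)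
      (UniversalEnvelopingAlgebra.ι k (RestrictedLieAlgebra.pMap k x))

/-- The restricted enveloping algebra `𝔲(L) = U(L) / (x ^ p - x^[p] : x ∈ L)`. -/
def RestrictedEnveloping : Type _ := RingQuot (RestrictedEnveloping.Rel k L)

namespace RestrictedEnveloping

instance : Ring (RestrictedEnveloping k L) :=
  inferInstanceAs (Ring (RingQuot (RestrictedEnveloping.Rel k L)))

instance : Algebra k (RestrictedEnveloping k L) :=
  inferInstanceAs (Algebra k (RingQuot (RestrictedEnveloping.Rel k L)))

/-- The quotient map `U(L) → 𝔲(L)`. -/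
def mk : UniversalEnvelopingAlgebra k L →ₐ[k] RestrictedEnveloping k L :=
  RingQuot.mkAlgHom k (Rel k L)

variable {L}

/-- The canonical Lie algebra map `L → 𝔲(L)`. -/
def ι : L →ₗ⁅k⁆ RestrictedEnveloping k L :=
  ((mk k L : UniversalEnvelopingAlgebra k L →ₐ[k] RestrictedEnveloping k L) :
    UniversalEnvelopingAlgebra k L →ₗ⁅k⁆ RestrictedEnveloping k L).comp
      (UniversalEnvelopingAlgebra.ι k)

lemma mk_ι (x : L) : mk k L (UniversalEnvelopingAlgebra.ι k x) = ι k x := rfl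

lemma ι_pow (x : L) : ι k x ^ p = ι k (RestrictedLieAlgebra.pMap k x) := by
  rw [← mk_ι, ← mk_ι, ← map_pow]
  exact RingQuot.mkAlgHom_rel k (Rel.pow x)

variable {k}

/-- The universal property of `𝔲(L)`. -/
def lift {A : Type*} [Ring A] [Algebra k A] (f : L →ₗ⁅k⁆ A)
    (hf : ∀ x, f x ^ p = f (RestrictedLieAlgebra.pMap k x)) : RestrictedEnveloping k L →ₐ[k] A :=
  RingQuot.liftAlgHom k ⟨UniversalEnvelopingAlgebra.lift k f, by
    rintro _ _ ⟨x⟩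
    rw [map_pow, UniversalEnvelopingAlgebra.lift_ι_apply, UniversalEnvelopingAlgebra.lift_ι_apply,
      hf]⟩

@[simp] lemma lift_ι {A : Type*} [Ring A] [Algebra k A] (f : L →ₗ⁅k⁆ A)
    (hf : ∀ x, f x ^ p = f (RestrictedLieAlgebra.pMap k x)) (x : L) : lift f hf (ι k x) = f x := by
  rw [← mk_ι]
  exact (RingQuot.liftAlgHom_mkAlgHom_apply k _ _ _).trans
    (UniversalEnvelopingAlgebra.lift_ι_apply k f x)

lemma hom_ext {A : Type*} [Ring A] [Algebra k A] {f g : RestrictedEnveloping k L →ₐ[k] A}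
    (h : ∀ x : L, f (ι k x) = g (ι k x)) : f = g := by
  refine RingQuot.ringQuot_ext' k f g (UniversalEnvelopingAlgebra.hom_ext k ?_)
  ext x
  exact h x

lemma adjoin_ι : Algebra.adjoin k (Set.range (ι k : L → RestrictedEnveloping k L)) = ⊤ := by
  set T := Algebra.adjoin k (Set.range (ι k : L → RestrictedEnveloping k L))
  let f : L →ₗ⁅k⁆ T :=
    { toFun := fun x => ⟨ι k x, Algebra.subset_adjoin ⟨x, rfl⟩⟩
      map_add' := fun x y => Subtype.ext (map_add _ _ _)
      map_smul' := fun c x => Subtype.ext (map_smul _ _ _)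
      map_lie' := fun {x y} => Subtype.ext (LieHom.map_lie _ _ _) }
  have hf : ∀ x, f x ^ p = f (RestrictedLieAlgebra.pMap k x) :=
    fun x => Subtype.ext (ι_pow k x)
  have h : T.val.comp (lift f hf) = AlgHom.id k _ := hom_ext fun x => by simp [f]
  refine eq_top_iff.2 fun a _ => ?_
  have := DFunLike.congr_fun h a
  rw [AlgHom.id_apply] at this
  rw [← this]
  exact (lift f hf a).2

variable [hp : Fact p.Prime] [CharP k p]

/-- The comultiplication of `𝔲(L)`, for which the elements of `L` are primitive. -/
def comulHom : RestrictedEnveloping k L →ₐ[k] RestrictedEnveloping k L ⊗[k] RestrictedEnveloping k L :=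
  lift
    { toFun := fun x => ι k x ⊗ₜ 1 + 1 ⊗ₜ ι k x
      map_add' := fun x y => by
        rw [map_add, TensorProduct.add_tmul, TensorProduct.tmul_add]; abel
      map_smul' := fun c x => by
        rw [map_smul, RingHom.id_apply, smul_add, TensorProduct.smul_tmul',
          TensorProduct.tmul_smul]
      map_lie' := fun {x y} => by
        simp only [LieHom.map_lie, LieRing.of_associative_ring_bracket, TensorProduct.sub_tmul,
          TensorProduct.tmul_sub, add_mul, mul_add, Algebra.TensorProduct.tmul_mul_tmul, mul_one,
          one_mul]
        abel }
    (fun x => by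
      have hc : Commute (ι k x ⊗ₜ[k] (1 : RestrictedEnveloping k L))
          ((1 : RestrictedEnveloping k L) ⊗ₜ[k] ι k x) := by
        simp [Commute, SemiconjBy]
      obtain ⟨r, hr⟩ : ∃ r, (ι k x ⊗ₜ[k] (1 : RestrictedEnveloping k L) +
          (1 : RestrictedEnveloping k L) ⊗ₜ[k] ι k x) ^ p =
          (ι k x ⊗ₜ[k] (1 : RestrictedEnveloping k L)) ^ p +
          ((1 : RestrictedEnveloping k L) ⊗ₜ[k] ι k x) ^ p + (p : _) * r :=
        by
        obtain ⟨r, hr⟩ := hc.exists_add_pow_prime_eq hp.out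
        exact ⟨_, hr.trans (by rw [mul_assoc, mul_assoc])⟩
      have h0 : (p : RestrictedEnveloping k L ⊗[k] RestrictedEnveloping k L) = 0 := by
        rw [← map_natCast (algebraMap k _), CharP.cast_eq_zero, map_zero]
      refine hr.trans ?_
      rw [h0, zero_mul, add_zero]
      simp [Algebra.TensorProduct.tmul_pow, ι_pow])

/-- The counit of `𝔲(L)`. -/
def counitHom : RestrictedEnveloping k L →ₐ[k] k :=
  lift 0 (fun x => by simp [hp.out.ne_zero])

/-- The antipode of `𝔲(L)`: `x ↦ -x` for `x ∈ L`. -/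
def antiHom : RestrictedEnveloping k L →ₐ[k] (RestrictedEnveloping k L)ᵐᵒᵖ :=
  lift
    { toFun := fun x => MulOpposite.op (-ι k x)
      map_add' := fun x y => by
        rw [map_add, neg_add, MulOpposite.op_add]
      map_smul' := fun c x => by
        rw [map_smul, ← smul_neg, MulOpposite.op_smul, RingHom.id_apply]
      map_lie' := fun {x y} => by
        simp only [LieHom.map_lie, LieRing.of_associative_ring_bracket, ← MulOpposite.op_mul,
          ← MulOpposite.op_sub, neg_mul_neg, neg_sub] }
    (fun x => by
      have h0 : (p : RestrictedEnveloping k L) = 0 := by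
        rw [← map_natCast (algebraMap k _), CharP.cast_eq_zero, map_zero]
      change MulOpposite.op (-ι k x) ^ p = MulOpposite.op (-ι k _)
      rw [← MulOpposite.op_pow, ← ι_pow]
      congr 1
      rcases hp.out.eq_two_or_odd' with h2 | hodd
      · subst h2
        have h0' : (2 : RestrictedEnveloping k L) = 0 := by exact_mod_cast h0
        rw [neg_sq, eq_neg_iff_add_eq_zero, ← two_mul, h0', zero_mul]
      · exact hodd.neg_pow _)

lemma comulHom_ι (x : L) : comulHom (ι k x) = ι k x ⊗ₜ 1 + 1 ⊗ₜ ι k x := lift_ι _ _ x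

lemma counitHom_ι (x : L) : counitHom (ι k x) = 0 := lift_ι _ _ x

lemma antiHom_ι (x : L) : antiHom (ι k x) = MulOpposite.op (-ι k x) := lift_ι _ _ x

instance : Bialgebra k (RestrictedEnveloping k L) :=
  Bialgebra.ofAlgHom comulHom counitHom
    (hom_ext fun x => by
      simp [comulHom_ι, TensorProduct.add_tmul, TensorProduct.tmul_add,
        Algebra.TensorProduct.one_def, add_assoc])
    (hom_ext fun x => by simp [comulHom_ι, counitHom_ι])
    (hom_ext fun x => by simp [comulHom_ι, counitHom_ι])

/-- The Hopf algebra structure of `𝔲(L)`, for which the elements of `L` are primitive. -/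
instance : HopfAlgebra k (RestrictedEnveloping k L) :=
  hopfOfGenerators antiHom _ adjoin_ι
    (by
      rintro _ ⟨x, rfl⟩
      change LinearMap.mul' k _ (LinearMap.rTensor _ _ (comulHom (ι k x))) =
        algebraMap k _ (counitHom (ι k x))
      simp [comulHom_ι, counitHom_ι, antiHom_ι])
    (by
      rintro _ ⟨x, rfl⟩
      change LinearMap.mul' k _ (LinearMap.lTensor _ _ (comulHom (ι k x))) =
        algebraMap k _ (counitHom (ι k x))
      simp [comulHom_ι, counitHom_ι, antiHom_ι])

end RestrictedEnveloping

end RestrictedLie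

section AbelianSemidirect

/-- A module regarded as an abelian Lie algebra. -/
def AbelianLie (V : Type*) : Type _ := V

namespace AbelianLie

variable {k V N : Type*} [Field k] [AddCommGroup V] [Module k V] [AddCommGroup N] [Module k N]

instance : AddCommGroup (AbelianLie V) := inferInstanceAs (AddCommGroup V)

instance : Module k (AbelianLie V) := inferInstanceAs (Module k V)

instance : Bracket (AbelianLie V) (AbelianLie V) := ⟨fun _ _ => 0⟩

lemma lie_eq_zero (v w : AbelianLie V) : ⁅v, w⁆ = 0 := rfl

instance : LieRing (AbelianLie V) where
  add_lie _ _ _ := by simp [lie_eq_zero]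
  lie_add _ _ _ := by simp [lie_eq_zero]
  lie_self _ := rfl
  leibniz_lie _ _ _ := by simp [lie_eq_zero]

instance : LieAlgebra k (AbelianLie V) where
  lie_smul _ _ _ := by simp [lie_eq_zero]

/-- A vector of `V`, regarded as an element of the abelian Lie algebra `V`. -/
def of (v : V) : AbelianLie V := v

/-- An endomorphism of the vector space `V`, regarded as a derivation of the abelian Lie algebra
`V`. -/
def derivation (D : Module.End k V) : LieDerivation k (AbelianLie V) (AbelianLie V) where
  toLinearMap := (D : V →ₗ[k] V)
  leibniz' _ _ := by
    rw [lie_eq_zero, lie_eq_zero, lie_eq_zero, sub_zero]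
    exact map_zero D

/-- The action of the abelian Lie algebra `N` on the abelian Lie algebra `V`, given by pairwise
commuting endomorphisms of `V`. -/
def action (E : N →ₗ[k] Module.End k V) (hE : ∀ a b, Commute (E a) (E b)) :
    AbelianLie N →ₗ⁅k⁆ LieDerivation k (AbelianLie V) (AbelianLie V) where
  toFun a := derivation (E a)
  map_add' a b := LieDerivation.ext fun v => LinearMap.congr_fun (map_add E a b) v
  map_smul' c a := LieDerivation.ext fun v => LinearMap.congr_fun (map_smul E c a) v
  map_lie' := fun {a b} => LieDerivation.ext fun v => by
    rw [LieDerivation.lie_apply]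
    have h := LinearMap.congr_fun (hE a b).eq v
    have h0 : derivation (E (0 : N)) v = (0 : AbelianLie V) := LinearMap.congr_fun (map_zero E) v
    exact h0.trans (sub_eq_zero.2 h).symm

variable (E : N →ₗ[k] Module.End k V) (hE : ∀ a b, Commute (E a) (E b))

/-- The semidirect product `V ⋊ N`. -/
abbrev Semidirect : Type _ := AbelianLie V ⋊⁅action E hE⁆ AbelianLie N

variable {E hE}

lemma bracket_eq (x y : Semidirect E hE) :
    ⁅x, y⁆ = ⟨(E x.right y.left - E y.right x.left : V), 0⟩ := by
  rw [LieAlgebra.SemiDirectSum.lie_eq_mk]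
  simp only [lie_eq_zero, zero_add]
  rfl

variable {p : ℕ} [hp : Fact p.Prime] [CharP k p]

/-- The `p`-operation `(v, e) ↦ (e ^ (p - 1) • v, 0)` of `V ⋊ N`. -/
def semidirectPMap (p : ℕ) (x : Semidirect E hE) : Semidirect E hE :=
  ⟨((E x.right ^ (p - 1)) x.left : V), 0⟩

lemma lie_mk_zero (x : Semidirect E hE) (v : V) :
    ⁅x, (⟨v, 0⟩ : Semidirect E hE)⁆ = ⟨(E x.right v : V), 0⟩ := by
  rw [bracket_eq]
  have h : E (0 : N) (x.left : V) = 0 := LinearMap.congr_fun (map_zero E) (x.left : V)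
  have h' : (E x.right v : V) - E (0 : N) (x.left : V) = E x.right v := by rw [h, sub_zero]
  exact congrArg (fun w : V => (⟨w, 0⟩ : Semidirect E hE)) h'

lemma jacobsonCoeff_eq (x y : Semidirect E hE) (n j : ℕ) :
    jacobsonCoeff x y (n + 1) j = ⟨(n.choose j • (E x.right ^ j * E y.right ^ (n - j))
      (E y.right x.left - E x.right y.left) : V), 0⟩ := by
  induction n generalizing j with
  | zero =>
    rcases j with _ | _ | j
    · simp only [jacobsonCoeff, bracket_eq]; simp
    · have h1 : jacobsonCoeff x y (0 + 1) (0 + 1) = ⁅x, x⁆ + ⁅y, (0 : Semidirect E hE)⁆ := rfl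
      rw [h1, lie_self, lie_zero]
      simp
      rfl
    · have h1 : jacobsonCoeff x y (0 + 1) (j + 1 + 1) =
        ⁅x, (0 : Semidirect E hE)⁆ + ⁅y, (0 : Semidirect E hE)⁆ := rfl
      rw [h1, lie_zero, lie_zero]
      simp
      rfl
  | succ n ih =>
    set u : V := E y.right x.left - E x.right y.left
    rcases j with _ | j
    · have h1 : jacobsonCoeff x y (n + 1 + 1) 0 = ⁅y, jacobsonCoeff x y (n + 1) 0⁆ := rfl
      rw [h1, ih, lie_mk_zero]
      simp [pow_succ']
    · have h1 : jacobsonCoeff x y (n + 1 + 1) (j + 1) =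
        ⁅x, jacobsonCoeff x y (n + 1) j⁆ + ⁅y, jacobsonCoeff x y (n + 1) (j + 1)⁆ := rfl
      have hc := hE x.right y.right
      have e1 : E x.right (n.choose j • (E x.right ^ j * E y.right ^ (n - j)) u) =
          n.choose j • (E x.right ^ (j + 1) * E y.right ^ (n - j)) u := by
        rw [map_nsmul, ← Module.End.mul_apply, ← mul_assoc, pow_succ']
      have e2 : E y.right (n.choose (j + 1) • (E x.right ^ (j + 1) * E y.right ^ (n - (j + 1))) u) =
          n.choose (j + 1) • (E x.right ^ (j + 1) * E y.right ^ (n - j)) u := by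
        rcases Nat.lt_or_ge n (j + 1) with h | h
        · rw [Nat.choose_eq_zero_of_lt h]; simp
        · rw [map_nsmul, ← Module.End.mul_apply, ← mul_assoc,
            (hc.pow_left (j + 1)).eq.symm, mul_assoc, ← pow_succ']
          congr 4
          omega
      rw [h1, ih, ih, lie_mk_zero, lie_mk_zero, e1, e2, LieAlgebra.SemiDirectSum.add_eq_mk,
        Nat.add_sub_add_right, Nat.choose_succ_succ, add_nsmul]
      simp only [add_zero]
      rfl

lemma mk_add_mk (v w : V) : (⟨v, 0⟩ + ⟨w, 0⟩ : Semidirect E hE) = ⟨(v + w : V), 0⟩ := by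
  rw [LieAlgebra.SemiDirectSum.add_eq_mk]
  simp only [add_zero]
  rfl

/-- The inclusion of `V` in `V ⋊ N`, as a linear map. -/
def inclLeft : V →ₗ[k] Semidirect E hE where
  toFun v := ⟨v, 0⟩
  map_add' v w := (mk_add_mk v w).symm
  map_smul' c v := by
    rw [RingHom.id_apply, LieAlgebra.SemiDirectSum.smul_eq_mk]
    simp only [smul_zero]
    rfl

lemma ad_pow_succ (x y : Semidirect E hE) (n : ℕ) :
    (LieAlgebra.ad k (Semidirect E hE) x ^ (n + 1)) y =
      inclLeft ((E x.right ^ n) (E x.right y.left - E y.right x.left)) := by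
  induction n with
  | zero => exact bracket_eq x y
  | succ n ih =>
    rw [pow_succ' (LieAlgebra.ad k (Semidirect E hE) x), Module.End.mul_apply, ih,
      LieAlgebra.ad_apply, pow_succ', Module.End.mul_apply]
    exact lie_mk_zero x _

lemma inv_mul_choose {i : ℕ} (h1 : 1 ≤ i) (h2 : i < p) :
    (i : k)⁻¹ * ((p - 2).choose (i - 1) : k) = -((p - 1).choose i : k) := by
  obtain ⟨q, rfl⟩ : ∃ q, p = q + 2 := ⟨p - 2, (Nat.sub_add_cancel hp.out.two_le).symm⟩
  obtain ⟨j, rfl⟩ : ∃ j, i = j + 1 := ⟨i - 1, (Nat.sub_add_cancel h1).symm⟩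
  have h := congrArg (Nat.cast (R := k)) (Nat.add_one_mul_choose_eq q j)
  have hi : ((j + 1 : ℕ) : k) ≠ 0 := fun h0 =>
    absurd (Nat.le_of_dvd (by omega) ((CharP.cast_eq_zero_iff k (q + 2) (j + 1)).1 h0)) (by omega)
  have hq : ((q + 1 : ℕ) : k) = -1 := by
    have := CharP.cast_eq_zero k (q + 2)
    push_cast at this ⊢
    linear_combination this
  rw [inv_mul_eq_iff_eq_mul₀ hi]
  rw [Nat.cast_mul, Nat.cast_mul, hq] at h
  simp only [Nat.add_sub_cancel, show q + 2 - 1 = q + 1 by omega]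
  linear_combination -h

lemma inv_mul_choose' {i : ℕ} (h1 : 1 ≤ i) (h2 : i < p) :
    (i : k)⁻¹ * ((p - 2).choose (i - 1) : k) = ((p - 1).choose (i - 1) : k) := by
  rw [inv_mul_choose h1 h2]
  obtain ⟨q, rfl⟩ : ∃ q, p = q + 1 := ⟨p - 1, (Nat.sub_add_cancel hp.out.one_le).symm⟩
  obtain ⟨j, rfl⟩ : ∃ j, i = j + 1 := ⟨i - 1, (Nat.sub_add_cancel h1).symm⟩
  have h : (((q + 1).choose (j + 1) : ℕ) : k) = 0 :=
    (CharP.cast_eq_zero_iff k (q + 1) _).2 (hp.out.dvd_choose_self (by omega) h2)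
  rw [Nat.choose_succ_succ, Nat.cast_add] at h
  simp only [Nat.add_sub_cancel]
  linear_combination -h

lemma add_pow_apply {A B : Module.End k V} (hAB : Commute A B) (v w : V) :
    ((A + B) ^ (p - 1)) (v + w) = (A ^ (p - 1)) v + (B ^ (p - 1)) w +
      ∑ i ∈ Finset.Ico 1 p, (i : k)⁻¹ •
        ((p - 2).choose (i - 1) • (A ^ (i - 1) * B ^ (p - 2 - (i - 1))) (B v - A w)) := by
  have h : ∀ u : V, ((A + B) ^ (p - 1)) u = ∑ m ∈ Finset.range p,
      ((p - 1).choose m : k) • (A ^ m * B ^ (p - 1 - m)) u := fun u => by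
    rw [hAB.add_pow, Nat.sub_add_cancel hp.out.one_le, LinearMap.sum_apply]
    refine Finset.sum_congr rfl fun m _ => ?_
    rw [← nsmul_eq_mul', LinearMap.smul_apply, Nat.cast_smul_eq_nsmul]
  have hs : ∑ i ∈ Finset.Ico 1 p, (i : k)⁻¹ •
        ((p - 2).choose (i - 1) • (A ^ (i - 1) * B ^ (p - 2 - (i - 1))) (B v - A w)) =
      ∑ i ∈ Finset.Ico 1 p, (((p - 1).choose (i - 1) : k) • (A ^ (i - 1) * B ^ (p - 1 - (i - 1))) v +
        ((p - 1).choose i : k) • (A ^ i * B ^ (p - 1 - i)) w) := by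
    refine Finset.sum_congr rfl fun i hi => ?_
    obtain ⟨h1, h2⟩ := Finset.mem_Ico.1 hi
    have e1 : (A ^ (i - 1) * B ^ (p - 2 - (i - 1))) (B v) =
        (A ^ (i - 1) * B ^ (p - 1 - (i - 1))) v := by
      rw [← Module.End.mul_apply, mul_assoc, ← pow_succ]
      congr 3
      omega
    have e2 : (A ^ (i - 1) * B ^ (p - 2 - (i - 1))) (A w) = (A ^ i * B ^ (p - 1 - i)) w := by
      rw [← Module.End.mul_apply, mul_assoc, ← (hAB.pow_right _).eq, ← mul_assoc, ← pow_succ]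
      congr 3
      all_goals omega
    rw [← Nat.cast_smul_eq_nsmul k, smul_smul, map_sub, e1, e2, smul_sub,
      inv_mul_choose h1 h2, neg_smul, neg_smul, sub_neg_eq_add, ← neg_smul, ← inv_mul_choose h1 h2,
      inv_mul_choose' h1 h2]
  rw [hs, Finset.sum_add_distrib, map_add, h, h]
  obtain ⟨q, hq⟩ : ∃ q, p = q + 1 := ⟨p - 1, (Nat.sub_add_cancel hp.out.one_le).symm⟩
  have s1 : ∑ i ∈ Finset.Ico 1 p, ((p - 1).choose (i - 1) : k) •
      (A ^ (i - 1) * B ^ (p - 1 - (i - 1))) v = ∑ m ∈ Finset.range q,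
      ((p - 1).choose m : k) • (A ^ m * B ^ (p - 1 - m)) v := by
    rw [hq, Finset.sum_Ico_eq_sum_range]
    simp
  have s2 : ∑ m ∈ Finset.range p, ((p - 1).choose m : k) • (A ^ m * B ^ (p - 1 - m)) w =
      (B ^ (p - 1)) w + ∑ i ∈ Finset.Ico 1 p, ((p - 1).choose i : k) •
        (A ^ i * B ^ (p - 1 - i)) w := by
    rw [Finset.range_eq_Ico, Finset.sum_eq_sum_Ico_succ_bot hp.out.pos]
    simp
  have s3 : ∑ m ∈ Finset.range p, ((p - 1).choose m : k) • (A ^ m * B ^ (p - 1 - m)) v =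
      ∑ m ∈ Finset.range q, ((p - 1).choose m : k) • (A ^ m * B ^ (p - 1 - m)) v +
        (A ^ (p - 1)) v := by
    conv_lhs => rw [hq]
    rw [Finset.sum_range_succ]
    simp [hq]
  rw [s1, s2, s3]
  abel

/-- The restricted structure of `V ⋊ N`, when the elements of `N` act by endomorphisms of `V` whose
`p`-th power is zero. This `p`-operation is the unique one that is zero on `V` and on `N`. -/
abbrev restricted (hE' : ∀ a, E a ^ p = 0) : RestrictedLieAlgebra k (Semidirect E hE) p where
  pMap := semidirectPMap p
  pMap_smul c x := by
    have h (a : N) (v : V) : (E (c • a) ^ (p - 1)) (c • v) = c ^ p • (E a ^ (p - 1)) v := by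
      rw [map_smul E, smul_pow, LinearMap.smul_apply, map_smul, smul_smul, ← pow_succ,
        Nat.sub_add_cancel hp.out.one_le]
    exact (congrArg inclLeft (h x.right x.left)).trans (map_smul inclLeft _ _)
  ad_pMap x := by
    obtain ⟨q, hq⟩ : ∃ q, p = q + 1 := ⟨p - 1, (Nat.sub_add_cancel hp.out.one_le).symm⟩
    have h (a b : N) (v w : V) : E (0 : N) w - E b ((E a ^ (p - 1)) v) =
        (E a ^ q) (E a w - E b v) := by
      have ha := hE' a
      rw [hq] at ha
      rw [map_zero, LinearMap.zero_apply, map_sub, ← Module.End.mul_apply (E a ^ q),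
        ← pow_succ, ha, hq, Nat.add_sub_cancel, LinearMap.zero_apply,
        ← Module.End.mul_apply, ← Module.End.mul_apply, ((hE a b).pow_left q).eq]
    refine LinearMap.ext fun y => ?_
    have e : (LieAlgebra.ad k (Semidirect E hE) x ^ p) y =
      (LieAlgebra.ad k (Semidirect E hE) x ^ (q + 1)) y := by rw [← hq]
    rw [e, ad_pow_succ, LieAlgebra.ad_apply, bracket_eq]
    exact congrArg inclLeft (h x.right y.right x.left y.left)
  pMap_add x y := by
    have hJ : ∀ i, jacobsonCoeff x y (p - 1) (i - 1) =
        inclLeft ((p - 2).choose (i - 1) • (E x.right ^ (i - 1) * E y.right ^ (p - 2 - (i - 1)))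
          (E y.right x.left - E x.right y.left)) := fun i => by
      rw [show p - 1 = (p - 2) + 1 by have := hp.out.two_le; omega]
      exact jacobsonCoeff_eq x y (p - 2) (i - 1)
    simp only [hJ]
    have h (a b : N) (v w : V) : (E (a + b) ^ (p - 1)) (v + w) = (E a ^ (p - 1)) v +
        (E b ^ (p - 1)) w + ∑ i ∈ Finset.Ico 1 p, (i : k)⁻¹ • ((p - 2).choose (i - 1) •
          (E a ^ (i - 1) * E b ^ (p - 2 - (i - 1))) (E b v - E a w)) := by
      rw [map_add E]
      exact add_pow_apply (hE a b) v w
    refine (congrArg inclLeft (h x.right y.right x.left y.left)).trans ?_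
    rw [map_add, map_add, map_sum]
    simp only [map_smul]
    rfl

end AbelianLie

end AbelianSemidirect

section HopfSubalgebra

open Coalgebra

/-- A subalgebra `K` of a Hopf algebra is a Hopf subalgebra if `Δ (K) ⊆ K ⊗ K` and `S (K) ⊆ K`. -/
class IsHopfSubalgebra {k H : Type*} [Field k] [Ring H] [HopfAlgebra k H]
    (K : Subalgebra k H) : Prop where
  comul_mem : ∀ b ∈ K, comul (R := k) b ∈ (Algebra.TensorProduct.map K.val K.val).range
  antipode_mem : ∀ b ∈ K, HopfAlgebra.antipode k b ∈ K

namespace IsHopfSubalgebra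

variable {k H : Type*} [Field k] [Ring H] [HopfAlgebra k H] (K : Subalgebra k H)

lemma val_tensor_injective :
    Function.Injective (Algebra.TensorProduct.map K.val K.val) :=
  TensorProduct.map_injective_of_flat_flat K.val.toLinearMap K.val.toLinearMap
    Subtype.val_injective Subtype.val_injective

lemma val_tensor_tensor_injective :
    Function.Injective (Algebra.TensorProduct.map K.val
      (Algebra.TensorProduct.map K.val K.val)) :=
  TensorProduct.map_injective_of_flat_flat K.val.toLinearMap
    (Algebra.TensorProduct.map K.val K.val).toLinearMap
    Subtype.val_injective (val_tensor_injective K)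

variable [hK : IsHopfSubalgebra K]

/-- The restriction of the comultiplication to a Hopf subalgebra. -/
def comulHom : K →ₐ[k] K ⊗[k] K :=
  (AlgEquiv.ofInjective _ (val_tensor_injective K)).symm.toAlgHom.comp
    (((Bialgebra.comulAlgHom k H).comp K.val).codRestrict
      (Algebra.TensorProduct.map K.val K.val).range fun b => hK.comul_mem b b.2)

lemma map_comulHom (b : K) :
    Algebra.TensorProduct.map K.val K.val (comulHom K b) = comul (R := k) (b : H) :=
  congrArg Subtype.val
    ((AlgEquiv.ofInjective _ (val_tensor_injective K)).apply_symm_apply _)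

lemma map_comp_comulHom : (Algebra.TensorProduct.map K.val K.val).comp (comulHom K) =
    (Bialgebra.comulAlgHom k H).comp K.val :=
  AlgHom.ext (map_comulHom K)

/-- The restriction of the counit to a Hopf subalgebra. -/
def counitHom : K →ₐ[k] k := (Bialgebra.counitAlgHom k H).comp K.val

lemma map_val_rTensor (z : K ⊗[k] K) :
    Algebra.TensorProduct.map K.val (Algebra.TensorProduct.map K.val K.val)
      (Algebra.TensorProduct.assoc k k k K K K
        (Algebra.TensorProduct.map (comulHom K) (AlgHom.id k K) z)) =
    Algebra.TensorProduct.assoc k k k H H H (Algebra.TensorProduct.map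
      (Bialgebra.comulAlgHom k H) (AlgHom.id k H) (Algebra.TensorProduct.map K.val K.val z)) := by
  induction z with
  | zero => simp
  | add x y hx hy => simp only [map_add, hx, hy]
  | tmul b c =>
    have h (w : K ⊗[k] K) : Algebra.TensorProduct.map K.val (Algebra.TensorProduct.map K.val K.val)
        (Algebra.TensorProduct.assoc k k k K K K (w ⊗ₜ c)) =
        Algebra.TensorProduct.assoc k k k H H H
          (Algebra.TensorProduct.map K.val K.val w ⊗ₜ (c : H)) := by
      induction w with
      | zero => simp
      | add x y hx hy => simp only [map_add, TensorProduct.add_tmul, hx, hy]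
      | tmul x y => simp
    simp only [Algebra.TensorProduct.map_tmul, h, map_comulHom, AlgHom.id_apply]
    rfl

lemma map_val_lTensor (z : K ⊗[k] K) :
    Algebra.TensorProduct.map K.val (Algebra.TensorProduct.map K.val K.val)
      (Algebra.TensorProduct.map (AlgHom.id k K) (comulHom K) z) =
    Algebra.TensorProduct.map (AlgHom.id k H) (Bialgebra.comulAlgHom k H)
      (Algebra.TensorProduct.map K.val K.val z) := by
  induction z with
  | zero => simp
  | add x y hx hy => simp only [map_add, hx, hy]
  | tmul b c =>
    simp only [Algebra.TensorProduct.map_tmul, map_comulHom, AlgHom.id_apply]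
    rfl

instance : Bialgebra k K :=
  Bialgebra.ofAlgHom (comulHom K) (counitHom K)
    (AlgHom.ext fun b => val_tensor_tensor_injective K <| by
      refine (map_val_rTensor K (comulHom K b)).trans ?_
      refine Eq.trans ?_ (map_val_lTensor K (comulHom K b)).symm
      rw [map_comulHom]
      exact Coalgebra.coassoc_apply (R := k) (b : H))
    (AlgHom.ext fun b => by
      have h (z : K ⊗[k] K) : Algebra.TensorProduct.map (AlgHom.id k k) K.val
          (Algebra.TensorProduct.map (counitHom K) (AlgHom.id k K) z) =
          Algebra.TensorProduct.map (Bialgebra.counitAlgHom k H) (AlgHom.id k H)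
            (Algebra.TensorProduct.map K.val K.val z) := by
        induction z with
        | zero => simp
        | add x y hx hy => simp only [map_add, hx, hy]
        | tmul x y => simp [counitHom]
      have hi : Function.Injective (Algebra.TensorProduct.map (AlgHom.id k k) K.val) :=
        TensorProduct.map_injective_of_flat_flat LinearMap.id K.val.toLinearMap
          Function.injective_id Subtype.val_injective
      refine hi ((h (comulHom K b)).trans ?_)
      rw [map_comulHom]
      exact (Coalgebra.rTensor_counit_comul (R := k) (b : H)).trans (by simp))
    (AlgHom.ext fun b => by
      have h (z : K ⊗[k] K) : Algebra.TensorProduct.map K.val (AlgHom.id k k)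
          (Algebra.TensorProduct.map (AlgHom.id k K) (counitHom K) z) =
          Algebra.TensorProduct.map (AlgHom.id k H) (Bialgebra.counitAlgHom k H)
            (Algebra.TensorProduct.map K.val K.val z) := by
        induction z with
        | zero => simp
        | add x y hx hy => simp only [map_add, hx, hy]
        | tmul x y => simp [counitHom]
      have hi : Function.Injective (Algebra.TensorProduct.map K.val (AlgHom.id k k)) :=
        TensorProduct.map_injective_of_flat_flat K.val.toLinearMap LinearMap.id
          Subtype.val_injective Function.injective_id
      refine hi ((h (comulHom K b)).trans ?_)
      rw [map_comulHom]
      exact (Coalgebra.lTensor_counit_comul (R := k) (b : H)).trans (by simp))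

instance : HopfAlgebra k K where
  antipode := ((HopfAlgebra.antipode k (A := H)).comp K.val.toLinearMap).codRestrict
    (Subalgebra.toSubmodule K) fun b => hK.antipode_mem b b.2
  mul_antipode_rTensor_comul := LinearMap.ext fun b => Subtype.ext <| by
    have h (z : K ⊗[k] K) : ((LinearMap.mul' k K (LinearMap.rTensor K
        (((HopfAlgebra.antipode k (A := H)).comp K.val.toLinearMap).codRestrict
        (Subalgebra.toSubmodule K) fun b => hK.antipode_mem b b.2) z) : K) : H) =
        LinearMap.mul' k H (LinearMap.rTensor H (HopfAlgebra.antipode k)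
          (Algebra.TensorProduct.map K.val K.val z)) := by
      induction z with
      | zero => simp
      | add x y hx hy => simp only [map_add, Subalgebra.coe_add, hx, hy]
      | tmul x y => simp; rfl
    refine (h (comulHom K b)).trans ?_
    rw [map_comulHom]
    exact HopfAlgebra.mul_antipode_rTensor_comul_apply (R := k) (b : H)
  mul_antipode_lTensor_comul := LinearMap.ext fun b => Subtype.ext <| by
    have h (z : K ⊗[k] K) : ((LinearMap.mul' k K (LinearMap.lTensor K
        (((HopfAlgebra.antipode k (A := H)).comp K.val.toLinearMap).codRestrict
        (Subalgebra.toSubmodule K) fun b => hK.antipode_mem b b.2) z) : K) : H) =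
        LinearMap.mul' k H (LinearMap.lTensor H (HopfAlgebra.antipode k)
          (Algebra.TensorProduct.map K.val K.val z)) := by
      induction z with
      | zero => simp
      | add x y hx hy => simp only [map_add, Subalgebra.coe_add, hx, hy]
      | tmul x y => simp; rfl
    refine (h (comulHom K b)).trans ?_
    rw [map_comulHom]
    exact HopfAlgebra.mul_antipode_lTensor_comul_apply (R := k) (b : H)

/-- The inclusion of a Hopf subalgebra. -/
def inclusion : K →ₐc[k] H :=
  BialgHom.ofAlgHom K.val rfl (map_comp_comulHom K)

end IsHopfSubalgebra

end HopfSubalgebra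

section ExactSequences

open Coalgebra

variable {k A C B : Type*} [Field k] [Ring A] [HopfAlgebra k A] [Ring C] [HopfAlgebra k C]
  [Ring B] [HopfAlgebra k B]

/-- The sequence of Hopf algebra maps `k → A → C → B → k` is exact: `ι` is injective, `π` is
surjective, `ker π = C ι(A)⁺` and `ι(A)` is the subalgebra of coinvariants
`{c | (id ⊗ π) Δ c = c ⊗ 1}`. -/
structure IsHopfExact (ι : A →ₐc[k] C) (π : C →ₐc[k] B) : Prop where
  injective : Function.Injective ι
  surjective : Function.Surjective π
  eq_zero_iff : ∀ c, π c = 0 ↔ c ∈ Ideal.span (ι '' {a | counit (R := k) a = 0})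
  mem_range_iff : ∀ c, c ∈ Set.range ι ↔
    LinearMap.lTensor C (π : C →ₗ[k] B) (comul (R := k) c) = c ⊗ₜ[k] (1 : B)

/-- An exact sequence `k → A → C → B → k` is abelian if `A` is commutative and `B` is
cocommutative. -/
structure IsAbelianHopfExact (ι : A →ₐc[k] C) (π : C →ₐc[k] B) : Prop
    extends IsHopfExact ι π where
  mul_comm : ∀ a b : A, a * b = b * a
  isCocomm : IsCocomm k B

/-- `s` and `r` are cleaving maps of the exact sequence `k → A → C → B → k`: `s` is a unit
preserving, convolution invertible, right `B`-colinear section of `π`, and `r` is a counit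
preserving, convolution invertible, left `A`-linear retraction of `ι`, and `r s = ε 1`. -/
structure AreCleavingMaps (ι : A →ₐc[k] C) (π : C →ₐc[k] B) (s : B →ₗ[k] C) (r : C →ₗ[k] A) :
    Prop where
  section_one : s 1 = 1
  proj_section : ∀ b, π (s b) = b
  section_colinear : ∀ b, LinearMap.lTensor C (π : C →ₗ[k] B) (comul (R := k) (s b)) =
    LinearMap.rTensor B s (comul (R := k) b)
  section_isUnit : IsUnit (WithConv.toConv s)
  counit_retraction : ∀ c, counit (R := k) (r c) = counit (R := k) c
  retraction_incl : ∀ a, r (ι a) = a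
  retraction_linear : ∀ a c, r (ι a * c) = a * r c
  retraction_isUnit : IsUnit (WithConv.toConv r)
  retraction_section : ∀ b, r (s b) = algebraMap k A (counit b)

/-- The exact sequence `k → A → C → B → k` is split: it has cleaving maps `s` and `r` such that
`s` is an algebra map and `r` is a coalgebra map. -/
def IsSplitHopfSequence (ι : A →ₐc[k] C) (π : C →ₐc[k] B) : Prop :=
  ∃ (s : B →ₐ[k] C) (r : C →ₗc[k] A), AreCleavingMaps ι π s.toLinearMap (r : C →ₗ[k] A)

end ExactSequences

/-- The data defining the braided vector space `𝒱(𝟏, 𝐚)` and its realization: the number `t` of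
blocks, the number `s = θ - t` of points, the family `𝐚 = (a_hj)` with entries in `𝔽_p`, for
points `h` and blocks `j`, and a positive multiple `f` of `p`. -/
structure BlockPointDatum (p : ℕ) where
  t : ℕ
  s : ℕ
  t_pos : 0 < t
  s_pos : 0 < s
  a : Fin s → Fin t → ZMod p
  f : ℕ
  f_pos : 0 < f
  dvd_f : p ∣ f

namespace BlockPointDatum

section Realization

variable {p : ℕ} (D : BlockPointDatum p)

/-- The index set `𝕀_θ`: the blocks and the points. -/
abbrev Index : Type := Fin D.t ⊕ Fin D.s

/-- The basis of `𝒱(𝟏, 𝐚)`: `inl i` is `x_i`, for `i ∈ 𝕀_θ`, and `inr j` is `y_j`, for a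
block `j`. -/
abbrev Basis : Type := D.Index ⊕ Fin D.t

/-- The group `Γ = (ℤ/f)^θ`, written multiplicatively. -/
abbrev Grp : Type := Multiplicative (D.Index → ZMod D.f)

/-- The generator `g_i` of `Γ`. -/
def grp (i : D.Index) : D.Grp := Multiplicative.ofAdd (Pi.single i 1)

/-- The element `c_ij` of `𝔽_p` such that `g_i • y_j = y_j + c_ij x_j`. -/
def coeff (i : D.Index) (j : Fin D.t) : ZMod p :=
  match i with
  | Sum.inl i => if i = j then 1 else 0
  | Sum.inr h => D.a h j

variable (k : Type*) [Field k] [CharP k p]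

/-- For `γ = ∏ g_i ^ (n_i)`, the scalar `∑ n_i c_ij`, so that `γ • y_j = y_j + (∑ n_i c_ij) x_j`. -/
def shift (γ : D.Grp) (j : Fin D.t) : k :=
  ∑ i, ZMod.castHom (dvd_refl p) k (ZMod.castHom D.dvd_f (ZMod p) (Multiplicative.toAdd γ i) *
    D.coeff i j)

lemma shift_one (j : Fin D.t) : D.shift k 1 j = 0 := by simp [shift]

lemma shift_mul (γ δ : D.Grp) (j : Fin D.t) :
    D.shift k (γ * δ) j = D.shift k γ j + D.shift k δ j := by
  simp only [shift, toAdd_mul, Pi.add_apply, map_add, add_mul, Finset.sum_add_distrib]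

lemma shift_grp (i : D.Index) (j : Fin D.t) :
    D.shift k (D.grp i) j = ZMod.castHom (dvd_refl p) k (D.coeff i j) := by
  rw [shift, Finset.sum_eq_single i]
  · rw [grp, toAdd_ofAdd, Pi.single_eq_same, map_one, one_mul]
  · intro b _ hb
    simp [grp, Pi.single_eq_of_ne hb]
  · simp

/-- The image under `γ ∈ Γ` of a basis element of `𝒱(𝟏, 𝐚)`. -/
def actBasis (γ : D.Grp) : D.Basis → D.Basis →₀ k
  | Sum.inl i => Finsupp.single (Sum.inl i) 1
  | Sum.inr j => Finsupp.single (Sum.inr j) 1 +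
      D.shift k γ j • Finsupp.single (Sum.inl (Sum.inl j)) 1

/-- The braided vector space `𝒱(𝟏, 𝐚)`, realized as a Yetter-Drinfeld module over `kΓ`:
`γ • x_i = x_i`, `deg x_i = g_i` for `i ∈ 𝕀_θ`, and, for a block `j`, `deg y_j = g_j`,
`g_j • y_j = y_j + x_j`, `g_i • y_j = y_j` for any other block `i`, and
`g_h • y_j = y_j + a_hj x_j` for any point `h`. -/
def braidedSpace : YetterDrinfeld k D.Grp D.Basis where
  action :=
    { toFun := fun γ => Finsupp.linearCombination k (D.actBasis k γ)
      map_one' := by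
        ext b : 1
        ext
        rcases b with i | j <;> simp [actBasis, shift_one]
      map_mul' := fun γ δ => by
        ext b : 1
        ext
        rcases b with i | j
        · simp [actBasis]
        · simp [actBasis, shift_mul, add_smul, add_assoc] }
  deg
    | Sum.inl i => D.grp i
    | Sum.inr j => D.grp (Sum.inl j)
  deg_eq γ b b' h := by
    rcases b with i | j
    · by_cases e : Sum.inl i = b'
      · rw [← e]
      · exact absurd (by simp [actBasis, e]) h
    · by_cases e : Sum.inr j = b'
      · rw [← e]
      · by_cases e' : Sum.inl (Sum.inl j) = b'
        · rw [← e']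
        · exact absurd (by simp [actBasis, e, e']) h

/-- The basis element `x_i` of `𝒱(𝟏, 𝐚)`, for `i ∈ 𝕀_θ`. -/
def vecX (i : D.Index) : D.Basis →₀ k := Finsupp.single (Sum.inl i) 1

/-- The basis element `y_j` of `𝒱(𝟏, 𝐚)`, for a block `j`. -/
def vecY (j : Fin D.t) : D.Basis →₀ k := Finsupp.single (Sum.inr j) 1

lemma action_vecX (γ : D.Grp) (i : D.Index) :
    (D.braidedSpace k).action γ (D.vecX k i) = D.vecX k i := by
  simp [braidedSpace, vecX, actBasis]

lemma action_vecY (i : D.Index) (j : Fin D.t) :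
    (D.braidedSpace k).action (D.grp i) (D.vecY k j) =
      D.vecY k j + ZMod.castHom (dvd_refl p) k (D.coeff i j) • D.vecX k (Sum.inl j) := by
  simp [braidedSpace, vecX, vecY, actBasis, shift_grp]

lemma braiding_X_X (i l : D.Index) :
    (D.braidedSpace k).braiding (D.vecX k i ⊗ₜ D.vecX k l) = D.vecX k l ⊗ₜ D.vecX k i :=
  ((D.braidedSpace k).braiding_single (Sum.inl i) _).trans
    (congrArg (· ⊗ₜ[k] D.vecX k i) (D.action_vecX k _ l))

lemma braiding_Y_X (j : Fin D.t) (l : D.Index) :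
    (D.braidedSpace k).braiding (D.vecY k j ⊗ₜ D.vecX k l) = D.vecX k l ⊗ₜ D.vecY k j :=
  ((D.braidedSpace k).braiding_single (Sum.inr j) _).trans
    (congrArg (· ⊗ₜ[k] D.vecY k j) (D.action_vecX k _ l))

/-- On a block, `c (x_j ⊗ y_j) = (y_j + x_j) ⊗ x_j`. -/
lemma braiding_X_Y_self (j : Fin D.t) :
    (D.braidedSpace k).braiding (D.vecX k (Sum.inl j) ⊗ₜ D.vecY k j) =
      (D.vecY k j + D.vecX k (Sum.inl j)) ⊗ₜ D.vecX k (Sum.inl j) :=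
  ((D.braidedSpace k).braiding_single (Sum.inl (Sum.inl j)) _).trans
    (congrArg (· ⊗ₜ[k] D.vecX k (Sum.inl j)) ((D.action_vecY k (Sum.inl j) j).trans
      (by simp [coeff])))

/-- On a block, `c (y_j ⊗ y_j) = (y_j + x_j) ⊗ y_j`. -/
lemma braiding_Y_Y_self (j : Fin D.t) :
    (D.braidedSpace k).braiding (D.vecY k j ⊗ₜ D.vecY k j) =
      (D.vecY k j + D.vecX k (Sum.inl j)) ⊗ₜ D.vecY k j :=
  ((D.braidedSpace k).braiding_single (Sum.inr j) _).trans
    (congrArg (· ⊗ₜ[k] D.vecY k j) ((D.action_vecY k (Sum.inl j) j).trans (by simp [coeff])))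

/-- For blocks `i ≠ j`, `c (x_i ⊗ y_j) = y_j ⊗ x_i`. -/
lemma braiding_X_Y_of_ne {i j : Fin D.t} (h : i ≠ j) :
    (D.braidedSpace k).braiding (D.vecX k (Sum.inl i) ⊗ₜ D.vecY k j) =
      D.vecY k j ⊗ₜ D.vecX k (Sum.inl i) :=
  ((D.braidedSpace k).braiding_single (Sum.inl (Sum.inl i)) _).trans
    (congrArg (· ⊗ₜ[k] D.vecX k (Sum.inl i)) ((D.action_vecY k (Sum.inl i) j).trans
      (by simp [coeff, h])))

/-- For blocks `i ≠ j`, `c (y_i ⊗ y_j) = y_j ⊗ y_i`. -/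
lemma braiding_Y_Y_of_ne {i j : Fin D.t} (h : i ≠ j) :
    (D.braidedSpace k).braiding (D.vecY k i ⊗ₜ D.vecY k j) = D.vecY k j ⊗ₜ D.vecY k i :=
  ((D.braidedSpace k).braiding_single (Sum.inr i) _).trans
    (congrArg (· ⊗ₜ[k] D.vecY k i) ((D.action_vecY k (Sum.inl i) j).trans (by simp [coeff, h])))

/-- For a point `h` and a block `j`, `c (x_h ⊗ y_j) = (y_j + a_hj x_j) ⊗ x_h`. -/
lemma braiding_point_Y (h : Fin D.s) (j : Fin D.t) :
    (D.braidedSpace k).braiding (D.vecX k (Sum.inr h) ⊗ₜ D.vecY k j) =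
      (D.vecY k j + ZMod.castHom (dvd_refl p) k (D.a h j) • D.vecX k (Sum.inl j)) ⊗ₜ
        D.vecX k (Sum.inr h) :=
  ((D.braidedSpace k).braiding_single (Sum.inl (Sum.inr h)) _).trans
    (congrArg (· ⊗ₜ[k] D.vecX k (Sum.inr h)) (D.action_vecY k (Sum.inr h) j))

/-- The Hopf algebra `H = 𝔅(𝒱(𝟏, 𝐚)) # kΓ`. -/
abbrev HopfH : Type _ := (D.braidedSpace k).Bosonization

/-- The element `x_i` of `H`, for `i ∈ 𝕀_θ`. -/
def x (i : D.Index) : D.HopfH k := (D.braidedSpace k).bosonGen (Sum.inl i)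

/-- The element `y_j` of `H`, for a block `j`. -/
def y (j : Fin D.t) : D.HopfH k := (D.braidedSpace k).bosonGen (Sum.inr j)

/-- The element `g_i` of `H`, for `i ∈ 𝕀_θ`. -/
def g (i : D.Index) : D.HopfH k := (D.braidedSpace k).bosonGroup (D.grp i)

/-- The subalgebra `K = k⟨x_1, …, x_t, g_1, …, g_θ⟩` of `H`. -/
def subalgebraK : Subalgebra k (D.HopfH k) :=
  Algebra.adjoin k (Set.range (fun j : Fin D.t => D.x k (Sum.inl j)) ∪ Set.range (D.g k))

lemma x_mem (j : Fin D.t) : D.x k (Sum.inl j) ∈ D.subalgebraK k :=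
  Algebra.subset_adjoin (Or.inl ⟨j, rfl⟩)

lemma g_mem (i : D.Index) : D.g k i ∈ D.subalgebraK k := Algebra.subset_adjoin (Or.inr ⟨i, rfl⟩)

lemma grp_pow (i : D.Index) : D.grp i ^ D.f = 1 := by
  rw [grp, ← ofAdd_nsmul, ← Pi.single_smul]
  simp

lemma g_inv_mem (i : D.Index) : (D.braidedSpace k).bosonGroup (D.grp i)⁻¹ ∈ D.subalgebraK k := by
  have h : (D.grp i)⁻¹ = D.grp i ^ (D.f - 1) := by
    rw [inv_eq_iff_mul_eq_one, ← pow_succ', Nat.sub_add_cancel D.f_pos, grp_pow]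
  have h' : (D.braidedSpace k).bosonGroup (D.grp i ^ (D.f - 1)) = D.g k i ^ (D.f - 1) :=
    map_pow (SkewMonoidAlgebra.of (D.braidedSpace k).NicholsAlgebra D.Grp) _ _
  rw [h, h']
  exact pow_mem (D.g_mem k i) _

instance : IsHopfSubalgebra (D.subalgebraK k) where
  comul_mem := by
    have h : D.subalgebraK k ≤ (Algebra.TensorProduct.map (D.subalgebraK k).val
        (D.subalgebraK k).val).range.comap (Bialgebra.comulAlgHom k (D.HopfH k)) := by
      refine Algebra.adjoin_le ?_
      rintro _ (⟨j, rfl⟩ | ⟨i, rfl⟩)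
      · exact ⟨⟨_, D.x_mem k j⟩ ⊗ₜ 1 + ⟨_, D.g_mem k (Sum.inl j)⟩ ⊗ₜ ⟨_, D.x_mem k j⟩,
          ((D.braidedSpace k).comul_bosonGen (Sum.inl (Sum.inl j))).symm⟩
      · exact ⟨⟨_, D.g_mem k i⟩ ⊗ₜ ⟨_, D.g_mem k i⟩,
          ((D.braidedSpace k).comul_bosonGroup (D.grp i)).symm⟩
    exact fun b hb => h hb
  antipode_mem := by
    have h : D.subalgebraK k ≤ (D.subalgebraK k).op.comap (D.braidedSpace k).nicholsData.antiHom := by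
      refine Algebra.adjoin_le ?_
      rintro _ (⟨j, rfl⟩ | ⟨i, rfl⟩)
      · have h : HopfAlgebra.antipode k ((D.braidedSpace k).bosonGen (Sum.inl (Sum.inl j))) ∈
            D.subalgebraK k := by
          rw [(D.braidedSpace k).antipode_bosonGen]
          exact neg_mem (mul_mem (D.g_inv_mem k (Sum.inl j)) (D.x_mem k j))
        exact h
      · have h : HopfAlgebra.antipode k ((D.braidedSpace k).bosonGroup (D.grp i)) ∈
            D.subalgebraK k := by
          rw [(D.braidedSpace k).antipode_bosonGroup]
          exact D.g_inv_mem k i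
        exact h
    exact fun b hb => h hb

end Realization

section LieAlgebra

variable {p : ℕ} (D : BlockPointDatum p)

/-- The ghost `𝒢_hj ∈ {0, …, p - 1}`: the representative of `-2 a_hj`. -/
def ghost (h : Fin D.s) (j : Fin D.t) : ℕ := (-2 * D.a h j).val

/-- The index set of the basis `v_{h, m}` of `V(𝒢)`: the pairs of a point `h` and of a family
`m = (m_j)` with `0 ≤ m_j ≤ 𝒢_hj` for all blocks `j`. -/
abbrev Weight : Type := Σ h : Fin D.s, ∀ j : Fin D.t, Fin (D.ghost h j + 1)

variable (k : Type*) [Field k]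

/-- The vector space `V(𝒢)`. -/
abbrev VG : Type _ := D.Weight →₀ k

/-- The action of `E_j` on the basis of `V(𝒢)`: `v_{h, m} ↦ v_{h, m + e_j}` if `m_j < 𝒢_hj`, and
`v_{h, m} ↦ 0` if `m_j = 𝒢_hj`. -/
def raiseBasis (j : Fin D.t) (w : D.Weight) : D.VG k :=
  if hw : (w.2 j : ℕ) < D.ghost w.1 j then
    Finsupp.single ⟨w.1, Function.update w.2 j ⟨w.2 j + 1, Nat.succ_lt_succ hw⟩⟩ 1
  else 0

/-- The action of `E_j` on `V(𝒢)`. -/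
def raise (j : Fin D.t) : Module.End k (D.VG k) := Finsupp.linearCombination k (D.raiseBasis k j)

lemma raise_single (j : Fin D.t) (w : D.Weight) :
    D.raise k j (Finsupp.single w 1) = D.raiseBasis k j w := by
  simp [raise]

lemma raise_commute (i j : Fin D.t) : Commute (D.raise k i) (D.raise k j) := by
  rcases eq_or_ne i j with rfl | hij
  · exact Commute.refl _
  refine Finsupp.lhom_ext' fun w => LinearMap.ext_ring ?_
  simp only [LinearMap.comp_apply, Module.End.mul_apply, Finsupp.lsingle_apply, raise_single]
  by_cases hi : (w.2 i : ℕ) < D.ghost w.1 i <;> by_cases hj : (w.2 j : ℕ) < D.ghost w.1 j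
  all_goals simp [raiseBasis, hi, hj, raise_single, hij, hij.symm, Function.update_comm hij]

lemma raise_pow_single (j : Fin D.t) (n : ℕ) (w : D.Weight) (h : D.ghost w.1 j < w.2 j + n) :
    (D.raise k j ^ n) (Finsupp.single w 1) = 0 := by
  induction n generalizing w with
  | zero => exact absurd (w.2 j).2 (by omega)
  | succ n ih =>
    rw [pow_succ, Module.End.mul_apply, raise_single, raiseBasis]
    split_ifs with hw
    · exact ih _ (by simp; omega)
    · simp

/-- The action of `𝔫 = ⨁ k E_j` on `V(𝒢)`. -/
def nAct : (Fin D.t →₀ k) →ₗ[k] Module.End k (D.VG k) :=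
  Finsupp.linearCombination k (D.raise k)

lemma nAct_single (j : Fin D.t) (c : k) : D.nAct k (Finsupp.single j c) = c • D.raise k j := by
  simp [nAct]

lemma nAct_commute (a b : Fin D.t →₀ k) : Commute (D.nAct k a) (D.nAct k b) := by
  induction a using Finsupp.induction_linear with
  | zero => rw [map_zero]; exact Commute.zero_left _
  | add a a' h h' => rw [map_add]; exact h.add_left h'
  | single i c =>
    induction b using Finsupp.induction_linear with
    | zero => rw [map_zero]; exact Commute.zero_right _
    | add b b' h h' => rw [map_add]; exact h.add_right h'
    | single j d =>
      rw [nAct_single, nAct_single]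
      exact ((D.raise_commute k i j).smul_left c).smul_right d

variable [hp : Fact p.Prime]

lemma ghost_lt (h : Fin D.s) (j : Fin D.t) : D.ghost h j < p := ZMod.val_lt _

lemma cast_ghost (h : Fin D.s) (j : Fin D.t) : (D.ghost h j : ZMod p) = -2 * D.a h j :=
  ZMod.natCast_zmod_val _

lemma raise_pow (j : Fin D.t) : D.raise k j ^ p = 0 :=
  Finsupp.lhom_ext' fun w => LinearMap.ext_ring (by
    simpa using D.raise_pow_single k j p w (by have := D.ghost_lt w.1 j; omega))

lemma nAct_pow [CharP k p] (a : Fin D.t →₀ k) : D.nAct k a ^ p = 0 := by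
  induction a using Finsupp.induction_linear with
  | zero => rw [map_zero, zero_pow hp.out.ne_zero]
  | add a b ha hb =>
    have hz : (p : Module.End k (D.VG k)) = 0 := by
      rw [← map_natCast (algebraMap k _), CharP.cast_eq_zero, map_zero]
    obtain ⟨r, hr⟩ := (D.nAct_commute k a b).exists_add_pow_prime_eq hp.out
    rw [map_add, hr, ha, hb, hz]
    simp
  | single j c => rw [nAct_single, smul_pow, raise_pow, smul_zero]

/-- The Lie algebra `𝔩 = V(𝒢) ⋊ 𝔫`, where `V(𝒢)` and `𝔫 = ⨁ k E_j` are abelian. -/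
abbrev LieL : Type _ := AbelianLie.Semidirect (D.nAct k) (D.nAct_commute k)

/-- The element `E_j` of `𝔩`, for a block `j`. -/
def E (j : Fin D.t) : D.LieL k := ⟨0, AbelianLie.of (Finsupp.single j 1)⟩

/-- The element `v_{h, m}` of `𝔩`, for a point `h` and a family `m`. -/
def vBasis (w : D.Weight) : D.LieL k := ⟨AbelianLie.of (Finsupp.single w 1), 0⟩

/-- The element `v_h = v_{h, 0}` of `𝔩`, for a point `h`. -/
def v (h : Fin D.s) : D.LieL k := D.vBasis k ⟨h, 0⟩

lemma lie_E (j : Fin D.t) (u : D.VG k) :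
    ⁅D.E k j, (⟨u, 0⟩ : D.LieL k)⁆ = ⟨D.raise k j u, 0⟩ := by
  have h : D.nAct k (Finsupp.single j 1) u = D.raise k j u := by rw [nAct_single, one_smul]
  exact (AbelianLie.lie_mk_zero (D.E k j) u).trans (congrArg AbelianLie.inclLeft h)

variable [CharP k p]

/-- The restricted Lie algebra structure of `𝔩`: its `p`-operation is the one that is zero on
`V(𝒢)` and on `𝔫`. -/
instance : RestrictedLieAlgebra k (D.LieL k) p := AbelianLie.restricted (D.nAct_pow k)

/-- The Hopf algebra `L = 𝔲(𝔩)`. -/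
abbrev HopfL : Type _ := RestrictedEnveloping k (D.LieL k)

/-- The inclusion of the Hopf subalgebra `K` in `H`. -/
def inclK : D.subalgebraK k →ₐc[k] D.HopfH k := IsHopfSubalgebra.inclusion (D.subalgebraK k)

end LieAlgebra

end BlockPointDatum

end

/-! The relations in `H` that the proof needs come from one fact about Nichols algebras: in `𝔅(V) #
kΓ` a homogeneous skew primitive element of degree at least `2` is zero
(`eq_zero_of_skewPrimitive`). Such elements generate a graded Hopf ideal, whose pull back to `T(V)`
is one of the ideals over which the Nichols ideal is the supremum.

Put `X_i = g_i⁻¹ x_i` and `Y_j = g_j⁻¹ y_j`, so that `Δ(Z) = Z ⊗ g⁻¹ + 1 ⊗ Z`. Subtracting or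
raising to the power `p` until the correction terms in the coproduct cancel, one finds that the
`X_i` commute, the `Y_j` commute, `[Y_j, X_j] = X_j² / 2` and `Y_j ^ p = 0`. For a point `h` let
`w_{h,m}` be the iterated commutator of `X_h` with `m_j` copies of each `Y_j`. These elements
commute with `K` and with each other and have zero `p`-th power (`commute_orbit`, `orbit_pow`). In
the coproduct of `ad(Y_j) ^ n (X_h)` the intermediate coefficients contain the product of the `(l -
𝒢_hj) / 2`; for `n = 𝒢_hj + 1` all of them vanish, and so does the commutator
(`orbit_replicate_ghost`). Jacobson's formula matches the `p`-operation of `𝔩`, so `E_j ↦ Y_j`,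
`v_{h,m} ↦ w_{h,m}` defines an algebra map `s : L → H` (`sectionL`).

For `π`, the Hopf map `T(𝒱) # kΓ → L` given by the prescribed values must kill the kernel of the
projection to `H`. No presentation of `𝔅(𝒱)` is used. Instead, one considers the functionals on `L`
whose pull back to `T(𝒱) # kΓ` factors through `H`. They are closed under convolution, and they
contain the counit and the coordinates of the `E_j`. They also contain functionals `psi` that read
off the `v_{h,m}`: for `m = 0` this is a coordinate of degree one, and the convolution commutator
with the coordinate of `x_j` raises `m_j` by one, up to the scalar `m_j (𝒢_hj + 1 - m_j) / 2` at the
new `m_j`, which is nonzero because `0 < m_j ≤ 𝒢_hj < p` (`coordT_commutator`,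
`descends_psiT_lapply`). The common zero space of these functionals is stable under contraction, and
contraction acts on ordered monomials like a partial derivative. Since the monomials with exponents
below `p` span `L`, the zero space is trivial (`descentOrthogonal_eq_bot`), which gives `π`.

Finally `s` is a right colinear section of `π`, and `H = K s(L) = s(L) K`, because `ad(Y_j)`
preserves `K` and `X_h` commutes with `K`. Any such section yields exactness and the retraction
`ι(a) s(b) ↦ ε(b) a`. The latter is a coalgebra map because `L` is generated by elements with skew
primitive image in `H` (`IsColinearSection`). -/

/-! ### Generation of algebras, and inner derivations. -/

section Generation

variable {k A : Type*} [CommRing k] [Ring A] [Algebra k A]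

/-- A submodule that contains `1` and is stable under right multiplication by generators of the
algebra is everything. -/
lemma Submodule.eq_top_of_mul_mem_of_adjoin_eq_top {s : Set A} (hs : Algebra.adjoin k s = ⊤)
    (N : Submodule k A) (h1 : 1 ∈ N) (hN : ∀ a ∈ N, ∀ x ∈ s, a * x ∈ N) : N = ⊤ := by
  have key : ∀ b ∈ Algebra.adjoin k s, ∀ a ∈ N, a * b ∈ N := by
    intro b hb
    induction hb using Algebra.adjoin_induction with
    | mem x hx => exact fun a ha => hN a ha x hx
    | algebraMap r =>
      intro a ha
      rw [← Algebra.commutes, ← Algebra.smul_def]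
      exact N.smul_mem r ha
    | add x y _ _ hx hy => exact fun a ha => by rw [mul_add]; exact N.add_mem (hx a ha) (hy a ha)
    | mul x y _ _ hx hy => exact fun a ha => by rw [← mul_assoc]; exact hy _ (hx a ha)
  refine eq_top_iff.2 fun b _ => ?_
  have := key b (by rw [hs]; trivial) 1 h1
  rwa [one_mul] at this

/-- Left-handed version of `Submodule.eq_top_of_mul_mem_of_adjoin_eq_top`. -/
lemma Submodule.eq_top_of_mul_mem_left_of_adjoin_eq_top {s : Set A} (hs : Algebra.adjoin k s = ⊤)
    (N : Submodule k A) (h1 : 1 ∈ N) (hN : ∀ a ∈ N, ∀ x ∈ s, x * a ∈ N) : N = ⊤ := by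
  have key : ∀ b ∈ Algebra.adjoin k s, ∀ a ∈ N, b * a ∈ N := by
    intro b hb
    induction hb using Algebra.adjoin_induction with
    | mem x hx => exact fun a ha => hN a ha x hx
    | algebraMap r =>
      intro a ha
      rw [← Algebra.smul_def]
      exact N.smul_mem r ha
    | add x y _ _ hx hy => exact fun a ha => by rw [add_mul]; exact N.add_mem (hx a ha) (hy a ha)
    | mul x y _ _ hx hy => exact fun a ha => by rw [mul_assoc]; exact hx _ (hy a ha)
  refine eq_top_iff.2 fun b _ => ?_
  have := key b (by rw [hs]; trivial) 1 h1
  rwa [mul_one] at this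

variable (k) in
/-- The inner derivation `x ↦ e x - x e`. -/
def innerDer (e : A) : Module.End k A := LinearMap.mulLeft k e - LinearMap.mulRight k e

@[simp] lemma innerDer_apply (e x : A) : innerDer k e x = e * x - x * e := rfl

lemma innerDer_mul (e x y : A) :
    innerDer k e (x * y) = innerDer k e x * y + x * innerDer k e y := by
  simp only [innerDer_apply]; noncomm_ring

/-- An inner derivation that maps generators of a subalgebra into it preserves the subalgebra. -/
lemma innerDer_mem_adjoin {s : Set A} {e : A}
    (h : ∀ x ∈ s, innerDer k e x ∈ Algebra.adjoin k s) :
    ∀ x ∈ Algebra.adjoin k s, innerDer k e x ∈ Algebra.adjoin k s := by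
  intro x hx
  induction hx using Algebra.adjoin_induction with
  | mem x hx => exact h x hx
  | algebraMap r =>
    rw [innerDer_apply, ← Algebra.commutes, sub_self]
    exact zero_mem _
  | add x y _ _ hx hy => rw [map_add]; exact add_mem hx hy
  | mul x y hx' hy' hx hy =>
    rw [innerDer_mul]
    exact add_mem (mul_mem hx hy') (mul_mem hx' hy)

end Generation

/-! ### Jacobson's formula in characteristic `p`. -/

section Jacobson

open Polynomial

/-- Two consecutive binomial coefficients of `p - 1` add up to one of `p`, which vanishes in `R`, so
they alternate in sign. -/
lemma neg_one_pow_mul_choose_pred {R : Type*} [CommRing R] {p : ℕ} [hp : Fact p.Prime] [CharP R p]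
    {j : ℕ} (hj : j < p) : (-1 : R) ^ j * ((p - 1).choose j : R) = 1 := by
  obtain ⟨q, rfl⟩ : ∃ q, p = q + 1 := ⟨p - 1, (Nat.sub_add_cancel hp.out.one_le).symm⟩
  rw [Nat.add_sub_cancel]
  induction j with
  | zero => simp
  | succ j ih =>
    have h : (((q + 1).choose (j + 1) : ℕ) : R) = 0 :=
      (CharP.cast_eq_zero_iff R (q + 1) _).2 (hp.out.dvd_choose_self (by omega) hj)
    rw [Nat.choose_succ_succ, Nat.cast_add] at h
    have ih' := ih (by omega)
    rw [pow_succ]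
    linear_combination (-(-1 : R) ^ j) * h + ih'

variable {k R : Type*} [Field k] [Ring R] [Algebra k R] {p : ℕ} [hp : Fact p.Prime] [CharP k p]

/-- In characteristic `p`, `ad (a) ^ (p - 1) (b) = ∑ a ^ i b a ^ (p - 1 - i)`. -/
lemma innerDer_pow_pred (a b : R) :
    (innerDer k a ^ (p - 1)) b = ∑ i ∈ Finset.range p, a ^ i * b * a ^ (p - 1 - i) := by
  have hc : Commute (LinearMap.mulLeft k a : Module.End k R)
      (-LinearMap.mulRight k a : Module.End k R) :=
    (LinearMap.commute_mulLeft_right (R := k) a a).neg_right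
  rw [innerDer, sub_eq_add_neg, hc.add_pow, Nat.sub_add_cancel hp.out.one_le,
    LinearMap.sum_apply]
  refine Finset.sum_congr rfl fun i hi => ?_
  have hi' : i < p := Finset.mem_range.1 hi
  have h1 : (-1 : k) ^ (p - 1 - i) * ((p - 1).choose i : k) = 1 := by
    have := neg_one_pow_mul_choose_pred (R := k) (p := p) (j := p - 1 - i) (by omega)
    rwa [Nat.choose_symm (by omega)] at this
  have h2 : (-LinearMap.mulRight k a : Module.End k R) ^ (p - 1 - i) =
      (-1 : k) ^ (p - 1 - i) • LinearMap.mulRight k (a ^ (p - 1 - i)) := by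
    rw [← neg_one_smul k, _root_.smul_pow, LinearMap.pow_mulRight]
  rw [h2, LinearMap.pow_mulLeft, ← nsmul_eq_mul', ← Nat.cast_smul_eq_nsmul k, mul_smul_comm,
    smul_smul, mul_comm, h1, one_smul]
  simp [mul_assoc]

/-- The coefficients do not commute, so the Leibniz rule differentiates each factor in its place. -/
lemma derivative_C_add_C_mul_X_pow (e v : R) (n : ℕ) :
    derivative ((C e + C v * X) ^ n) =
      ∑ i ∈ Finset.range n, (C e + C v * X) ^ i * C v * (C e + C v * X) ^ (n - 1 - i) := by
  induction n with
  | zero => simp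
  | succ n ih =>
    rw [pow_succ, derivative_mul, ih, Finset.sum_range_succ, Finset.sum_mul]
    congr 1
    · refine Finset.sum_congr rfl fun i hi => ?_
      rw [mul_assoc, ← pow_succ]
      congr 2
      have := Finset.mem_range.1 hi
      omega
    · simp

/-- Jacobson's formula for `(e + v) ^ p` when `v` commutes with all `ad (e) ^ n (v)`. -/
lemma add_pow_char_of_commute_innerDer (e v : R) (h : ∀ n, Commute v ((innerDer k e ^ n) v)) :
    (e + v) ^ p = e ^ p + v ^ p + (innerDer k e ^ (p - 1)) v := by
  -- The central variable records the degree in `v`. The value of `q ^ p` at `1` is `(e + v) ^ p`,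
  -- so it is enough to find the coefficients of `q ^ p`.
  set q : R[X] := C e + C v * X with hq
  -- The part of `ad(q)` that involves `X` contributes `[v, ad(e) ^ n (v)] X`, which vanishes by
  -- hypothesis.
  have had : ∀ n, (innerDer k q ^ n) (C v) = C ((innerDer k e ^ n) v) := by
    intro n
    induction n with
    | zero => simp
    | succ n ih =>
      rw [pow_succ', Module.End.mul_apply, ih, pow_succ', Module.End.mul_apply, innerDer_apply,
        innerDer_apply, C_sub, C_mul, C_mul, hq]
      have h' := (h n).eq
      rw [add_mul, mul_add, mul_assoc, X_mul_C, ← mul_assoc, ← mul_assoc, ← C_mul, ← C_mul, h']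
      simp only [C_mul]
      abel
  -- The derivative is `ad(q) ^ (p - 1) (v)`, hence a constant. This determines the coefficient of
  -- `X` and kills those of degree strictly between `1` and `p`.
  have hd : derivative (q ^ p) = C ((innerDer k e ^ (p - 1)) v) := by
    rw [derivative_C_add_C_mul_X_pow, ← innerDer_pow_pred (k := k), had]
  have hdeg1 : q.natDegree ≤ 1 := by
    rw [hq]; compute_degree
  have hdeg : (q ^ p).natDegree ≤ p := (natDegree_pow_le_of_le p hdeg1).trans (by simp)
  have hc0 : (q ^ p).coeff 0 = e ^ p := by
    have := map_pow (constantCoeff (R := R)) q p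
    simpa [hq] using this
  have hcp : (q ^ p).coeff p = v ^ p := by
    have := coeff_pow_of_natDegree_le (m := p) hdeg1
    simpa [hq] using this
  have hc : ∀ n, (q ^ p).coeff (n + 1) * (n + 1) = (C ((innerDer k e ^ (p - 1)) v)).coeff n := by
    intro n; rw [← hd, coeff_derivative]
  have hmid : ∀ i, 2 ≤ i → i < p → (q ^ p).coeff i = 0 := by
    intro i h2 hi
    obtain ⟨n, rfl⟩ : ∃ n, i = n + 1 := ⟨i - 1, by omega⟩
    have h0 := hc n
    rw [coeff_C_of_ne_zero (by omega)] at h0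
    have hne : ((n + 1 : ℕ) : k) ≠ 0 := fun h0 =>
      absurd (Nat.le_of_dvd (by omega) ((CharP.cast_eq_zero_iff k p (n + 1)).1 h0)) (by omega)
    have : ((n + 1 : ℕ) : k) • (q ^ p).coeff (n + 1) = 0 := by
      rw [Nat.cast_smul_eq_nsmul, nsmul_eq_mul', ← h0]; push_cast; rfl
    exact (smul_eq_zero.1 this).resolve_left hne
  have hc1 : (q ^ p).coeff 1 = (innerDer k e ^ (p - 1)) v := by
    have := hc 0
    simpa using this
  have hev : eval₂RingHom' (RingHom.id R) 1 (fun a => Commute.one_right a) (q ^ p) =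
      (e + v) ^ p := by
    rw [map_pow, hq]; simp [eval₂RingHom']
  have hsum : eval₂RingHom' (RingHom.id R) 1 (fun a => Commute.one_right a) (q ^ p) =
      ∑ i ∈ Finset.range (p + 1), (q ^ p).coeff i := by
    change eval₂ (RingHom.id R) 1 (q ^ p) = _
    rw [eval₂_eq_sum_range' _ (Nat.lt_succ_of_le hdeg)]
    simp
  have hr : Finset.range p = Finset.range (p - 2 + 1 + 1) := by
    have := hp.out.two_le
    congr 1; omega
  rw [← hev, hsum, Finset.sum_range_succ, hcp, hr,
    Finset.sum_range_succ', Finset.sum_range_succ', Finset.sum_eq_zero, hc0]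
  · rw [show 0 + 1 = 1 from rfl, hc1]
    abel
  · intro i hi
    exact hmid _ (by omega) (by have := Finset.mem_range.1 hi; omega)

end Jacobson

noncomputable section

/-! ### The projection from `T(V) # kΓ` and the bigrading of the bosonization. -/

namespace YetterDrinfeld

open Coalgebra SkewMonoidAlgebra

variable {k Γ X : Type*} [Field k] [CommGroup Γ] (M : YetterDrinfeld k Γ X)

/-- The projection of the bosonization `T(V) # kΓ` onto `𝔅(V) # kΓ`. -/
def bosonMk : SkewMonoidAlgebra M.Tensor Γ →ₐ[k] M.Bosonization := M.smashMk

lemma bosonMk_single (γ : Γ) (u : M.Tensor) :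
    M.bosonMk (single γ u) =
      (single γ (M.toNichols u) : SkewMonoidAlgebra M.NicholsAlgebra Γ) :=
  M.smashMk_single γ u

lemma bosonMk_gen (x : X) : M.bosonMk (single 1 (M.ι (Finsupp.single x 1))) = M.bosonGen x :=
  M.bosonMk_single 1 _

lemma bosonMk_group (γ : Γ) : M.bosonMk (single γ 1) = M.bosonGroup γ :=
  (M.bosonMk_single γ 1).trans (by rw [map_one]; rfl)

lemma comul_single_gen (x : X) :
    comul (R := k) (single 1 (M.ι (Finsupp.single x 1)) : SkewMonoidAlgebra M.Tensor Γ) =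
      single 1 (M.ι (Finsupp.single x 1)) ⊗ₜ 1 +
        single (M.deg x) 1 ⊗ₜ single 1 (M.ι (Finsupp.single x 1)) :=
  (M.tensorData.comulHom_single _).trans (M.tensorData.comul_gen x)

lemma comul_single_one (γ : Γ) :
    comul (R := k) (single γ 1 : SkewMonoidAlgebra M.Tensor Γ) = single γ 1 ⊗ₜ single γ 1 :=
  M.tensorData.comulHom_of γ

lemma counit_single_gen (x : X) :
    counit (R := k) (single 1 (M.ι (Finsupp.single x 1)) : SkewMonoidAlgebra M.Tensor Γ) = 0 :=
  (M.tensorData.counitHom_single _).trans (M.tensorData.counit_gen x)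

lemma counit_single_one (γ : Γ) :
    counit (R := k) (single γ 1 : SkewMonoidAlgebra M.Tensor Γ) = 1 :=
  M.tensorData.counitHom_of γ

lemma counit_bosonGen (x : X) : counit (R := k) (M.bosonGen x) = 0 :=
  (M.nicholsData.counitHom_single _).trans (M.nicholsData.counit_gen x)

lemma counit_bosonGroup (γ : Γ) : counit (R := k) (M.bosonGroup γ) = 1 :=
  M.nicholsData.counitHom_of γ

lemma adjoin_tensor_eq_top : Algebra.adjoin k
    (Set.range (fun x => (single 1 (M.ι (Finsupp.single x 1)) : SkewMonoidAlgebra M.Tensor Γ)) ∪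
      Set.range (fun γ : Γ => (single γ 1 : SkewMonoidAlgebra M.Tensor Γ))) = ⊤ :=
  M.tensorData.adjoin_smash

lemma adjoin_boson_eq_top :
    Algebra.adjoin k (Set.range M.bosonGen ∪ Set.range M.bosonGroup) = ⊤ :=
  M.nicholsData.adjoin_smash

lemma algHom_ext_tensor {B : Type*} [Semiring B] [Algebra k B]
    {φ ψ : SkewMonoidAlgebra M.Tensor Γ →ₐ[k] B}
    (h₁ : ∀ x, φ (single 1 (M.ι (Finsupp.single x 1))) = ψ (single 1 (M.ι (Finsupp.single x 1))))
    (h₂ : ∀ γ : Γ, φ (single γ 1) = ψ (single γ 1)) : φ = ψ :=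
  M.tensorData.algHom_ext_gen h₁ h₂

lemma algHom_ext_boson {B : Type*} [Semiring B] [Algebra k B]
    {φ ψ : M.Bosonization →ₐ[k] B} (h₁ : ∀ x, φ (M.bosonGen x) = ψ (M.bosonGen x))
    (h₂ : ∀ γ, φ (M.bosonGroup γ) = ψ (M.bosonGroup γ)) : φ = ψ :=
  M.nicholsData.algHom_ext_gen (B := B) h₁ h₂

/-- Together with `counit_bosonMk` and `antipode_bosonMk`, this lets Hopf ideals be pulled back and
functionals be convolved on either side of the projection. -/
lemma map_bosonMk_comul (a : SkewMonoidAlgebra M.Tensor Γ) :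
    Algebra.TensorProduct.map M.bosonMk M.bosonMk (comul (R := k) a) =
      comul (R := k) (M.bosonMk a) := by
  have h : (Algebra.TensorProduct.map M.bosonMk M.bosonMk).comp (Bialgebra.comulAlgHom k _) =
      (Bialgebra.comulAlgHom k M.Bosonization).comp M.bosonMk :=
    M.algHom_ext_tensor
      (fun x => by
        simp only [AlgHom.comp_apply, Bialgebra.comulAlgHom_apply, comul_single_gen, bosonMk_gen,
          comul_bosonGen, map_add, Algebra.TensorProduct.map_tmul, bosonMk_group, map_one])
      (fun γ => by
        simp only [AlgHom.comp_apply, Bialgebra.comulAlgHom_apply, comul_single_one,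
          comul_bosonGroup, Algebra.TensorProduct.map_tmul, bosonMk_group])
  exact DFunLike.congr_fun h a

lemma counit_bosonMk (a : SkewMonoidAlgebra M.Tensor Γ) :
    counit (R := k) (M.bosonMk a) = counit (R := k) a := by
  have h : (Bialgebra.counitAlgHom k M.Bosonization).comp M.bosonMk =
      Bialgebra.counitAlgHom k _ :=
    M.algHom_ext_tensor
      (fun x => by
        simp only [AlgHom.comp_apply, Bialgebra.counitAlgHom_apply, counit_single_gen,
          bosonMk_gen, counit_bosonGen])
      (fun γ => by
        simp only [AlgHom.comp_apply, Bialgebra.counitAlgHom_apply, counit_single_one,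
          bosonMk_group, counit_bosonGroup])
  exact DFunLike.congr_fun h a

lemma antipode_bosonMk (a : SkewMonoidAlgebra M.Tensor Γ) :
    HopfAlgebra.antipode k (M.bosonMk a) = M.bosonMk (HopfAlgebra.antipode k a) := by
  have h : M.nicholsData.antiHom.comp M.smashMk =
      (AlgHom.op M.smashMk).comp M.tensorData.antiHom :=
    M.algHom_ext_tensor
      (fun x => by
        simp only [AlgHom.comp_apply, smashMk_single, SmashData.antiHom_single]
        rfl)
      (fun γ => by
        simp only [AlgHom.comp_apply, smashMk_single, SmashData.antiHom_single_one, map_one]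
        rw [AlgHom.op_apply_apply]
        simp)
  exact congrArg MulOpposite.unop (DFunLike.congr_fun h a)

lemma bosonMk_surjective : Function.Surjective M.bosonMk := by
  have h : M.bosonMk.range = ⊤ := by
    rw [eq_top_iff, ← M.adjoin_boson_eq_top, Algebra.adjoin_le_iff]
    rintro _ (⟨x, rfl⟩ | ⟨γ, rfl⟩)
    · exact ⟨_, M.bosonMk_gen x⟩
    · exact ⟨_, M.bosonMk_group γ⟩
  exact (AlgHom.range_eq_top _).1 h

lemma bosonGroup_mul (γ δ : Γ) : M.bosonGroup γ * M.bosonGroup δ = M.bosonGroup (γ * δ) := by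
  rw [← bosonMk_group, ← bosonMk_group, ← bosonMk_group, ← map_mul]
  simp [single_mul_single]

lemma bosonGroup_one : M.bosonGroup 1 = 1 := rfl

lemma bosonGroup_pow (γ : Γ) (n : ℕ) : M.bosonGroup γ ^ n = M.bosonGroup (γ ^ n) := by
  induction n with
  | zero => simp [bosonGroup_one]
  | succ n ih => rw [pow_succ, ih, bosonGroup_mul, pow_succ]

/-- The element `u # γ` of `𝔅(V) # kΓ`, for `u` in `T(V)`. -/
def bosonSingle (γ : Γ) : M.Tensor →ₗ[k] M.Bosonization where
  toFun u := M.bosonMk (single γ u)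
  map_add' u v := by rw [single_add, map_add]
  map_smul' c u := by rw [← smul_single, map_smul]; rfl

lemma bosonSingle_apply (γ : Γ) (u : M.Tensor) : M.bosonSingle γ u = M.bosonMk (single γ u) := rfl

lemma bosonSingle_mul (γ δ : Γ) (u v : M.Tensor) :
    M.bosonSingle γ u * M.bosonSingle δ v = M.bosonSingle (γ * δ) (u * γ • v) := by
  simp [bosonSingle_apply, ← map_mul, single_mul_single]

lemma smul_mem_tensorGrading (γ : Γ) {n : ℕ} {u : M.Tensor} (hu : u ∈ M.tensorGrading n) :
    γ • u ∈ M.tensorGrading n := by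
  have h : (M.tensorGrading n).map (M.tensorAct γ).toLinearMap ≤ M.tensorGrading n := by
    rw [tensorGrading, Submodule.map_pow]
    refine pow_le_pow_left' ?_ n
    rintro _ ⟨_, ⟨v, rfl⟩, rfl⟩
    exact ⟨M.action γ v, (M.smul_ι γ v).symm⟩
  exact h ⟨u, hu, rfl⟩

/-- The homogeneous elements of `𝔅(V) # kΓ` of degree `n` in the Nichols algebra and `γ` in the
group. -/
def homog (n : ℕ) (γ : Γ) : Submodule k M.Bosonization :=
  (M.tensorGrading n).map (M.bosonSingle γ)

lemma mul_mem_homog {m n : ℕ} {γ δ : Γ} {a b : M.Bosonization} (ha : a ∈ M.homog m γ)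
    (hb : b ∈ M.homog n δ) : a * b ∈ M.homog (m + n) (γ * δ) := by
  obtain ⟨u, hu, rfl⟩ := ha
  obtain ⟨v, hv, rfl⟩ := hb
  rw [bosonSingle_mul]
  exact ⟨_, SetLike.mul_mem_graded hu (M.smul_mem_tensorGrading γ hv), rfl⟩

lemma bosonGroup_mem_homog (γ : Γ) : M.bosonGroup γ ∈ M.homog 0 γ :=
  ⟨1, SetLike.one_mem_graded _, M.bosonMk_group γ⟩

lemma bosonGen_mem_homog (x : X) : M.bosonGen x ∈ M.homog 1 1 :=
  ⟨M.ι (Finsupp.single x 1), by rw [tensorGrading, pow_one]; exact ⟨_, rfl⟩, M.bosonMk_gen x⟩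

lemma one_mem_homog : (1 : M.Bosonization) ∈ M.homog 0 1 := M.bosonGroup_mem_homog 1

lemma pow_mem_homog {m : ℕ} {γ : Γ} {a : M.Bosonization} (ha : a ∈ M.homog m γ) (n : ℕ) :
    a ^ n ∈ M.homog (n * m) (γ ^ n) := by
  induction n with
  | zero => simpa using M.one_mem_homog
  | succ n ih =>
    rw [pow_succ, pow_succ, add_mul, one_mul]
    exact M.mul_mem_homog ih ha

lemma exists_sum_homogeneous (u : M.Tensor) :
    u ∈ Submodule.span k {w | ∃ n, w ∈ M.tensorGrading n} := by
  classical
  rw [← DirectSum.sum_support_decompose M.tensorGrading u]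
  exact Submodule.sum_mem _ fun i _ => Submodule.subset_span ⟨i, SetLike.coe_mem _⟩

lemma span_homog : Submodule.span k {a | ∃ n γ, a ∈ M.homog n γ} = ⊤ := by
  refine eq_top_iff.2 fun b _ => ?_
  obtain ⟨a, rfl⟩ := M.bosonMk_surjective b
  induction a using SkewMonoidAlgebra.induction_on with
  | zero => rw [map_zero]; exact zero_mem _
  | add a b ha hb => rw [map_add]; exact add_mem (ha trivial) (hb trivial)
  | single γ u =>
    have := Submodule.mem_map_of_mem (f := M.bosonSingle γ) (M.exists_sum_homogeneous u)
    rw [Submodule.map_span] at this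
    refine Submodule.span_mono ?_ this
    rintro _ ⟨w, ⟨n, hw⟩, rfl⟩
    exact ⟨n, γ, w, hw, rfl⟩

lemma isHomogeneous_nicholsIdeal : M.nicholsIdeal.IsHomogeneous M.tensorGrading :=
  Ideal.IsHomogeneous.sSup fun _ hI => hI.isHomogeneous

/-- The degree condition passes to sums of ideals. It is the only property of the Nichols ideal
needed to make functionals of degree at most one factor through the bosonization. -/
lemma proj_eq_zero_of_mem_nicholsIdeal {u : M.Tensor} (hu : u ∈ M.nicholsIdeal) {n : ℕ}
    (hn : n < 2) : GradedRing.proj M.tensorGrading n u = 0 := by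
  have : M.nicholsIdeal.toAddSubmonoid ≤ AddMonoidHom.mker (GradedRing.proj M.tensorGrading n) := by
    intro u hu
    rw [nicholsIdeal, sSup_eq_iSup', Submodule.mem_toAddSubmonoid] at hu
    induction hu using Submodule.iSup_induction' with
    | mem I u hu => exact I.2.two_le_degree u hu n hn
    | zero => exact zero_mem _
    | add x y _ _ hx hy => exact add_mem hx hy
  exact this hu

end YetterDrinfeld

/-! ### Vanishing of skew primitive elements of degree at least two. -/

namespace YetterDrinfeld

open Coalgebra SkewMonoidAlgebra

variable {k Γ X : Type*} [Field k] [CommGroup Γ] (M : YetterDrinfeld k Γ X)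

/-- The homogeneous skew primitive elements of `𝔅(V) # kΓ` of degree at least `2`. -/
def skewPrimitives : Set M.Bosonization :=
  {a | (∃ n γ, 2 ≤ n ∧ a ∈ M.homog n γ) ∧ ∃ σ τ : Γ,
    comul (R := k) a = a ⊗ₜ M.bosonGroup σ + M.bosonGroup τ ⊗ₜ a}

/-- The two-sided ideal of `𝔅(V) # kΓ` generated by the homogeneous skew primitive elements of
degree at least `2`. -/
def skewPrimitiveIdeal : Ideal M.Bosonization :=
  Ideal.span {z | ∃ c ∈ M.skewPrimitives, ∃ b, z = c * b}

instance : M.skewPrimitiveIdeal.IsTwoSided where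
  mul_mem_of_left {a} b ha := by
    induction ha using Submodule.span_induction with
    | mem z hz =>
      obtain ⟨c, hc, b', rfl⟩ := hz
      exact Ideal.subset_span ⟨c, hc, b' * b, mul_assoc _ _ _⟩
    | zero => rw [zero_mul]; exact zero_mem _
    | add x y _ _ hx hy => rw [add_mul]; exact add_mem hx hy
    | smul h x _ hx => rw [smul_eq_mul, mul_assoc]; exact Ideal.mul_mem_left _ _ hx

lemma skewPrimitives_subset {c : M.Bosonization} (hc : c ∈ M.skewPrimitives) :
    c ∈ M.skewPrimitiveIdeal :=
  Ideal.subset_span ⟨c, hc, 1, (mul_one c).symm⟩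

/-- The generators are homogeneous for the degree and for the group, the homogeneous elements span
the algebra, and degrees only grow under multiplication. -/
lemma skewPrimitiveIdeal_le_span {z : M.Bosonization} (hz : z ∈ M.skewPrimitiveIdeal) :
    z ∈ Submodule.span k
      {z | z ∈ M.skewPrimitiveIdeal ∧ ∃ n γ, 2 ≤ n ∧ z ∈ M.homog n γ} := by
  set S : Set M.Bosonization := {z | z ∈ M.skewPrimitiveIdeal ∧ ∃ n γ, 2 ≤ n ∧ z ∈ M.homog n γ}
  have hmul (h x : M.Bosonization) (hx : x ∈ Submodule.span k S) :
      h * x ∈ Submodule.span k S := by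
    have hh : h ∈ Submodule.span k {a | ∃ n γ, a ∈ M.homog n γ} := by
      rw [M.span_homog]; trivial
    induction hx using Submodule.span_induction with
    | zero => rw [mul_zero]; exact zero_mem _
    | add x y _ _ hx hy => rw [mul_add]; exact add_mem hx hy
    | smul c x _ hx => rw [mul_smul_comm]; exact Submodule.smul_mem _ c hx
    | mem x hx =>
      obtain ⟨hx, n, γ, hn, hxn⟩ := hx
      induction hh using Submodule.span_induction with
      | zero => rw [zero_mul]; exact zero_mem _
      | add a b _ _ ha hb => rw [add_mul]; exact add_mem ha hb
      | smul c a _ ha => rw [smul_mul_assoc]; exact Submodule.smul_mem _ c ha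
      | mem a ha =>
        obtain ⟨m, δ, ha⟩ := ha
        exact Submodule.subset_span ⟨Ideal.mul_mem_left _ _ hx, m + n, δ * γ, by omega,
          M.mul_mem_homog ha hxn⟩
  induction hz using Submodule.span_induction with
  | zero => exact zero_mem _
  | add x y _ _ hx hy => exact add_mem hx hy
  | smul h x _ hx => exact hmul h x hx
  | mem z hz =>
    obtain ⟨c, hc, b, rfl⟩ := hz
    obtain ⟨n, γ, hn, hcn⟩ := hc.1
    have hb : b ∈ Submodule.span k {a | ∃ n γ, a ∈ M.homog n γ} := by
      rw [M.span_homog]; trivial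
    induction hb using Submodule.span_induction with
    | zero => rw [mul_zero]; exact zero_mem _
    | add a b _ _ ha hb => rw [mul_add]; exact add_mem ha hb
    | smul r a _ ha => rw [mul_smul_comm]; exact Submodule.smul_mem _ r ha
    | mem a ha =>
      obtain ⟨m, δ, ha⟩ := ha
      exact Submodule.subset_span ⟨Ideal.mul_mem_right _ _ (M.skewPrimitives_subset hc), n + m,
        γ * δ, by omega, M.mul_mem_homog hcn ha⟩

lemma counit_eq_zero_of_mem_homog {n : ℕ} {γ : Γ} (hn : n ≠ 0) {a : M.Bosonization}
    (ha : a ∈ M.homog n γ) : counit (R := k) a = 0 := by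
  obtain ⟨u, hu, rfl⟩ := ha
  have h : ∀ u ∈ M.tensorGrading n,
      counit (R := k) (single 1 u : SkewMonoidAlgebra M.Tensor Γ) = 0 := by
    obtain ⟨m, rfl⟩ := Nat.exists_eq_succ_of_ne_zero hn
    intro u hu
    have e (u : M.Tensor) : counit (R := k) (single 1 u : SkewMonoidAlgebra M.Tensor Γ) =
      M.tensorData.counit u := M.tensorData.counitHom_single u
    rw [e]
    rw [tensorGrading, pow_succ] at hu
    refine Submodule.mul_induction_on hu ?_ (fun x y hx hy => by rw [map_add, hx, hy, add_zero])
    rintro a _ _ ⟨v, rfl⟩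
    rw [map_mul]
    have : M.tensorData.counit (M.ι v) = 0 := M.tensorLift_ι 0 v
    rw [this, mul_zero]
  have e : M.bosonSingle γ u = M.bosonMk (single 1 u) * M.bosonGroup γ := by
    rw [← bosonMk_group, ← map_mul]; simp [single_mul_single, bosonSingle_apply]
  rw [e, Bialgebra.counit_mul, counit_bosonMk, h u hu, zero_mul]

lemma counit_eq_zero_of_mem_skewPrimitiveIdeal {z : M.Bosonization}
    (hz : z ∈ M.skewPrimitiveIdeal) : counit (R := k) z = 0 := by
  have h := M.skewPrimitiveIdeal_le_span hz
  clear hz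
  induction h using Submodule.span_induction with
  | zero => exact map_zero _
  | add x y _ _ hx hy => rw [map_add, hx, hy, add_zero]
  | smul c x _ hx => rw [map_smul, hx, smul_zero]
  | mem x hx =>
    obtain ⟨-, n, γ, hn, hx⟩ := hx
    exact M.counit_eq_zero_of_mem_homog (by omega) hx

/-- For a generator with `Δ(c) = c ⊗ σ + τ ⊗ c` one has `ε(c) = 0`, and the antipode identity gives
`S(c) = -τ⁻¹ c σ⁻¹`. That `S` reverses products is harmless, since the ideal is two-sided. -/
lemma antipode_mem_skewPrimitiveIdeal {z : M.Bosonization} (hz : z ∈ M.skewPrimitiveIdeal) :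
    HopfAlgebra.antipode k z ∈ M.skewPrimitiveIdeal := by
  induction hz using Submodule.span_induction with
  | zero => rw [map_zero]; exact zero_mem _
  | add x y _ _ hx hy => rw [map_add]; exact add_mem hx hy
  | smul h x _ hx =>
    rw [smul_eq_mul, HopfAlgebra.antipode_mul_antidistrib]
    exact Ideal.mul_mem_right _ _ hx
  | mem z hz =>
    obtain ⟨c, hc, b, rfl⟩ := hz
    rw [HopfAlgebra.antipode_mul_antidistrib]
    refine Ideal.mul_mem_left _ _ ?_
    obtain ⟨⟨n, γ, hn, hcn⟩, σ, τ, h⟩ := hc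
    have h0 := HopfAlgebra.mul_antipode_rTensor_comul_apply (R := k) c
    rw [h, map_add, map_add, LinearMap.rTensor_tmul, LinearMap.rTensor_tmul,
      LinearMap.mul'_apply, LinearMap.mul'_apply, antipode_bosonGroup,
      M.counit_eq_zero_of_mem_homog (by omega) hcn, map_zero] at h0
    have e : HopfAlgebra.antipode k c = -(M.bosonGroup τ⁻¹ * c * M.bosonGroup σ⁻¹) := by
      rw [← eq_neg_iff_add_eq_zero] at h0
      rw [← neg_mul, ← h0, mul_assoc, bosonGroup_mul, mul_inv_cancel, bosonGroup_one, mul_one]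
    rw [e]
    exact neg_mem (Ideal.mul_mem_right _ _ (Ideal.mul_mem_left _ _
      (Ideal.subset_span ⟨c, ⟨⟨n, γ, hn, hcn⟩, σ, τ, h⟩, 1, (mul_one c).symm⟩)))

/-- The quotient map by the ideal generated by the skew primitive elements. -/
abbrev skewPrimitiveMk : M.Bosonization →ₐ[k] M.Bosonization ⧸ M.skewPrimitiveIdeal :=
  Ideal.Quotient.mkₐ k M.skewPrimitiveIdeal

lemma skewPrimitiveMk_comul {z : M.Bosonization} (hz : z ∈ M.skewPrimitiveIdeal) :
    Algebra.TensorProduct.map M.skewPrimitiveMk M.skewPrimitiveMk (comul (R := k) z) = 0 := by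
  induction hz using Submodule.span_induction with
  | zero => simp
  | add x y _ _ hx hy => rw [map_add, map_add, hx, hy, add_zero]
  | smul h x _ hx => rw [smul_eq_mul, Bialgebra.comul_mul, map_mul, hx, mul_zero]
  | mem z hz =>
    obtain ⟨c, hc, b, rfl⟩ := hz
    have h0 : M.skewPrimitiveMk c = 0 :=
      Ideal.Quotient.eq_zero_iff_mem.2 (M.skewPrimitives_subset hc)
    obtain ⟨-, σ, τ, h⟩ := hc
    rw [Bialgebra.comul_mul, map_mul, h, map_add, Algebra.TensorProduct.map_tmul,
      Algebra.TensorProduct.map_tmul, h0, TensorProduct.zero_tmul, TensorProduct.tmul_zero,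
      add_zero, zero_mul]

/-- The pull back to `T(V)` of the ideal generated by the skew primitive elements. -/
def skewPrimitiveTensorIdeal : Ideal M.Tensor :=
  M.skewPrimitiveIdeal.comap (M.bosonMk.comp (SmashData.incl k Γ M.Tensor))

lemma mem_skewPrimitiveTensorIdeal {u : M.Tensor} :
    u ∈ M.skewPrimitiveTensorIdeal ↔ M.bosonSingle 1 u ∈ M.skewPrimitiveIdeal := Iff.rfl

lemma bosonSingle_eq_mul_group (γ δ : Γ) (u : M.Tensor) :
    M.bosonSingle γ u * M.bosonGroup δ = M.bosonSingle (γ * δ) u := by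
  rw [← bosonMk_group, bosonSingle_apply, ← map_mul]; simp [single_mul_single, bosonSingle_apply]

/-- Group elements are invertible, so multiplication by them moves the group component without
leaving the ideal. -/
lemma bosonSingle_mem_skewPrimitiveIdeal_iff (γ : Γ) {u : M.Tensor} :
    M.bosonSingle γ u ∈ M.skewPrimitiveIdeal ↔ u ∈ M.skewPrimitiveTensorIdeal := by
  rw [mem_skewPrimitiveTensorIdeal]
  constructor
  · intro h
    have := Ideal.mul_mem_right (M.bosonGroup γ⁻¹) _ h
    rwa [bosonSingle_eq_mul_group, mul_inv_cancel] at this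
  · intro h
    have := Ideal.mul_mem_right (M.bosonGroup γ) _ h
    rwa [bosonSingle_eq_mul_group, one_mul] at this

/-- The coefficient at an element of `Γ` of an element of `𝔅(V) # kΓ`. -/
def coeffAt (γ : Γ) : M.Bosonization →ₗ[k] M.NicholsAlgebra :=
  Finsupp.lapply γ ∘ₗ (coeffLinearEquiv (S := k) (k := M.NicholsAlgebra) (G := Γ)).toLinearMap

lemma coeffAt_bosonMk (γ : Γ) (a : SkewMonoidAlgebra M.Tensor Γ) :
    M.coeffAt γ (M.bosonMk a) = M.toNichols (a.coeff γ) := by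
  classical
  induction a using SkewMonoidAlgebra.induction_on with
  | zero => simp
  | add a b ha hb => rw [map_add, map_add, ha, hb, coeff_add, Finsupp.add_apply, map_add]
  | single δ u =>
    have e : M.coeffAt γ (M.bosonMk (single δ u)) =
        (single δ (M.toNichols u) : SkewMonoidAlgebra M.NicholsAlgebra Γ).coeff γ :=
      congrArg (M.coeffAt γ) (M.bosonMk_single δ u)
    rw [e, coeff_single_apply, coeff_single_apply]
    split_ifs <;> simp

lemma bosonSingle_eq_zero_iff {γ : Γ} {u : M.Tensor} :
    M.bosonSingle γ u = 0 ↔ u ∈ M.nicholsIdeal := by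
  rw [← toNichols_eq_zero]
  constructor
  · intro h
    have := M.coeffAt_bosonMk γ (single γ u)
    rw [← bosonSingle_apply, h, map_zero] at this
    simpa using this.symm
  · intro h
    exact (M.bosonMk_single γ u).trans (by rw [h, single_zero]; rfl)

lemma nicholsIdeal_le_skewPrimitiveTensorIdeal :
    M.nicholsIdeal ≤ M.skewPrimitiveTensorIdeal := fun u hu => by
  rw [mem_skewPrimitiveTensorIdeal, M.bosonSingle_eq_zero_iff.2 hu]
  exact zero_mem _

/-- Being spanned by bihomogeneous elements, the ideal contains the group components of its
elements, and these lift to sums of homogeneous tensors. Both the homogeneity and the degree bound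
of the pulled back ideal rest on this. -/
lemma exists_homogeneous_of_mem_skewPrimitiveIdeal {z : M.Bosonization}
    (hz : z ∈ M.skewPrimitiveIdeal) (γ : Γ) :
    ∃ u ∈ Submodule.span k {w | w ∈ M.skewPrimitiveTensorIdeal ∧
      ∃ n, 2 ≤ n ∧ w ∈ M.tensorGrading n}, M.coeffAt γ z = M.toNichols u := by
  classical
  have h := M.skewPrimitiveIdeal_le_span hz
  clear hz
  induction h using Submodule.span_induction with
  | zero => exact ⟨0, zero_mem _, by simp⟩
  | add x y _ _ hx hy =>
    obtain ⟨u, hu, hu'⟩ := hx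
    obtain ⟨v, hv, hv'⟩ := hy
    exact ⟨u + v, add_mem hu hv, by rw [map_add, map_add, hu', hv']⟩
  | smul c x _ hx =>
    obtain ⟨u, hu, hu'⟩ := hx
    exact ⟨c • u, Submodule.smul_mem _ c hu, by rw [map_smul, map_smul, hu']⟩
  | mem x hx =>
    obtain ⟨hx, n, δ, hn, u, hu, rfl⟩ := hx
    rw [bosonSingle_apply, coeffAt_bosonMk, coeff_single_apply]
    rw [bosonSingle_mem_skewPrimitiveIdeal_iff] at hx
    split_ifs
    · exact ⟨u, Submodule.subset_span ⟨hx, n, hn, hu⟩, rfl⟩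
    · exact ⟨0, zero_mem _, rfl⟩

lemma mem_skewPrimitiveTensorIdeal_of_coeffAt {z : M.Bosonization}
    (hz : z ∈ M.skewPrimitiveIdeal) {γ : Γ} {u : M.Tensor} (h : M.coeffAt γ z = M.toNichols u) :
    ∃ w ∈ Submodule.span k {w | w ∈ M.skewPrimitiveTensorIdeal ∧
      ∃ n, 2 ≤ n ∧ w ∈ M.tensorGrading n}, u - w ∈ M.nicholsIdeal := by
  obtain ⟨w, hw, e⟩ := M.exists_homogeneous_of_mem_skewPrimitiveIdeal hz γ
  exact ⟨w, hw, by rw [← toNichols_eq_zero, map_sub, ← h, ← e, sub_self]⟩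

lemma span_le_skewPrimitiveTensorIdeal {w : M.Tensor}
    (hw : w ∈ Submodule.span k {w | w ∈ M.skewPrimitiveTensorIdeal ∧
      ∃ n, 2 ≤ n ∧ w ∈ M.tensorGrading n}) : w ∈ M.skewPrimitiveTensorIdeal := by
  have : Submodule.span k {w | w ∈ M.skewPrimitiveTensorIdeal ∧
      ∃ n, 2 ≤ n ∧ w ∈ M.tensorGrading n} ≤ M.skewPrimitiveTensorIdeal.restrictScalars k :=
    Submodule.span_le.2 fun w hw => hw.1
  exact this hw

/-- This identifies `I # kΓ` with the kernel of an algebra map to a quotient of the bosonization,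
where the coideal and antipode conditions are already known. -/
lemma mem_smashIdeal_skewPrimitive_iff {a : SkewMonoidAlgebra M.Tensor Γ} :
    a ∈ M.smashIdeal M.skewPrimitiveTensorIdeal ↔ M.bosonMk a ∈ M.skewPrimitiveIdeal := by
  constructor
  · intro h
    rw [← sum_single a, sum_def', _root_.map_sum]
    exact Ideal.sum_mem _ fun γ _ => (M.bosonSingle_mem_skewPrimitiveIdeal_iff γ).2 (h γ)
  · intro h γ
    obtain ⟨w, hw, hw'⟩ := M.mem_skewPrimitiveTensorIdeal_of_coeffAt h (M.coeffAt_bosonMk γ a)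
    have := add_mem (M.nicholsIdeal_le_skewPrimitiveTensorIdeal hw')
      (M.span_le_skewPrimitiveTensorIdeal hw)
    rwa [sub_add_cancel] at this

lemma isPreNicholsIdeal_skewPrimitiveTensorIdeal :
    M.IsPreNicholsIdeal M.skewPrimitiveTensorIdeal where
  isTwoSided := inferInstanceAs (Ideal.IsTwoSided (Ideal.comap _ _))
  isHomogeneous := by
    intro i u hu
    -- Modulo the Nichols ideal, which is itself homogeneous, `u` is a sum of homogeneous elements
    -- of the ideal.
    obtain ⟨w, hw, hw'⟩ := M.mem_skewPrimitiveTensorIdeal_of_coeffAt hu (γ := 1) (u := u)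
      ((M.coeffAt_bosonMk 1 (single 1 u)).trans (by simp))
    have h1 : (DirectSum.decompose M.tensorGrading w i : M.Tensor) ∈
        M.skewPrimitiveTensorIdeal := by
      clear hw'
      induction hw using Submodule.span_induction with
      | zero => simp
      | add x y _ _ hx hy =>
        rw [DirectSum.decompose_add, DirectSum.add_apply, Submodule.coe_add]
        exact add_mem hx hy
      | smul c x _ hx =>
        rw [DirectSum.decompose_smul, DirectSum.smul_apply, Submodule.coe_smul]
        exact (M.skewPrimitiveTensorIdeal.restrictScalars k).smul_mem c hx
      | mem x hx =>
        obtain ⟨hx, n, -, hn⟩ := hx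
        by_cases h : n = i
        · subst h
          rwa [DirectSum.decompose_of_mem_same _ hn]
        · rw [DirectSum.decompose_of_mem_ne _ hn h]
          exact zero_mem _
    have h2 := M.nicholsIdeal_le_skewPrimitiveTensorIdeal (M.isHomogeneous_nicholsIdeal i hw')
    have h3 := add_mem h2 h1
    rwa [← Submodule.coe_add, ← DirectSum.add_apply, ← DirectSum.decompose_add,
      sub_add_cancel] at h3
  two_le_degree := by
    intro u hu n hn
    obtain ⟨w, hw, hw'⟩ := M.mem_skewPrimitiveTensorIdeal_of_coeffAt hu (γ := 1) (u := u)
      ((M.coeffAt_bosonMk 1 (single 1 u)).trans (by simp))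
    have h1 : GradedRing.proj M.tensorGrading n w = 0 := by
      clear hw'
      induction hw using Submodule.span_induction with
      | zero => simp
      | add x y _ _ hx hy => rw [map_add, hx, hy, add_zero]
      | smul c x _ hx =>
        rw [GradedRing.proj_apply] at hx ⊢
        rw [DirectSum.decompose_smul, DirectSum.smul_apply, Submodule.coe_smul, hx, smul_zero]
      | mem x hx =>
        obtain ⟨-, m, hm, hx⟩ := hx
        rw [GradedRing.proj_apply, DirectSum.decompose_of_mem_ne _ hx (by omega)]
    have h2 := M.proj_eq_zero_of_mem_nicholsIdeal hw' hn
    rwa [map_sub, h1, sub_zero] at h2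
  smul_mem γ u hu := by
    rw [← M.bosonSingle_mem_skewPrimitiveIdeal_iff γ]
    have := Ideal.mul_mem_left _ (M.bosonGroup γ) (M.mem_skewPrimitiveTensorIdeal.1 hu)
    have e : M.bosonGroup γ * M.bosonSingle 1 u = M.bosonSingle γ (γ • u) := by
      rw [← bosonMk_group, bosonSingle_apply, ← map_mul]
      simp [single_mul_single, bosonSingle_apply]
    rw [← e]
    exact this
  isCoideal :=
    { counit_eq_zero := fun a ha => by
        rw [mem_smashIdeal_skewPrimitive_iff] at ha
        rw [← counit_bosonMk]
        exact M.counit_eq_zero_of_mem_skewPrimitiveIdeal ha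
      map_mkQ_comul_eq_zero := fun a ha => by
        set f : SkewMonoidAlgebra M.Tensor Γ →ₐ[k] M.Bosonization ⧸ M.skewPrimitiveIdeal :=
          M.skewPrimitiveMk.comp M.bosonMk
        have hker : LinearMap.ker f.toLinearMap = M.smashIdeal M.skewPrimitiveTensorIdeal := by
          ext b
          rw [mem_smashIdeal_skewPrimitive_iff]
          exact Ideal.Quotient.eq_zero_iff_mem
        -- Over a field the tensor square of an injective map is injective, so the coideal condition
        -- may be tested in the quotient of the bosonization.
        have hinj : Function.Injective
            ((M.smashIdeal M.skewPrimitiveTensorIdeal).liftQ f.toLinearMap hker.ge) := by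
          rw [← LinearMap.ker_eq_bot]
          exact Submodule.ker_liftQ_eq_bot _ _ _ hker.le
        refine TensorProduct.map_injective_of_flat_flat _ _ hinj hinj ?_
        rw [map_zero, ← LinearMap.comp_apply, ← TensorProduct.map_comp, Submodule.liftQ_mkQ]
        rw [mem_smashIdeal_skewPrimitive_iff] at ha
        have := M.skewPrimitiveMk_comul ha
        rw [← map_bosonMk_comul, ← AlgHom.comp_apply, ← Algebra.TensorProduct.map_comp] at this
        exact this }
  antipode_mem a ha := by
    rw [mem_smashIdeal_skewPrimitive_iff] at ha ⊢
    rw [← antipode_bosonMk]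
    exact M.antipode_mem_skewPrimitiveIdeal ha

/-- In the bosonization of a Nichols algebra there are no homogeneous skew primitive elements of
degree at least `2`. -/
theorem eq_zero_of_skewPrimitive {a : M.Bosonization} {n : ℕ} {γ : Γ} (hn : 2 ≤ n)
    (ha : a ∈ M.homog n γ) {σ τ : Γ}
    (h : comul (R := k) a = a ⊗ₜ M.bosonGroup σ + M.bosonGroup τ ⊗ₜ a) : a = 0 := by
  -- Maximality of the Nichols ideal enters here: the pull back of the ideal to `T(V)` is contained
  -- in it, so a representative of `a` already vanishes in the Nichols algebra.
  have hs : a ∈ M.skewPrimitiveIdeal :=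
    M.skewPrimitives_subset ⟨⟨n, γ, hn, ha⟩, σ, τ, h⟩
  obtain ⟨u, -, rfl⟩ := ha
  rw [bosonSingle_mem_skewPrimitiveIdeal_iff] at hs
  exact M.bosonSingle_eq_zero_iff.2
    (M.le_nicholsIdeal M.isPreNicholsIdeal_skewPrimitiveTensorIdeal hs)

end YetterDrinfeld

/-! ### Normalized skew primitive generators. -/

namespace YetterDrinfeld

open Coalgebra SkewMonoidAlgebra

variable {k Γ X : Type*} [Field k] [CommGroup Γ] (M : YetterDrinfeld k Γ X)

/-- The inclusion of `V` in `𝔅(V) # kΓ`. -/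
def bosonι : (X →₀ k) →ₗ[k] M.Bosonization := M.bosonSingle 1 ∘ₗ M.ι

lemma bosonι_single (x : X) : M.bosonι (Finsupp.single x 1) = M.bosonGen x := M.bosonMk_gen x

lemma bosonGroup_mul_bosonι (γ : Γ) (v : X →₀ k) :
    M.bosonGroup γ * M.bosonι v = M.bosonι (M.action γ v) * M.bosonGroup γ := by
  simp only [bosonι, LinearMap.comp_apply, bosonSingle_apply, ← bosonMk_group, ← map_mul]
  simp [single_mul_single, smul_ι]

lemma bosonGroup_inv_mul_cancel (γ : Γ) : M.bosonGroup γ⁻¹ * M.bosonGroup γ = 1 := by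
  rw [bosonGroup_mul, inv_mul_cancel, bosonGroup_one]

lemma bosonGroup_mul_inv_cancel (γ : Γ) : M.bosonGroup γ * M.bosonGroup γ⁻¹ = 1 := by
  rw [bosonGroup_mul, mul_inv_cancel, bosonGroup_one]

lemma commute_bosonGroup (γ δ : Γ) : Commute (M.bosonGroup γ) (M.bosonGroup δ) := by
  rw [Commute, SemiconjBy, bosonGroup_mul, bosonGroup_mul, mul_comm]

/-- The skew primitive element `(deg x)⁻¹ x`. -/
def normGen (x : X) : M.Bosonization := M.bosonGroup (M.deg x)⁻¹ * M.bosonGen x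

lemma bosonGroup_mul_normGen (x : X) :
    M.bosonGroup (M.deg x) * M.normGen x = M.bosonGen x := by
  rw [normGen, ← mul_assoc, bosonGroup_mul_inv_cancel, one_mul]

lemma comul_normGen (x : X) : comul (R := k) (M.normGen x) =
    M.normGen x ⊗ₜ M.bosonGroup (M.deg x)⁻¹ + 1 ⊗ₜ M.normGen x := by
  rw [normGen, Bialgebra.comul_mul, comul_bosonGroup, comul_bosonGen, mul_add,
    Algebra.TensorProduct.tmul_mul_tmul, Algebra.TensorProduct.tmul_mul_tmul, mul_one,
    bosonGroup_inv_mul_cancel]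

lemma normGen_mem_homog (x : X) : M.normGen x ∈ M.homog 1 (M.deg x)⁻¹ := by
  have := M.mul_mem_homog (M.bosonGroup_mem_homog (M.deg x)⁻¹) (M.bosonGen_mem_homog x)
  rwa [zero_add, mul_one] at this

/-- The coproduct of the commutator of two skew primitive elements. -/
lemma comul_innerDer {a b : M.Bosonization} {α β : Γ}
    (ha : comul (R := k) a = a ⊗ₜ M.bosonGroup α + 1 ⊗ₜ a)
    (hb : comul (R := k) b = b ⊗ₜ M.bosonGroup β + 1 ⊗ₜ b) :
    comul (R := k) (innerDer k a b) =
      innerDer k a b ⊗ₜ M.bosonGroup (α * β) + M.bosonGroup 1 ⊗ₜ innerDer k a b +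
        (b ⊗ₜ innerDer k a (M.bosonGroup β) - a ⊗ₜ innerDer k b (M.bosonGroup α)) := by
  simp only [innerDer_apply, map_sub, Bialgebra.comul_mul, ha, hb, add_mul, mul_add,
    Algebra.TensorProduct.tmul_mul_tmul, one_mul, mul_one, TensorProduct.sub_tmul,
    TensorProduct.tmul_sub, bosonGroup_one, bosonGroup_mul, mul_comm β α]
  abel

end YetterDrinfeld

/-! ### Commuting spans and their `p`-th powers. -/

section CommutingSpan

variable {k R : Type*} [Field k] [Ring R] [Algebra k R]

/-- Spans of commuting sets commute. -/
lemma commute_of_mem_span {s t : Set R} (h : ∀ a ∈ s, ∀ b ∈ t, Commute a b) {a b : R}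
    (ha : a ∈ Submodule.span k s) (hb : b ∈ Submodule.span k t) : Commute a b := by
  induction ha using Submodule.span_induction with
  | zero => exact Commute.zero_left _
  | add x y _ _ hx hy => exact hx.add_left hy
  | smul c x _ hx => exact hx.smul_left c
  | mem a ha =>
    induction hb using Submodule.span_induction with
    | zero => exact Commute.zero_right _
    | add x y _ _ hx hy => exact hx.add_right hy
    | smul c x _ hx => exact hx.smul_right c
    | mem b hb => exact h a ha b hb

lemma innerDer_one_tmul_pow (e a b : R) (n : ℕ) :
    (innerDer k ((1 : R) ⊗ₜ[k] e) ^ n) (a ⊗ₜ[k] b) = a ⊗ₜ (innerDer k e ^ n) b := by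
  induction n with
  | zero => rfl
  | succ n ih =>
    rw [pow_succ', Module.End.mul_apply, ih, pow_succ', Module.End.mul_apply, innerDer_apply,
      innerDer_apply, Algebra.TensorProduct.tmul_mul_tmul, Algebra.TensorProduct.tmul_mul_tmul,
      one_mul, mul_one, TensorProduct.tmul_sub]

variable {p : ℕ} [hp : Fact p.Prime] [CharP k p]

lemma add_pow_charP_of_commute (k : Type*) [Field k] [Algebra k R] [CharP k p] {a b : R}
    (h : Commute a b) : (a + b) ^ p = a ^ p + b ^ p := by
  have hz : (p : R) = 0 := by
    rw [← map_natCast (algebraMap k _), CharP.cast_eq_zero, map_zero]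
  obtain ⟨r, hr⟩ := h.exists_add_pow_prime_eq hp.out
  rw [hr, hz]
  simp

/-- In characteristic `p`, the elements of the span of commuting elements with vanishing `p`-th
powers have vanishing `p`-th powers. -/
lemma pow_char_eq_zero_of_mem_span {s : Set R} (h : ∀ a ∈ s, ∀ b ∈ s, Commute a b)
    (h0 : ∀ a ∈ s, a ^ p = 0) {a : R} (ha : a ∈ Submodule.span k s) : a ^ p = 0 := by
  induction ha using Submodule.span_induction with
  | zero => exact zero_pow hp.out.ne_zero
  | add x y hx' hy' hx hy =>
    rw [add_pow_charP_of_commute k (commute_of_mem_span h hx' hy'), hx, hy, add_zero]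
  | smul c x _ hx => rw [smul_pow, hx, smul_zero]
  | mem a ha => exact h0 a ha

end CommutingSpan

/-! ### Quadratic relations in `H` and nilpotency of the `g_j⁻¹ y_j`. -/

namespace BlockPointDatum

open Coalgebra YetterDrinfeld

section Relations

variable {p : ℕ} (D : BlockPointDatum p) (k : Type*) [Field k] [CharP k p]

/-- The element `γ` of `H`, for `γ ∈ Γ`. -/
abbrev grpElt (γ : D.Grp) : D.HopfH k := (D.braidedSpace k).bosonGroup γ

/-- The skew primitive element `g_i⁻¹ x_i` of `H`. -/
def xNorm (i : D.Index) : D.HopfH k := (D.braidedSpace k).normGen (Sum.inl i)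

/-- The skew primitive element `g_j⁻¹ y_j` of `H`, for a block `j`. -/
def yNorm (j : Fin D.t) : D.HopfH k := (D.braidedSpace k).normGen (Sum.inr j)

lemma xNorm_eq (i : D.Index) : D.xNorm k i = D.grpElt k (D.grp i)⁻¹ * D.x k i := rfl

lemma yNorm_eq (j : Fin D.t) : D.yNorm k j = D.grpElt k (D.grp (Sum.inl j))⁻¹ * D.y k j := rfl

lemma comul_xNorm (i : D.Index) : comul (R := k) (D.xNorm k i) =
    D.xNorm k i ⊗ₜ D.grpElt k (D.grp i)⁻¹ + 1 ⊗ₜ D.xNorm k i :=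
  (D.braidedSpace k).comul_normGen (Sum.inl i)

lemma comul_yNorm (j : Fin D.t) : comul (R := k) (D.yNorm k j) =
    D.yNorm k j ⊗ₜ D.grpElt k (D.grp (Sum.inl j))⁻¹ + 1 ⊗ₜ D.yNorm k j :=
  (D.braidedSpace k).comul_normGen (Sum.inr j)

lemma xNorm_mem_homog (i : D.Index) : D.xNorm k i ∈ (D.braidedSpace k).homog 1 (D.grp i)⁻¹ :=
  (D.braidedSpace k).normGen_mem_homog (Sum.inl i)

lemma yNorm_mem_homog (j : Fin D.t) :
    D.yNorm k j ∈ (D.braidedSpace k).homog 1 (D.grp (Sum.inl j))⁻¹ :=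
  (D.braidedSpace k).normGen_mem_homog (Sum.inr j)

lemma grpElt_mul_x (γ : D.Grp) (i : D.Index) :
    D.grpElt k γ * D.x k i = D.x k i * D.grpElt k γ := by
  have h := (D.braidedSpace k).bosonGroup_mul_bosonι γ (D.vecX k i)
  rw [action_vecX] at h
  have e : (D.braidedSpace k).bosonι (D.vecX k i) = D.x k i :=
    (D.braidedSpace k).bosonι_single _
  rwa [e] at h

lemma grpElt_mul_y (γ : D.Grp) (j : Fin D.t) :
    D.grpElt k γ * D.y k j =
      (D.y k j + D.shift k γ j • D.x k (Sum.inl j)) * D.grpElt k γ := by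
  have h := (D.braidedSpace k).bosonGroup_mul_bosonι γ (D.vecY k j)
  have e : (D.braidedSpace k).bosonι (D.vecX k (Sum.inl j)) = D.x k (Sum.inl j) :=
    (D.braidedSpace k).bosonι_single _
  have e' : (D.braidedSpace k).bosonι (D.vecY k j) = D.y k j :=
    (D.braidedSpace k).bosonι_single _
  have e2 : (D.braidedSpace k).action γ (D.vecY k j) =
      D.vecY k j + D.shift k γ j • D.vecX k (Sum.inl j) := by
    simp [braidedSpace, vecX, vecY, actBasis]
  rwa [e2, map_add, map_smul, e, e'] at h

lemma commute_grpElt_xNorm (γ : D.Grp) (i : D.Index) :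
    Commute (D.grpElt k γ) (D.xNorm k i) :=
  ((D.braidedSpace k).commute_bosonGroup _ _).mul_right (D.grpElt_mul_x k γ i)

/-- Conjugation by `γ` adds to `y_j` a multiple of `x_j`, so the commutator with `γ` measures the
shift. It is the only source of correction terms in `comul_innerDer` for the generators used here.
-/
lemma innerDer_yNorm_grpElt (j : Fin D.t) (γ : D.Grp) :
    innerDer k (D.yNorm k j) (D.grpElt k γ) =
      -D.shift k γ j • (D.xNorm k (Sum.inl j) * D.grpElt k γ) := by
  have h : D.grpElt k γ * D.yNorm k j = D.yNorm k j * D.grpElt k γ +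
      D.shift k γ j • (D.xNorm k (Sum.inl j) * D.grpElt k γ) := by
    rw [yNorm_eq, xNorm_eq, ← mul_assoc,
      ((D.braidedSpace k).commute_bosonGroup γ _).eq, mul_assoc, grpElt_mul_y, add_mul, mul_add,
      smul_mul_assoc, mul_smul_comm, mul_assoc, mul_assoc]
  rw [innerDer_apply, h, neg_smul]
  abel

lemma shift_inv (γ : D.Grp) (j : Fin D.t) : D.shift k γ⁻¹ j = -D.shift k γ j := by
  rw [eq_neg_iff_add_eq_zero, ← shift_mul, inv_mul_cancel, shift_one]

lemma shift_pow (γ : D.Grp) (j : Fin D.t) (n : ℕ) : D.shift k (γ ^ n) j = n * D.shift k γ j := by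
  induction n with
  | zero => simp [shift_one]
  | succ n ih => rw [pow_succ, shift_mul, ih]; push_cast; ring

lemma shift_grp_block (i j : Fin D.t) :
    D.shift k (D.grp (Sum.inl i)) j = if i = j then 1 else 0 := by
  rw [shift_grp, coeff]
  split_ifs <;> simp

lemma shift_grp_point (h : Fin D.s) (j : Fin D.t) :
    D.shift k (D.grp (Sum.inr h)) j = ZMod.castHom (dvd_refl p) k (D.a h j) := by
  rw [shift_grp, coeff]

/-- The group elements commute with both factors, so the correction terms of `comul_innerDer`
vanish. The commutator is then a homogeneous skew primitive element of degree two, hence zero. The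
other commutation relations follow the same pattern. -/
lemma commute_xNorm (i l : D.Index) : Commute (D.xNorm k i) (D.xNorm k l) := by
  have h := (D.braidedSpace k).comul_innerDer (D.comul_xNorm k i) (D.comul_xNorm k l)
  have h0 (i : D.Index) (γ : D.Grp) : innerDer k (D.xNorm k i) (D.grpElt k γ) = 0 :=
    sub_eq_zero.2 (D.commute_grpElt_xNorm k γ i).eq.symm
  rw [h0, h0, TensorProduct.tmul_zero, TensorProduct.tmul_zero, sub_zero, add_zero] at h
  have hm : innerDer k (D.xNorm k i) (D.xNorm k l) ∈
      (D.braidedSpace k).homog (1 + 1) ((D.grp i)⁻¹ * (D.grp l)⁻¹) := by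
    refine sub_mem ((D.braidedSpace k).mul_mem_homog (D.xNorm_mem_homog k i)
      (D.xNorm_mem_homog k l)) ?_
    rw [mul_comm (D.grp i)⁻¹]
    exact (D.braidedSpace k).mul_mem_homog (D.xNorm_mem_homog k l) (D.xNorm_mem_homog k i)
  exact sub_eq_zero.1 ((D.braidedSpace k).eq_zero_of_skewPrimitive le_rfl hm h)

lemma commute_yNorm (i j : Fin D.t) : Commute (D.yNorm k i) (D.yNorm k j) := by
  rcases eq_or_ne i j with rfl | hij
  · exact Commute.refl _
  have h := (D.braidedSpace k).comul_innerDer (D.comul_yNorm k i) (D.comul_yNorm k j)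
  have h1 : innerDer k (D.yNorm k i) (D.grpElt k (D.grp (Sum.inl j))⁻¹) = 0 := by
    rw [innerDer_yNorm_grpElt, shift_inv, shift_grp_block, if_neg hij.symm]; simp
  have h2 : innerDer k (D.yNorm k j) (D.grpElt k (D.grp (Sum.inl i))⁻¹) = 0 := by
    rw [innerDer_yNorm_grpElt, shift_inv, shift_grp_block, if_neg hij]; simp
  rw [h1, h2, TensorProduct.tmul_zero, TensorProduct.tmul_zero, sub_zero, add_zero] at h
  have hm : innerDer k (D.yNorm k i) (D.yNorm k j) ∈
      (D.braidedSpace k).homog (1 + 1) ((D.grp (Sum.inl i))⁻¹ * (D.grp (Sum.inl j))⁻¹) := by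
    refine sub_mem ((D.braidedSpace k).mul_mem_homog (D.yNorm_mem_homog k i)
      (D.yNorm_mem_homog k j)) ?_
    rw [mul_comm (D.grp (Sum.inl i))⁻¹]
    exact (D.braidedSpace k).mul_mem_homog (D.yNorm_mem_homog k j) (D.yNorm_mem_homog k i)
  exact sub_eq_zero.1 ((D.braidedSpace k).eq_zero_of_skewPrimitive le_rfl hm h)

lemma innerDer_yNorm_xNorm_of_ne {i j : Fin D.t} (hij : i ≠ j) :
    innerDer k (D.yNorm k j) (D.xNorm k (Sum.inl i)) = 0 := by
  have h := (D.braidedSpace k).comul_innerDer (D.comul_yNorm k j) (D.comul_xNorm k (Sum.inl i))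
  have h1 : innerDer k (D.yNorm k j) (D.grpElt k (D.grp (Sum.inl i))⁻¹) = 0 := by
    rw [innerDer_yNorm_grpElt, shift_inv, shift_grp_block, if_neg hij]; simp
  have h2 (γ : D.Grp) : innerDer k (D.xNorm k (Sum.inl i)) (D.grpElt k γ) = 0 :=
    sub_eq_zero.2 (D.commute_grpElt_xNorm k γ _).eq.symm
  rw [h1, h2, TensorProduct.tmul_zero, TensorProduct.tmul_zero, sub_zero, add_zero] at h
  have hm : innerDer k (D.yNorm k j) (D.xNorm k (Sum.inl i)) ∈
      (D.braidedSpace k).homog (1 + 1) ((D.grp (Sum.inl j))⁻¹ * (D.grp (Sum.inl i))⁻¹) := by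
    refine sub_mem ((D.braidedSpace k).mul_mem_homog (D.yNorm_mem_homog k j)
      (D.xNorm_mem_homog k _)) ?_
    rw [mul_comm (D.grp (Sum.inl j))⁻¹]
    exact (D.braidedSpace k).mul_mem_homog (D.xNorm_mem_homog k _) (D.yNorm_mem_homog k j)
  exact (D.braidedSpace k).eq_zero_of_skewPrimitive le_rfl hm h

variable [hp : Fact p.Prime]

lemma two_ne_zero_of_char (h2 : p ≠ 2) : (2 : k) ≠ 0 := by
  intro h
  have h' : ((2 : ℕ) : k) = 0 := by exact_mod_cast h
  rw [CharP.cast_eq_zero_iff k p] at h'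
  exact h2 ((Nat.prime_dvd_prime_iff_eq hp.out Nat.prime_two).1 h')

/-- The defining relation of the Jordan plane. -/
lemma innerDer_yNorm_xNorm_self (h2 : p ≠ 2) (j : Fin D.t) :
    innerDer k (D.yNorm k j) (D.xNorm k (Sum.inl j)) =
      (2 : k)⁻¹ • D.xNorm k (Sum.inl j) ^ 2 := by
  set M := D.braidedSpace k
  set X := D.xNorm k (Sum.inl j)
  set Y := D.yNorm k j
  set γ := (D.grp (Sum.inl j))⁻¹
  have h2' := two_ne_zero_of_char k h2
  have hY : comul (R := k) Y = Y ⊗ₜ M.bosonGroup γ + 1 ⊗ₜ Y := D.comul_yNorm k j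
  have hX0 : comul (R := k) X = X ⊗ₜ M.bosonGroup γ + 1 ⊗ₜ X := D.comul_xNorm k (Sum.inl j)
  have h := M.comul_innerDer hY hX0
  have h1 : innerDer k Y (D.grpElt k γ) = X * D.grpElt k γ := by
    rw [innerDer_yNorm_grpElt, shift_inv, shift_grp_block, if_pos rfl]; simp [X]
  have h3 : innerDer k X (D.grpElt k γ) = 0 :=
    sub_eq_zero.2 (D.commute_grpElt_xNorm k γ _).eq.symm
  rw [h1, h3, TensorProduct.tmul_zero, sub_zero] at h
  -- The correction term of `X ^ 2` is twice the term `X ⊗ X γ` of `[Y, X]`. This is where the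
  -- factor `1 / 2` comes from: it makes the difference skew primitive.
  have hX : comul (R := k) (X ^ 2) = (X ^ 2) ⊗ₜ M.bosonGroup (γ * γ) + M.bosonGroup 1 ⊗ₜ (X ^ 2) +
      (2 : k) • (X ⊗ₜ (X * D.grpElt k γ)) := by
    rw [sq, Bialgebra.comul_mul, hX0]
    simp only [add_mul, mul_add, Algebra.TensorProduct.tmul_mul_tmul, one_mul, mul_one,
      bosonGroup_mul, bosonGroup_one]
    rw [show M.bosonGroup γ * X = X * M.bosonGroup γ from
      (D.commute_grpElt_xNorm k γ (Sum.inl j)).eq, two_smul]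
    abel
  have hs : comul (R := k) (innerDer k Y X - (2 : k)⁻¹ • X ^ 2) =
      (innerDer k Y X - (2 : k)⁻¹ • X ^ 2) ⊗ₜ M.bosonGroup (γ * γ) +
        M.bosonGroup 1 ⊗ₜ (innerDer k Y X - (2 : k)⁻¹ • X ^ 2) := by
    rw [map_sub, map_smul, hX, h]
    simp only [smul_add, smul_smul, inv_mul_cancel₀ h2', one_smul, TensorProduct.sub_tmul,
      TensorProduct.tmul_sub, ← TensorProduct.smul_tmul', TensorProduct.tmul_smul]
    abel
  have hm : innerDer k Y X - (2 : k)⁻¹ • X ^ 2 ∈ M.homog (1 + 1) (γ * γ) := by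
    refine sub_mem (sub_mem (M.mul_mem_homog (D.yNorm_mem_homog k j) (D.xNorm_mem_homog k _))
      (M.mul_mem_homog (D.xNorm_mem_homog k _) (D.yNorm_mem_homog k j))) ?_
    rw [sq]
    exact Submodule.smul_mem _ _ (M.mul_mem_homog (D.xNorm_mem_homog k _) (D.xNorm_mem_homog k _))
  exact sub_eq_zero.1 (M.eq_zero_of_skewPrimitive le_rfl hm hs)

lemma innerDer_yNorm_xNorm_pow (h2 : p ≠ 2) (j : Fin D.t) (n : ℕ) :
    innerDer k (D.yNorm k j) (D.xNorm k (Sum.inl j) ^ n) =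
      ((n : k) / 2) • D.xNorm k (Sum.inl j) ^ (n + 1) := by
  induction n with
  | zero => simp
  | succ n ih =>
    rw [pow_succ, innerDer_mul, ih, D.innerDer_yNorm_xNorm_self k h2, smul_mul_assoc,
      mul_smul_comm, ← pow_add, ← pow_succ, ← add_smul]
    congr 1
    push_cast
    ring

lemma innerDer_yNorm_xNorm_pow_mul_grpElt (h2 : p ≠ 2) (j : Fin D.t) (n : ℕ) (γ : D.Grp) :
    innerDer k (D.yNorm k j) (D.xNorm k (Sum.inl j) ^ n * D.grpElt k γ) =
      ((n : k) / 2 - D.shift k γ j) • (D.xNorm k (Sum.inl j) ^ (n + 1) * D.grpElt k γ) := by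
  rw [innerDer_mul, D.innerDer_yNorm_xNorm_pow k h2, innerDer_yNorm_grpElt, smul_mul_assoc,
    mul_smul_comm, ← mul_assoc, ← pow_succ, ← add_smul, sub_eq_add_neg]

lemma innerDer_yNorm_pow_grpElt (h2 : p ≠ 2) (j : Fin D.t) (γ : D.Grp) (n : ℕ) :
    (innerDer k (D.yNorm k j) ^ n) (D.grpElt k γ) =
      (∏ i ∈ Finset.range n, ((i : k) / 2 - D.shift k γ j)) •
        (D.xNorm k (Sum.inl j) ^ n * D.grpElt k γ) := by
  induction n with
  | zero => simp
  | succ n ih =>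
    rw [pow_succ', Module.End.mul_apply, ih, map_smul,
      D.innerDer_yNorm_xNorm_pow_mul_grpElt k h2, smul_smul, Finset.prod_range_succ]

/-- Jacobson's formula applies to `Δ(Y) = 1 ⊗ Y + Y ⊗ γ`. The extra term `Y ⊗ ad(Y) ^ (p - 1) (γ)`
carries the product of the scalars `i / 2 + 1` for `i < p - 1`, and the factor at `i = p - 2` is `p
/ 2 = 0`. Hence `Y ^ p` is skew primitive of degree `p`. -/
lemma yNorm_pow (h2 : p ≠ 2) (j : Fin D.t) : D.yNorm k j ^ p = 0 := by
  set M := D.braidedSpace k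
  set γ := (D.grp (Sum.inl j))⁻¹
  have hγ : D.shift k γ j = -1 := by rw [shift_inv, shift_grp_block, if_pos rfl]
  have hc (n : ℕ) : Commute (D.yNorm k j ⊗ₜ[k] D.grpElt k γ)
      ((innerDer k ((1 : D.HopfH k) ⊗ₜ[k] D.yNorm k j) ^ n)
        (D.yNorm k j ⊗ₜ[k] D.grpElt k γ)) := by
    rw [innerDer_one_tmul_pow, D.innerDer_yNorm_pow_grpElt k h2, TensorProduct.tmul_smul]
    refine Commute.smul_right ?_ _
    have : Commute (D.grpElt k γ) (D.xNorm k (Sum.inl j) ^ n * D.grpElt k γ) :=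
      ((D.commute_grpElt_xNorm k γ _).pow_right n).mul_right (Commute.refl _)
    rw [Commute, SemiconjBy, Algebra.TensorProduct.tmul_mul_tmul,
      Algebra.TensorProduct.tmul_mul_tmul, this.eq]
  have h := add_pow_char_of_commute_innerDer (k := k) (p := p) _ _ hc
  have hz : ∏ i ∈ Finset.range (p - 1), ((i : k) / 2 - D.shift k γ j) = 0 := by
    have := hp.out.two_le
    refine Finset.prod_eq_zero (i := p - 2) (Finset.mem_range.2 (by omega)) ?_
    rw [hγ, Nat.cast_sub this, CharP.cast_eq_zero]
    have := two_ne_zero_of_char k h2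
    push_cast
    field_simp
    ring
  rw [innerDer_one_tmul_pow, D.innerDer_yNorm_pow_grpElt k h2, hz, zero_smul,
    TensorProduct.tmul_zero, add_zero, add_comm, ← D.comul_yNorm k j, ← Bialgebra.comul_pow,
    Algebra.TensorProduct.tmul_pow, Algebra.TensorProduct.tmul_pow, one_pow, bosonGroup_pow,
    add_comm] at h
  have hm := M.pow_mem_homog (D.yNorm_mem_homog k j) p
  exact M.eq_zero_of_skewPrimitive (by have := hp.out.two_le; omega) hm h

end Relations

end BlockPointDatum

/-! ### Coefficients in the coproducts of iterated commutators. -/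

namespace BlockPointDatum

open Coalgebra YetterDrinfeld

section OrbitCoefficients

variable (k : Type*) [Field k]

/-- The coefficients of the coproducts of the iterated commutators with one element. -/
def orbitCoeff (G n i : ℕ) : k := (n.choose i : k) * ∏ l ∈ Finset.Ico i n, ((l : k) - G) / 2

lemma orbitCoeff_zero_right (G n : ℕ) :
    orbitCoeff k G (n + 1) 0 = orbitCoeff k G n 0 * (((n : k) - G) / 2) := by
  rw [orbitCoeff, orbitCoeff, Nat.choose_zero_right, Nat.choose_zero_right,
    Finset.prod_Ico_succ_top (Nat.zero_le _), mul_assoc]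

/-- Once the common factor is taken out, this reduces to `(i + 1) C(n, i + 1) = (n - i) C(n, i)`. It
is the recursion that the coproducts satisfy when one more commutator is taken. -/
lemma orbitCoeff_succ (h2 : (2 : k) ≠ 0) (G : ℕ) {n i : ℕ} (hi : i ≤ n) :
    orbitCoeff k G (n + 1) (i + 1) =
      orbitCoeff k G n i + orbitCoeff k G n (i + 1) * (((n : k) + (i + 1 : ℕ) - G) / 2) := by
  rcases hi.eq_or_lt with rfl | hi
  · simp [orbitCoeff]
  · have e1 : ∏ l ∈ Finset.Ico i n, ((l : k) - G) / 2 =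
        ((i : k) - G) / 2 * ∏ l ∈ Finset.Ico (i + 1) n, ((l : k) - G) / 2 :=
      Finset.prod_eq_prod_Ico_succ_bot hi _
    have e2 : ∏ l ∈ Finset.Ico (i + 1) (n + 1), ((l : k) - G) / 2 =
        (∏ l ∈ Finset.Ico (i + 1) n, ((l : k) - G) / 2) * (((n : k) - G) / 2) :=
      Finset.prod_Ico_succ_top (by omega) _
    have e3 : (n.choose (i + 1) : k) * ((i : k) + 1) = (n.choose i : k) * ((n : k) - i) := by
      have := congrArg (Nat.cast (R := k)) (Nat.choose_succ_right_eq n i)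
      rw [Nat.cast_mul, Nat.cast_mul, Nat.cast_sub hi.le] at this
      exact_mod_cast this
    rw [orbitCoeff, orbitCoeff, orbitCoeff, e1, e2, Nat.choose_succ_succ]
    push_cast
    set Q := ∏ l ∈ Finset.Ico (i + 1) n, ((l : k) - G) / 2
    field_simp
    linear_combination (-Q) * e3

end OrbitCoefficients

/-! ### Iterated commutators of a point with the blocks. -/

section Orbits

variable {p : ℕ} (D : BlockPointDatum p) (k : Type*) [Field k] [CharP k p]

lemma grpElt_mem (γ : D.Grp) : D.grpElt k γ ∈ D.subalgebraK k := by
  have : NeZero D.f := ⟨D.f_pos.ne'⟩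
  let N : Submonoid D.Grp :=
    { carrier := {γ | D.grpElt k γ ∈ D.subalgebraK k}
      one_mem' := (D.subalgebraK k).one_mem
      mul_mem' := fun {a b} ha hb => by
        change (D.braidedSpace k).bosonGroup (a * b) ∈ D.subalgebraK k
        rw [← bosonGroup_mul]
        exact mul_mem ha hb }
  have h : γ = ∏ i, D.grp i ^ (Multiplicative.toAdd γ i).val := by
    apply Multiplicative.toAdd.injective
    funext l
    rw [toAdd_prod, Finset.sum_apply, Finset.sum_eq_single l]
    · rw [toAdd_pow, grp, toAdd_ofAdd, Pi.smul_apply, Pi.single_eq_same, nsmul_one,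
        ZMod.natCast_zmod_val]
    · intro i _ hi
      rw [toAdd_pow, grp, toAdd_ofAdd, Pi.smul_apply, Pi.single_eq_of_ne hi.symm, smul_zero]
    · exact fun hl => absurd (Finset.mem_univ l) hl
  have : γ ∈ N := by
    rw [h]
    exact N.prod_mem fun i _ => N.pow_mem (D.g_mem k i) _
  exact this

lemma xNorm_mem (j : Fin D.t) : D.xNorm k (Sum.inl j) ∈ D.subalgebraK k :=
  mul_mem (D.grpElt_mem k _) (D.x_mem k j)

lemma commute_of_mem_subalgebraK {w : D.HopfH k}
    (hx : ∀ j, Commute (D.xNorm k (Sum.inl j)) w) (hg : ∀ γ, Commute (D.grpElt k γ) w) :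
    ∀ b ∈ D.subalgebraK k, Commute b w := by
  have h : D.subalgebraK k ≤ Subalgebra.centralizer k {w} := by
    refine Algebra.adjoin_le ?_
    rintro _ (⟨j, rfl⟩ | ⟨i, rfl⟩)
    · rw [SetLike.mem_coe, Subalgebra.mem_centralizer_iff]
      rintro _ rfl
      have e : D.x k (Sum.inl j) = D.grpElt k (D.grp (Sum.inl j)) * D.xNorm k (Sum.inl j) :=
        ((D.braidedSpace k).bosonGroup_mul_normGen _).symm
      change _ * D.x k (Sum.inl j) = D.x k (Sum.inl j) * _
      rw [e]
      exact ((hg _).mul_left (hx j)).eq.symm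
    · rw [SetLike.mem_coe, Subalgebra.mem_centralizer_iff]
      rintro _ rfl
      exact (hg _).eq.symm
  exact fun b hb => ((Subalgebra.mem_centralizer_iff k).1 (h hb) w rfl).symm

lemma commute_grpElt_of_mem {b : D.HopfH k} (hb : b ∈ D.subalgebraK k) (γ : D.Grp) :
    Commute (D.grpElt k γ) b :=
  (D.commute_of_mem_subalgebraK k (fun _ => (D.commute_grpElt_xNorm k γ _).symm)
    (fun δ => (D.braidedSpace k).commute_bosonGroup δ γ) b hb).symm

/-- The Hopf subalgebra `K` is commutative. -/
lemma commute_of_mem_of_mem {b c : D.HopfH k} (hb : b ∈ D.subalgebraK k)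
    (hc : c ∈ D.subalgebraK k) : Commute b c :=
  D.commute_of_mem_subalgebraK k
    (fun _ => (D.commute_of_mem_subalgebraK k (fun _ => D.commute_xNorm k _ _)
      (fun γ => D.commute_grpElt_xNorm k γ _) c hc).symm)
    (fun γ => D.commute_grpElt_of_mem k hc γ) b hb

lemma commute_xNorm_of_mem {b : D.HopfH k} (hb : b ∈ D.subalgebraK k) (i : D.Index) :
    Commute b (D.xNorm k i) :=
  D.commute_of_mem_subalgebraK k (fun _ => D.commute_xNorm k _ _)
      (fun γ => D.commute_grpElt_xNorm k γ _) b hb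

/-- With a second factor that commutes with `g_j⁻¹`, the operator `ad(Δ(Y))` becomes `ad(Y) ⊗ g_j⁻¹
+ id ⊗ ad(Y)`. This computes the coproducts of iterated commutators inductively. -/
lemma innerDer_comul_yNorm_tmul (j : Fin D.t) {a b : D.HopfH k}
    (hb : Commute (D.grpElt k (D.grp (Sum.inl j))⁻¹) b) :
    innerDer k (comul (R := k) (D.yNorm k j)) (a ⊗ₜ[k] b) =
      innerDer k (D.yNorm k j) a ⊗ₜ (D.grpElt k (D.grp (Sum.inl j))⁻¹ * b) +
        a ⊗ₜ innerDer k (D.yNorm k j) b := by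
  rw [comul_yNorm]
  simp only [innerDer_apply, add_mul, mul_add, Algebra.TensorProduct.tmul_mul_tmul, one_mul,
    mul_one, TensorProduct.sub_tmul, TensorProduct.tmul_sub]
  rw [← hb.eq]
  abel

lemma comul_innerDer_apply (a b : D.HopfH k) : comul (R := k) (innerDer k a b) =
    innerDer k (comul (R := k) a) (comul (R := k) b) := by
  simp [innerDer_apply, Bialgebra.comul_mul]

/-- Commuting elements have commuting inner derivations. An iterated commutator therefore depends
only on the multiset of blocks, which makes the fold in `orbit` legitimate. -/
instance : LeftCommutative fun (j : Fin D.t) (a : D.HopfH k) => innerDer k (D.yNorm k j) a where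
  left_comm i j a := by
    have h := (D.commute_yNorm k i j).eq
    have e₁ : D.yNorm k i * (D.yNorm k j * a) = D.yNorm k j * (D.yNorm k i * a) := by
      rw [← mul_assoc, h, mul_assoc]
    have e₂ : a * D.yNorm k j * D.yNorm k i = a * D.yNorm k i * D.yNorm k j := by
      rw [mul_assoc, ← h, mul_assoc]
    simp only [innerDer_apply, mul_sub, sub_mul]
    rw [e₁, e₂]
    simp only [mul_assoc]
    abel

/-- The iterated commutators of `g_h⁻¹ x_h`, for a point `h`, with the elements `g_j⁻¹ y_j`. -/
def orbit (h : Fin D.s) (m : Multiset (Fin D.t)) : D.HopfH k :=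
  m.foldr (fun j a => innerDer k (D.yNorm k j) a) (D.xNorm k (Sum.inr h))

@[simp] lemma orbit_zero (h : Fin D.s) : D.orbit k h 0 = D.xNorm k (Sum.inr h) := rfl

lemma orbit_cons (h : Fin D.s) (j : Fin D.t) (m : Multiset (Fin D.t)) :
    D.orbit k h (j ::ₘ m) = innerDer k (D.yNorm k j) (D.orbit k h m) :=
  Multiset.foldr_cons _ _ _ _

lemma orbit_add_eq_zero {h : Fin D.s} {m : Multiset (Fin D.t)} (hm : D.orbit k h m = 0)
    (n : Multiset (Fin D.t)) : D.orbit k h (n + m) = 0 := by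
  induction n using Multiset.induction_on with
  | empty => rwa [zero_add]
  | cons j n ih => rw [Multiset.cons_add, orbit_cons, ih, map_zero]

lemma exists_orbit_mem_homog (h : Fin D.s) (m : Multiset (Fin D.t)) :
    ∃ γ, D.orbit k h m ∈ (D.braidedSpace k).homog (m.card + 1) γ := by
  induction m using Multiset.induction_on with
  | empty => exact ⟨_, D.xNorm_mem_homog k _⟩
  | cons j m ih =>
    obtain ⟨γ, hγ⟩ := ih
    refine ⟨(D.grp (Sum.inl j))⁻¹ * γ, ?_⟩
    rw [orbit_cons, Multiset.card_cons]
    have h1 := (D.braidedSpace k).mul_mem_homog (D.yNorm_mem_homog k j) hγ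
    have h2 := (D.braidedSpace k).mul_mem_homog hγ (D.yNorm_mem_homog k j)
    rw [mul_comm γ] at h2
    rw [add_comm 1] at h1
    exact sub_mem h1 h2

variable [hp : Fact p.Prime]

lemma innerDer_yNorm_mem (h2 : p ≠ 2) (j : Fin D.t) {b : D.HopfH k}
    (hb : b ∈ D.subalgebraK k) : innerDer k (D.yNorm k j) b ∈ D.subalgebraK k := by
  refine innerDer_mem_adjoin ?_ b hb
  have hg (γ : D.Grp) : innerDer k (D.yNorm k j) (D.grpElt k γ) ∈ D.subalgebraK k := by
    rw [innerDer_yNorm_grpElt]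
    exact Subalgebra.smul_mem _ (mul_mem (D.xNorm_mem k j) (D.grpElt_mem k γ)) _
  rintro _ (⟨i, rfl⟩ | ⟨i, rfl⟩)
  · have e : D.x k (Sum.inl i) = D.grpElt k (D.grp (Sum.inl i)) * D.xNorm k (Sum.inl i) :=
      ((D.braidedSpace k).bosonGroup_mul_normGen _).symm
    change innerDer k (D.yNorm k j) (D.x k (Sum.inl i)) ∈ D.subalgebraK k
    rw [e, innerDer_mul]
    refine add_mem (mul_mem (hg _) (D.xNorm_mem k i)) (mul_mem (D.grpElt_mem k _) ?_)
    rcases eq_or_ne i j with rfl | hij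
    · rw [D.innerDer_yNorm_xNorm_self k h2]
      exact Subalgebra.smul_mem _ (pow_mem (D.xNorm_mem k i) 2) _
    · rw [D.innerDer_yNorm_xNorm_of_ne k hij]
      exact zero_mem _
  · exact hg _

/-- By the Jacobi identity the centralizer of `K` is stable under `ad(Y_j)`, because `ad(Y_j)`
preserves `K`. The induction starts from `g_h⁻¹ x_h`, which commutes with `K`. -/
lemma commute_orbit_of_mem (h2 : p ≠ 2) (h : Fin D.s) (m : Multiset (Fin D.t)) {b : D.HopfH k}
    (hb : b ∈ D.subalgebraK k) : Commute b (D.orbit k h m) := by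
  induction m using Multiset.induction_on generalizing b with
  | empty => exact D.commute_xNorm_of_mem k hb _
  | cons j m ih =>
    have h1 := (ih hb).eq
    have h3 := (ih (D.innerDer_yNorm_mem k h2 j hb)).eq
    rw [orbit_cons]
    set w := D.orbit k h m
    simp only [innerDer_apply, sub_mul, mul_sub] at h3 ⊢
    rw [Commute, SemiconjBy, mul_sub, sub_mul, ← mul_assoc b w, h1, mul_assoc _ w b, ← h1,
      ← sub_eq_zero]
    have h4 : D.yNorm k j * b * w - b * D.yNorm k j * w =
        w * (D.yNorm k j * b) - w * (b * D.yNorm k j) := h3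
    rw [h1]
    have h5 : b * (D.yNorm k j * w) - w * b * D.yNorm k j -
        (D.yNorm k j * (w * b) - w * D.yNorm k j * b) = 0 := by
      rw [← h1]
      have : b * (D.yNorm k j * w) - b * w * D.yNorm k j -
        (D.yNorm k j * (b * w) - w * D.yNorm k j * b) =
        -(D.yNorm k j * b * w - b * D.yNorm k j * w) +
          (w * (D.yNorm k j * b) - w * (b * D.yNorm k j)) + (w * b - b * w) * D.yNorm k j +
          (w * D.yNorm k j * b - w * (D.yNorm k j * b)) := by noncomm_ring
      rw [this, h4, h1]
      noncomm_ring
    exact h5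

/-- The span of the elements `w ⊗ b`, where `b` is in `K` and `w` is an iterated commutator of
length less than `n`. -/
def orbitFiltration (h : Fin D.s) (n : ℕ) : Submodule k (D.HopfH k ⊗[k] D.HopfH k) :=
  Submodule.span k {z | ∃ m : Multiset (Fin D.t), m.card < n ∧ ∃ b ∈ D.subalgebraK k,
    z = D.orbit k h m ⊗ₜ b}

lemma innerDer_comul_yNorm_mem_orbitFiltration (h2 : p ≠ 2) (j : Fin D.t) {h : Fin D.s} {n : ℕ}
    {z : D.HopfH k ⊗[k] D.HopfH k} (hz : z ∈ D.orbitFiltration k h n) :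
    innerDer k (comul (R := k) (D.yNorm k j)) z ∈ D.orbitFiltration k h (n + 1) := by
  induction hz using Submodule.span_induction with
  | zero => rw [map_zero]; exact zero_mem _
  | add x y _ _ hx hy => rw [map_add]; exact add_mem hx hy
  | smul c x _ hx => rw [map_smul]; exact Submodule.smul_mem _ c hx
  | mem z hz =>
    obtain ⟨m, hm, b, hb, rfl⟩ := hz
    rw [innerDer_comul_yNorm_tmul _ _ _ (D.commute_grpElt_of_mem k hb _), ← orbit_cons]
    exact add_mem
      (Submodule.subset_span ⟨_, by rw [Multiset.card_cons]; omega, _,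
        mul_mem (D.grpElt_mem k _) hb, rfl⟩)
      (Submodule.subset_span ⟨m, by omega, _, D.innerDer_yNorm_mem k h2 j hb, rfl⟩)

/-- The coproduct of an iterated commutator, up to shorter ones. -/
lemma exists_comul_orbit (h2 : p ≠ 2) (h : Fin D.s) (m : Multiset (Fin D.t)) :
    ∃ γ, ∃ z ∈ D.orbitFiltration k h m.card, comul (R := k) (D.orbit k h m) =
      1 ⊗ₜ D.orbit k h m + D.orbit k h m ⊗ₜ D.grpElt k γ + z := by
  induction m using Multiset.induction_on with
  | empty => exact ⟨_, 0, zero_mem _, by rw [orbit_zero, comul_xNorm, add_zero, add_comm]⟩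
  | cons j m ih =>
    obtain ⟨γ, z, hz, e⟩ := ih
    refine ⟨(D.grp (Sum.inl j))⁻¹ * γ, D.orbit k h m ⊗ₜ innerDer k (D.yNorm k j) (D.grpElt k γ) +
      innerDer k (comul (R := k) (D.yNorm k j)) z, ?_, ?_⟩
    · rw [Multiset.card_cons]
      exact add_mem (Submodule.subset_span ⟨m, by omega, _,
        D.innerDer_yNorm_mem k h2 j (D.grpElt_mem k γ), rfl⟩)
        (D.innerDer_comul_yNorm_mem_orbitFiltration k h2 j hz)
    · rw [orbit_cons, comul_innerDer_apply, e, map_add, map_add,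
        innerDer_comul_yNorm_tmul _ _ _ (D.commute_orbit_of_mem k h2 h m (D.grpElt_mem k _)),
        innerDer_comul_yNorm_tmul _ _ _ (D.commute_grpElt_of_mem k (D.grpElt_mem k _) _),
        bosonGroup_mul]
      rw [show innerDer k (D.yNorm k j) 1 = 0 by simp [innerDer_apply], TensorProduct.zero_tmul,
        zero_add]
      abel

/-- The iterated commutators commute. -/
lemma commute_orbit (h2 : p ≠ 2) (h h' : Fin D.s) (m m' : Multiset (Fin D.t)) :
    Commute (D.orbit k h m) (D.orbit k h' m') := by
  -- Induction on the total length. The coproducts involve shorter commutators in the first factor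
  -- and elements of `K` in the second, so nearly all cross terms commute by the induction
  -- hypothesis and by `commute_orbit_of_mem`.
  induction hN : m.card + m'.card using Nat.strong_induction_on generalizing m m' with
  | _ N ih =>
    subst hN
    obtain ⟨γ, z, hz, e⟩ := D.exists_comul_orbit k h2 h m
    obtain ⟨γ', z', hz', e'⟩ := D.exists_comul_orbit k h2 h' m'
    have hK (i : Fin D.s) (n : Multiset (Fin D.t)) (b : D.HopfH k) (hb : b ∈ D.subalgebraK k) :=
      D.commute_orbit_of_mem k h2 i n hb
    have htmul {a b c d : D.HopfH k} (hac : Commute a c) (hbd : Commute b d) :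
        Commute (a ⊗ₜ[k] b) (c ⊗ₜ[k] d) := by
      rw [Commute, SemiconjBy, Algebra.TensorProduct.tmul_mul_tmul,
        Algebra.TensorProduct.tmul_mul_tmul, hac.eq, hbd.eq]
    have hG (δ : D.Grp) := D.grpElt_mem k δ
    have c1 : Commute z ((1 : D.HopfH k) ⊗ₜ[k] D.orbit k h' m') := by
      refine commute_of_mem_span (t := {(1 : D.HopfH k) ⊗ₜ[k] D.orbit k h' m'}) ?_ hz
        (Submodule.mem_span_singleton_self _)
      rintro _ ⟨n, hn, b, hb, rfl⟩ _ rfl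
      exact htmul (Commute.one_right _) (hK _ _ _ hb)
    have c2 : Commute z (D.orbit k h' m' ⊗ₜ[k] D.grpElt k γ') := by
      refine commute_of_mem_span (t := {D.orbit k h' m' ⊗ₜ[k] D.grpElt k γ'}) ?_ hz
        (Submodule.mem_span_singleton_self _)
      rintro _ ⟨n, hn, b, hb, rfl⟩ _ rfl
      exact htmul (ih _ (by omega) n m' rfl) (D.commute_of_mem_of_mem k hb (hG _))
    have c3 : Commute z z' := by
      refine commute_of_mem_span ?_ hz hz'
      rintro _ ⟨n, hn, b, hb, rfl⟩ _ ⟨n', hn', b', hb', rfl⟩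
      exact htmul (ih _ (by omega) n n' rfl) (D.commute_of_mem_of_mem k hb hb')
    have c4 : Commute ((1 : D.HopfH k) ⊗ₜ[k] D.orbit k h m) z' := by
      refine commute_of_mem_span (s := {(1 : D.HopfH k) ⊗ₜ[k] D.orbit k h m}) ?_
        (Submodule.mem_span_singleton_self _) hz'
      rintro _ rfl _ ⟨n, hn, b, hb, rfl⟩
      exact htmul (Commute.one_left _) (hK _ _ _ hb).symm
    have c5 : Commute (D.orbit k h m ⊗ₜ[k] D.grpElt k γ) z' := by
      refine commute_of_mem_span (s := {D.orbit k h m ⊗ₜ[k] D.grpElt k γ}) ?_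
        (Submodule.mem_span_singleton_self _) hz'
      rintro _ rfl _ ⟨n, hn, b, hb, rfl⟩
      exact htmul (ih _ (by omega) m n rfl) (D.commute_of_mem_of_mem k (hG _) hb)
    have c6 : Commute ((1 : D.HopfH k) ⊗ₜ[k] D.orbit k h m)
        (D.orbit k h' m' ⊗ₜ[k] D.grpElt k γ') :=
      htmul (Commute.one_left _) (hK _ _ _ (hG _)).symm
    have c7 : Commute (D.orbit k h m ⊗ₜ[k] D.grpElt k γ)
        ((1 : D.HopfH k) ⊗ₜ[k] D.orbit k h' m') :=
      htmul (Commute.one_right _) (hK _ _ _ (hG _))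
    have hs : comul (R := k) (innerDer k (D.orbit k h m) (D.orbit k h' m')) =
        innerDer k (D.orbit k h m) (D.orbit k h' m') ⊗ₜ D.grpElt k (γ * γ') +
          D.grpElt k 1 ⊗ₜ innerDer k (D.orbit k h m) (D.orbit k h' m') := by
      rw [comul_innerDer_apply, e, e']
      set w := D.orbit k h m
      set w' := D.orbit k h' m'
      -- Of the nine commutators of summands seven vanish. The other two say that `[w, w']` is skew
      -- primitive.
      have key : innerDer k (1 ⊗ₜ[k] w + w ⊗ₜ[k] D.grpElt k γ + z)
          (1 ⊗ₜ[k] w' + w' ⊗ₜ[k] D.grpElt k γ' + z') =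
          innerDer k (1 ⊗ₜ[k] w) (1 ⊗ₜ[k] w') +
            innerDer k (w ⊗ₜ[k] D.grpElt k γ) (w' ⊗ₜ[k] D.grpElt k γ') := by
        simp only [innerDer_apply, add_mul, mul_add, c1.eq, c2.eq, c3.eq, c4.eq, c5.eq, c6.eq,
          c7.eq]
        abel
      rw [key]
      simp only [innerDer_apply, Algebra.TensorProduct.tmul_mul_tmul, one_mul, bosonGroup_mul,
        mul_comm γ' γ, TensorProduct.sub_tmul, TensorProduct.tmul_sub, bosonGroup_one]
      abel
    obtain ⟨δ, hδ⟩ := D.exists_orbit_mem_homog k h m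
    obtain ⟨δ', hδ'⟩ := D.exists_orbit_mem_homog k h' m'
    have h1 := (D.braidedSpace k).mul_mem_homog hδ hδ'
    have h3 := (D.braidedSpace k).mul_mem_homog hδ' hδ
    rw [mul_comm δ', add_comm (m'.card + 1)] at h3
    exact sub_eq_zero.1 ((D.braidedSpace k).eq_zero_of_skewPrimitive (by omega)
      (sub_mem h1 h3) hs)

/-- The three summands of the coproduct commute, so the `p`-th power is additive on them. The lower
terms `w ⊗ b` contribute nothing, since `w ^ p = 0` by induction on the length. Thus the `p`-th
power is skew primitive of degree at least two. -/
lemma orbit_pow (h2 : p ≠ 2) (h : Fin D.s) (m : Multiset (Fin D.t)) :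
    D.orbit k h m ^ p = 0 := by
  induction hN : m.card using Nat.strong_induction_on generalizing m with
  | _ N ih =>
    subst hN
    obtain ⟨γ, z, hz, e⟩ := D.exists_comul_orbit k h2 h m
    have htmul {a b c d : D.HopfH k} (hac : Commute a c) (hbd : Commute b d) :
        Commute (a ⊗ₜ[k] b) (c ⊗ₜ[k] d) := by
      rw [Commute, SemiconjBy, Algebra.TensorProduct.tmul_mul_tmul,
        Algebra.TensorProduct.tmul_mul_tmul, hac.eq, hbd.eq]
    have c1 : Commute ((1 : D.HopfH k) ⊗ₜ[k] D.orbit k h m + D.orbit k h m ⊗ₜ[k] D.grpElt k γ)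
        z := by
      refine commute_of_mem_span (s := {(1 : D.HopfH k) ⊗ₜ[k] D.orbit k h m +
        D.orbit k h m ⊗ₜ[k] D.grpElt k γ}) ?_ (Submodule.mem_span_singleton_self _) hz
      rintro _ rfl _ ⟨n, hn, b, hb, rfl⟩
      exact (htmul (Commute.one_left _) (D.commute_orbit_of_mem k h2 h m hb).symm).add_left
        (htmul (D.commute_orbit k h2 _ _ _ _)
          (D.commute_of_mem_of_mem k (D.grpElt_mem k _) hb))
    have c2 : Commute ((1 : D.HopfH k) ⊗ₜ[k] D.orbit k h m)
        (D.orbit k h m ⊗ₜ[k] D.grpElt k γ) :=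
      htmul (Commute.one_left _) (D.commute_orbit_of_mem k h2 h m (D.grpElt_mem k _)).symm
    have hz0 : z ^ p = 0 := by
      refine pow_char_eq_zero_of_mem_span ?_ ?_ hz
      · rintro _ ⟨n, hn, b, hb, rfl⟩ _ ⟨n', hn', b', hb', rfl⟩
        exact htmul (D.commute_orbit k h2 _ _ _ _) (D.commute_of_mem_of_mem k hb hb')
      · rintro _ ⟨n, hn, b, hb, rfl⟩
        rw [Algebra.TensorProduct.tmul_pow, ih _ hn n rfl, TensorProduct.zero_tmul]
    have hs : comul (R := k) (D.orbit k h m ^ p) =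
        (D.orbit k h m ^ p) ⊗ₜ D.grpElt k (γ ^ p) + D.grpElt k 1 ⊗ₜ (D.orbit k h m ^ p) := by
      rw [Bialgebra.comul_pow, e, add_pow_charP_of_commute k c1, hz0, add_zero,
        add_pow_charP_of_commute k c2, Algebra.TensorProduct.tmul_pow,
        Algebra.TensorProduct.tmul_pow, one_pow, bosonGroup_pow, add_comm]
      rfl
    obtain ⟨δ, hδ⟩ := D.exists_orbit_mem_homog k h m
    refine (D.braidedSpace k).eq_zero_of_skewPrimitive ?_ ((D.braidedSpace k).pow_mem_homog hδ p) hs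
    have := hp.out.two_le
    nlinarith

lemma castHom_a (h2 : p ≠ 2) (h : Fin D.s) (j : Fin D.t) :
    ZMod.castHom (dvd_refl p) k (D.a h j) = -((D.ghost h j : k) / 2) := by
  have h2' := two_ne_zero_of_char k h2
  have e := congrArg (ZMod.castHom (dvd_refl p) k) (D.cast_ghost h j)
  rw [map_natCast, map_mul, map_neg, map_ofNat] at e
  rw [e]
  field_simp

/-- On the term with index `i`, the operator `ad(Δ(Y))` either lengthens the commutator by one or
multiplies the second factor by `(n + i - 𝒢) / 2` and one more `X`. Collecting both contributions
gives the recursion `orbitCoeff_succ`. -/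
lemma comul_orbit_replicate (h2 : p ≠ 2) (h : Fin D.s) (j : Fin D.t) (n : ℕ) :
    comul (R := k) (D.orbit k h (Multiset.replicate n j)) =
      1 ⊗ₜ D.orbit k h (Multiset.replicate n j) + ∑ i ∈ Finset.range (n + 1),
        orbitCoeff k (D.ghost h j) n i • (D.orbit k h (Multiset.replicate i j) ⊗ₜ
          (D.xNorm k (Sum.inl j) ^ (n - i) *
            D.grpElt k ((D.grp (Sum.inl j))⁻¹ ^ i * (D.grp (Sum.inr h))⁻¹))) := by
  have h2' := two_ne_zero_of_char k h2
  induction n with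
  | zero => simp [orbitCoeff, comul_xNorm, add_comm]
  | succ n ih =>
    have hK (i l : ℕ) : D.xNorm k (Sum.inl j) ^ i *
        D.grpElt k ((D.grp (Sum.inl j))⁻¹ ^ l * (D.grp (Sum.inr h))⁻¹) ∈ D.subalgebraK k :=
      mul_mem (pow_mem (D.xNorm_mem k j) i) (D.grpElt_mem k _)
    rw [Multiset.replicate_succ, orbit_cons, comul_innerDer_apply, ih, map_add,
      innerDer_comul_yNorm_tmul _ _ _ (D.commute_orbit_of_mem k h2 h _ (D.grpElt_mem k _)),
      show innerDer k (D.yNorm k j) 1 = 0 by simp [innerDer_apply], TensorProduct.zero_tmul,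
      zero_add, map_sum]
    congr 1
    set T : ℕ → D.HopfH k ⊗[k] D.HopfH k := fun i =>
      D.orbit k h (Multiset.replicate i j) ⊗ₜ (D.xNorm k (Sum.inl j) ^ (n + 1 - i) *
        D.grpElt k ((D.grp (Sum.inl j))⁻¹ ^ i * (D.grp (Sum.inr h))⁻¹)) with hT
    have hterm : ∀ i ∈ Finset.range (n + 1), innerDer k (comul (R := k) (D.yNorm k j))
        (orbitCoeff k (D.ghost h j) n i • (D.orbit k h (Multiset.replicate i j) ⊗ₜ
          (D.xNorm k (Sum.inl j) ^ (n - i) *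
            D.grpElt k ((D.grp (Sum.inl j))⁻¹ ^ i * (D.grp (Sum.inr h))⁻¹)))) =
        orbitCoeff k (D.ghost h j) n i • T (i + 1) +
          (orbitCoeff k (D.ghost h j) n i * (((n : k) + (i : ℕ) - D.ghost h j) / 2)) • T i := by
      intro i hi
      have hi' : i ≤ n := Nat.lt_succ_iff.1 (Finset.mem_range.1 hi)
      rw [map_smul, innerDer_comul_yNorm_tmul _ _ _ (D.commute_grpElt_of_mem k (hK _ _) _),
        D.innerDer_yNorm_xNorm_pow_mul_grpElt k h2, ← orbit_cons, ← Multiset.replicate_succ,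
        smul_add, ← mul_assoc, ((D.commute_grpElt_xNorm k _ _).pow_right _).eq, mul_assoc,
        bosonGroup_mul, TensorProduct.tmul_smul, smul_smul, hT]
      congr 2
      · simp only
        rw [Nat.add_sub_add_right, pow_succ', mul_assoc]
      · congr 1
        -- The shift of `g_j ^ (-i) g_h⁻¹` is `-i + 𝒢 / 2`, so `(n - i) / 2` minus the shift is `(n
        -- + i - 𝒢) / 2`.
        rw [shift_mul, shift_pow, shift_inv, shift_inv, shift_grp_block, if_pos rfl,
          shift_grp_point, D.castHom_a k h2, Nat.cast_sub hi']
        field_simp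
        ring
      · simp only
        rw [Nat.sub_add_comm hi']
    rw [Finset.sum_congr rfl hterm, Finset.sum_add_distrib, Finset.sum_range_succ' _ (n + 1),
      orbitCoeff_zero_right]
    -- The added term at `i = n + 1` is zero because of the binomial coefficient. It aligns this sum
    -- with the shifted one.
    have hlast : ∑ i ∈ Finset.range (n + 1),
        (orbitCoeff k (D.ghost h j) n i * (((n : k) + (i : ℕ) - D.ghost h j) / 2)) • T i =
        ∑ i ∈ Finset.range (n + 1 + 1),
        (orbitCoeff k (D.ghost h j) n i * (((n : k) + (i : ℕ) - D.ghost h j) / 2)) • T i := by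
      rw [Finset.sum_range_succ _ (n + 1)]
      simp [orbitCoeff]
    rw [hlast, Finset.sum_range_succ' _ (n + 1), ← add_assoc, ← Finset.sum_add_distrib]
    congr 1
    · refine Finset.sum_congr rfl fun i hi => ?_
      rw [← add_smul, ← orbitCoeff_succ k h2' _ (Nat.lt_succ_iff.1 (Finset.mem_range.1 hi))]
    · simp [hT]

/-- For `n = 𝒢 + 1` every coefficient with `i ≤ 𝒢` contains the factor with `l = 𝒢`, which is zero.
What remains is the coproduct of a skew primitive element, so the ghost bounds the length of the
chain. -/
lemma orbit_replicate_ghost (h2 : p ≠ 2) (h : Fin D.s) (j : Fin D.t) :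
    D.orbit k h (Multiset.replicate (D.ghost h j + 1) j) = 0 := by
  have e := D.comul_orbit_replicate k h2 h j (D.ghost h j + 1)
  rw [Finset.sum_range_succ, Finset.sum_eq_zero, zero_add] at e
  · obtain ⟨δ, hδ⟩ := D.exists_orbit_mem_homog k h (Multiset.replicate (D.ghost h j + 1) j)
    refine (D.braidedSpace k).eq_zero_of_skewPrimitive (by simp) hδ
      (σ := (D.grp (Sum.inl j))⁻¹ ^ (D.ghost h j + 1) * (D.grp (Sum.inr h))⁻¹) (τ := 1)
      (e.trans ?_)
    simp only [orbitCoeff, Nat.choose_self, Nat.cast_one, Finset.Ico_self, Finset.prod_empty,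
      mul_one, one_smul, Nat.sub_self, pow_zero, one_mul]
    rw [add_comm]
    rfl
  · intro i hi
    rw [orbitCoeff, Finset.prod_eq_zero (i := D.ghost h j), mul_zero, zero_smul]
    · have := Finset.mem_range.1 hi
      exact Finset.mem_Ico.2 ⟨by omega, by omega⟩
    · simp

lemma orbit_eq_zero_of_lt_count (h2 : p ≠ 2) (h : Fin D.s) {j : Fin D.t}
    {m : Multiset (Fin D.t)} (hm : D.ghost h j < m.count j) : D.orbit k h m = 0 := by
  obtain ⟨n, rfl⟩ := Multiset.le_iff_exists_add.1 (Multiset.le_count_iff_replicate_le.1 hm)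
  rw [add_comm]
  exact D.orbit_add_eq_zero k (D.orbit_replicate_ghost k h2 h j) n

end Orbits

end BlockPointDatum

/-! ### Algebra maps out of the restricted enveloping algebra of `V ⋊ N`. -/

namespace AbelianLie

attribute [local instance] LieRing.ofAssociativeRing

section Lift

variable {k V N A : Type*} [Field k] [AddCommGroup V] [Module k V] [AddCommGroup N] [Module k N]
  [Ring A] [Algebra k A] {E : N →ₗ[k] Module.End k V} {hE : ∀ a b, Commute (E a) (E b)}
  {p : ℕ} [hp : Fact p.Prime] [CharP k p]

lemma innerDer_pow_map {w : V →ₗ[k] A} {y : N →ₗ[k] A}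
    (hyw : ∀ a u, innerDer k (y a) (w u) = w (E a u)) (a : N) (u : V) (n : ℕ) :
    (innerDer k (y a) ^ n) (w u) = w ((E a ^ n) u) := by
  induction n with
  | zero => rfl
  | succ n ih => rw [pow_succ', Module.End.mul_apply, ih, hyw, pow_succ', Module.End.mul_apply]

/-- The Lie algebra map from `V ⋊ N` given by linear maps on `V` and on `N`. -/
def liftLie (w : V →ₗ[k] A) (y : N →ₗ[k] A)
    (hw : ∀ u v, Commute (w u) (w v)) (hy : ∀ a b, Commute (y a) (y b))
    (hyw : ∀ a u, innerDer k (y a) (w u) = w (E a u)) : Semidirect E hE →ₗ⁅k⁆ A where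
  toFun x := w x.left + y x.right
  map_add' x x' :=
    (congrArg₂ (· + ·) (map_add w _ _) (map_add y _ _)).trans (add_add_add_comm _ _ _ _)
  map_smul' c x :=
    (congrArg₂ (· + ·) (map_smul w c _) (map_smul y c _)).trans (smul_add c _ _).symm
  map_lie' := fun {x x'} => by
    rw [bracket_eq]
    have h (u u' : V) (a a' : N) : w (E a u' - E a' u) + y 0 =
        (w u + y a) * (w u' + y a') - (w u' + y a') * (w u + y a) := by
      rw [map_sub, ← hyw, ← hyw, map_zero, add_zero]
      simp only [innerDer_apply, add_mul, mul_add, (hw u u').eq, (hy a a').eq]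
      abel
    exact h x.left x'.left x.right x'.right

/-- The iterated commutators of `y a` with `w u` stay in the commutative image of `w`, so Jacobson's
formula applies. Its last term is the image of the `p`-operation of the semidirect product. -/
lemma map_add_map_pow {w : V →ₗ[k] A} {y : N →ₗ[k] A} (hw : ∀ u v, Commute (w u) (w v))
    (hyw : ∀ a u, innerDer k (y a) (w u) = w (E a u)) (hwp : ∀ u, w u ^ p = 0)
    (hyp : ∀ a, y a ^ p = 0) (u : V) (a : N) : (w u + y a) ^ p = w ((E a ^ (p - 1)) u) := by
  rcases subsingleton_or_nontrivial A with h | h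
  · exact Subsingleton.elim _ _
  have := charP_of_injective_algebraMap (algebraMap k A).injective p
  rw [add_comm, add_pow_char_of_commute_innerDer (k := k), hyp, hwp, zero_add, zero_add,
    innerDer_pow_map hyw]
  intro n
  rw [innerDer_pow_map hyw]
  exact hw _ _

variable (hE' : ∀ a, E a ^ p = 0) {w : V →ₗ[k] A} {y : N →ₗ[k] A}
    (hw : ∀ u v, Commute (w u) (w v)) (hy : ∀ a b, Commute (y a) (y b))
    (hyw : ∀ a u, innerDer k (y a) (w u) = w (E a u)) (hwp : ∀ u, w u ^ p = 0)
    (hyp : ∀ a, y a ^ p = 0)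

/-- The algebra map from the restricted enveloping algebra of `V ⋊ N` given by linear maps on `V`
and on `N`. -/
def liftSemidirect :
    letI := restricted (hE := hE) hE'
    RestrictedEnveloping k (Semidirect E hE) →ₐ[k] A :=
  letI := restricted (hE := hE) hE'
  RestrictedEnveloping.lift (liftLie w y hw hy hyw) fun x =>
    (map_add_map_pow hw hyw hwp hyp x.left x.right).trans
      ((add_zero _).symm.trans (congrArg (_ + ·) (map_zero y).symm))

lemma liftSemidirect_ι (x : Semidirect E hE) :
    letI := restricted (hE := hE) hE'
    liftSemidirect hE' hw hy hyw hwp hyp (RestrictedEnveloping.ι k x) =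
      w x.left + y x.right := by
  let _ := restricted (hE := hE) hE'
  exact RestrictedEnveloping.lift_ι _ _ x

end Lift

end AbelianLie

/-! ### The algebra section `L → H`. -/

namespace BlockPointDatum

open Coalgebra YetterDrinfeld

section Section

variable {p : ℕ} (D : BlockPointDatum p) (k : Type*) [Field k] [CharP k p]

/-- The multiset of the blocks in which `j` has multiplicity `m_j`. -/
def blockMultiset {h : Fin D.s} (m : ∀ j : Fin D.t, Fin (D.ghost h j + 1)) :
    Multiset (Fin D.t) :=
  ∑ j, (m j : ℕ) • {j}

lemma count_blockMultiset {h : Fin D.s} (m : ∀ j : Fin D.t, Fin (D.ghost h j + 1))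
    (j : Fin D.t) : (D.blockMultiset m).count j = m j := by
  rw [blockMultiset, Multiset.count_sum', Finset.sum_eq_single j]
  · simp
  · intro i _ hi
    simp [hi.symm]
  · simp

/-- The linear map `v_{h, m} ↦ ∏ ad (g_j⁻¹ y_j) ^ m_j (g_h⁻¹ x_h)`. -/
def orbitMap : D.VG k →ₗ[k] D.HopfH k :=
  Finsupp.linearCombination k fun w => D.orbit k w.1 (D.blockMultiset w.2)

/-- The linear map `E_j ↦ g_j⁻¹ y_j`. -/
def yNormMap : (Fin D.t →₀ k) →ₗ[k] D.HopfH k := Finsupp.linearCombination k (D.yNorm k)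

lemma orbitMap_single (w : D.Weight) :
    D.orbitMap k (Finsupp.single w 1) = D.orbit k w.1 (D.blockMultiset w.2) := by
  simp [orbitMap]

lemma yNormMap_single (j : Fin D.t) : D.yNormMap k (Finsupp.single j 1) = D.yNorm k j := by
  simp [yNormMap]

lemma orbitMap_mem_span (u : D.VG k) : D.orbitMap k u ∈
    Submodule.span k (Set.range fun w : D.Weight => D.orbit k w.1 (D.blockMultiset w.2)) :=
  Finsupp.range_linearCombination k (M := D.HopfH k) ▸ LinearMap.mem_range_self _ u

lemma yNormMap_mem_span (e : Fin D.t →₀ k) :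
    D.yNormMap k e ∈ Submodule.span k (Set.range (D.yNorm k)) :=
  Finsupp.range_linearCombination k (M := D.HopfH k) ▸ LinearMap.mem_range_self _ e

variable [hp : Fact p.Prime]

/-- One more commutator with `Y_j` raises `m_j` by one. At the boundary `m_j = 𝒢_hj` both sides
vanish, the left one by `orbit_eq_zero_of_lt_count`. -/
lemma innerDer_yNorm_orbitMap (h2 : p ≠ 2) (j : Fin D.t) (u : D.VG k) :
    innerDer k (D.yNorm k j) (D.orbitMap k u) = D.orbitMap k (D.raise k j u) := by
  induction u using Finsupp.induction_linear with
  | zero => simp only [map_zero]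
  | add u v hu hv => simp only [map_add, hu, hv]
  | single w c =>
    rw [← mul_one c, ← smul_eq_mul, ← Finsupp.smul_single]
    simp only [map_smul]
    congr 1
    rw [orbitMap_single, raise_single, raiseBasis, ← orbit_cons]
    split_ifs with hw
    · rw [orbitMap_single]
      congr 1
      ext i
      rw [count_blockMultiset, Multiset.count_cons, count_blockMultiset]
      rcases eq_or_ne i j with rfl | hij
      · simp
      · simp [hij]
    · rw [map_zero]
      refine D.orbit_eq_zero_of_lt_count k h2 w.1 (j := j) ?_
      rw [Multiset.count_cons_self, count_blockMultiset]
      omega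

lemma innerDer_yNormMap_orbitMap (h2 : p ≠ 2) (e : Fin D.t →₀ k) (u : D.VG k) :
    innerDer k (D.yNormMap k e) (D.orbitMap k u) = D.orbitMap k (D.nAct k e u) := by
  induction e using Finsupp.induction_linear with
  | zero => simp
  | add e e' h h' =>
    rw [map_add, map_add, LinearMap.add_apply, map_add, ← h, ← h']
    simp only [innerDer_apply, add_mul, mul_add]
    abel
  | single j c =>
    rw [nAct_single, LinearMap.smul_apply, map_smul, ← D.innerDer_yNorm_orbitMap k h2]
    simp [yNormMap, smul_sub]

/-- The section `s : L → H`: the algebra map with `s (E_j) = g_j⁻¹ y_j` and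
`s (v_h) = g_h⁻¹ x_h`. -/
def sectionL (h2 : p ≠ 2) : D.HopfL k →ₐ[k] D.HopfH k :=
  AbelianLie.liftSemidirect (D.nAct_pow k) (w := D.orbitMap k) (y := D.yNormMap k)
    (fun u v => commute_of_mem_span
      (by rintro _ ⟨w, rfl⟩ _ ⟨w', rfl⟩; exact D.commute_orbit k h2 _ _ _ _)
      (D.orbitMap_mem_span k u) (D.orbitMap_mem_span k v))
    (fun e e' => commute_of_mem_span
      (by rintro _ ⟨i, rfl⟩ _ ⟨j, rfl⟩; exact D.commute_yNorm k i j)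
      (D.yNormMap_mem_span k e) (D.yNormMap_mem_span k e'))
    (D.innerDer_yNormMap_orbitMap k h2)
    (fun u => pow_char_eq_zero_of_mem_span
      (by rintro _ ⟨w, rfl⟩ _ ⟨w', rfl⟩; exact D.commute_orbit k h2 _ _ _ _)
      (by rintro _ ⟨w, rfl⟩; exact D.orbit_pow k h2 _ _) (D.orbitMap_mem_span k u))
    (fun e => pow_char_eq_zero_of_mem_span
      (by rintro _ ⟨i, rfl⟩ _ ⟨j, rfl⟩; exact D.commute_yNorm k i j)
      (by rintro _ ⟨i, rfl⟩; exact D.yNorm_pow k h2 _) (D.yNormMap_mem_span k e))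

lemma sectionL_E (h2 : p ≠ 2) (j : Fin D.t) :
    D.sectionL k h2 (RestrictedEnveloping.ι k (D.E k j)) = D.yNorm k j := by
  refine (AbelianLie.liftSemidirect_ι (D.nAct_pow k) _ _ _ _ _ _).trans ?_
  have h : D.orbitMap k 0 + D.yNormMap k (Finsupp.single j 1) = D.yNorm k j := by
    rw [map_zero, zero_add, yNormMap_single]
  exact h

lemma sectionL_vBasis (h2 : p ≠ 2) (w : D.Weight) :
    D.sectionL k h2 (RestrictedEnveloping.ι k (D.vBasis k w)) =
      D.orbit k w.1 (D.blockMultiset w.2) := by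
  refine (AbelianLie.liftSemidirect_ι (D.nAct_pow k) _ _ _ _ _ _).trans ?_
  have h : D.orbitMap k (Finsupp.single w 1) + D.yNormMap k 0 =
      D.orbit k w.1 (D.blockMultiset w.2) := by
    rw [map_zero, add_zero, orbitMap_single]
  exact h

lemma sectionL_v (h2 : p ≠ 2) (h : Fin D.s) :
    D.sectionL k h2 (RestrictedEnveloping.ι k (D.v k h)) = D.xNorm k (Sum.inr h) :=
  (D.sectionL_vBasis k h2 _).trans (by simp [blockMultiset])

end Section

end BlockPointDatum

/-! ### Spans of ordered monomials, and peeling by skew derivations. -/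

section MonomialSpans

variable {k A ι : Type*} [Field k] [Ring A] [Algebra k A]

/-- The sum of the subspaces `B v ^ n`, for `n < d`. -/
def Submodule.powSpan (B : Submodule k A) (v : A) : ℕ → Submodule k A
  | 0 => ⊥
  | d + 1 => Submodule.powSpan B v d ⊔ B.map (LinearMap.mulRight k (v ^ d))

/-- The span of the ordered monomials in the elements `u i`, `i ∈ l`, with exponents less than `p`
and with coefficients in `B`. -/
def Submodule.monomialSpan (p : ℕ) (B : Submodule k A) (u : ι → A) : List ι → Submodule k A
  | [] => B
  | i :: l => (Submodule.monomialSpan p B u l).powSpan (u i) p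

namespace Submodule

lemma powSpan_le {B Z : Submodule k A} {v : A} (hB : B ≤ Z) (hZ : ∀ z ∈ Z, z * v ∈ Z) (d : ℕ) :
    B.powSpan v d ≤ Z := by
  have h (n : ℕ) : ∀ z ∈ Z, z * v ^ n ∈ Z := by
    induction n with
    | zero => simp
    | succ n ih => intro z hz; rw [pow_succ, ← mul_assoc]; exact hZ _ (ih z hz)
  induction d with
  | zero => exact bot_le
  | succ d ih =>
    refine sup_le ih ?_
    rintro _ ⟨b, hb, rfl⟩
    exact h d b (hB hb)

lemma monomialSpan_le {p : ℕ} {B Z : Submodule k A} {u : ι → A} (hB : B ≤ Z)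
    (hZ : ∀ i, ∀ z ∈ Z, z * u i ∈ Z) (l : List ι) : B.monomialSpan p u l ≤ Z := by
  induction l with
  | nil => exact hB
  | cons i l ih => exact powSpan_le ih (hZ i) p

lemma powSpan_mul_mem {B : Submodule k A} {v w : A} (hB : ∀ b ∈ B, b * w ∈ B)
    (hvw : Commute v w) (d : ℕ) : ∀ z ∈ B.powSpan v d, z * w ∈ B.powSpan v d := by
  induction d with
  | zero => rintro _ rfl; rw [zero_mul]; exact zero_mem _
  | succ d ih =>
    intro z hz
    obtain ⟨y, hy, _, ⟨b, hb, rfl⟩, rfl⟩ := mem_sup.1 hz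
    rw [add_mul]
    refine add_mem (mem_sup_left (ih y hy)) (mem_sup_right ⟨b * w, hB b hb, ?_⟩)
    simp [mul_assoc, (hvw.pow_left d).eq]

lemma powSpan_mul_self_mem {B : Submodule k A} {v : A} (d : ℕ) :
    ∀ z ∈ B.powSpan v d, z * v ∈ B.powSpan v (d + 1) := by
  induction d with
  | zero => rintro _ rfl; rw [zero_mul]; exact zero_mem _
  | succ d ih =>
    intro z hz
    obtain ⟨y, hy, _, ⟨b, hb, rfl⟩, rfl⟩ := mem_sup.1 hz
    rw [add_mul]
    refine add_mem (mem_sup_left (ih y hy)) (mem_sup_right ⟨b, hb, ?_⟩)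
    simp [pow_succ, mul_assoc]

lemma powSpan_mul_self_mem_of_pow_eq_zero {B : Submodule k A} {v : A} {p : ℕ} (hv : v ^ p = 0) :
    ∀ z ∈ B.powSpan v p, z * v ∈ B.powSpan v p := by
  intro z hz
  obtain ⟨y, hy, _, ⟨b, hb, rfl⟩, e⟩ := mem_sup.1 (powSpan_mul_self_mem p z hz)
  rw [LinearMap.mulRight_apply, hv, mul_zero, add_zero] at e
  rwa [← e]

lemma le_powSpan {B : Submodule k A} {v : A} {d : ℕ} (hd : d ≠ 0) : B ≤ B.powSpan v d := by
  induction d with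
  | zero => exact absurd rfl hd
  | succ d ih =>
    rcases eq_or_ne d 0 with rfl | h
    · exact fun b hb => mem_sup_right ⟨b, hb, by simp⟩
    · exact (ih h).trans le_sup_left

lemma le_monomialSpan {p : ℕ} (hp : p ≠ 0) {B : Submodule k A} {u : ι → A} (l : List ι) :
    B ≤ B.monomialSpan p u l := by
  induction l with
  | nil => exact le_rfl
  | cons i l ih => exact ih.trans (le_powSpan hp)

lemma monomialSpan_mul_mem {p : ℕ} {B : Submodule k A} {u : ι → A}
    (hu : ∀ i j, Commute (u i) (u j)) (hp : ∀ i, u i ^ p = 0) (l : List ι) :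
    ∀ i ∈ l, ∀ z ∈ B.monomialSpan p u l, z * u i ∈ B.monomialSpan p u l := by
  induction l with
  | nil => simp
  | cons j l ih =>
    intro i hi z hz
    rcases List.mem_cons.1 hi with rfl | hi
    · exact powSpan_mul_self_mem_of_pow_eq_zero (hp i) z hz
    · exact powSpan_mul_mem (ih i hi) (hu j i) p z hz

section Peel

variable {p : ℕ} [hp : Fact p.Prime] [CharP k p] {N B : Submodule k A}

/-- On powers of `v` with coefficients killed by `δ`, the map `δ` acts as `c` times the derivative
in `v`. -/
lemma skewDerivation_mul_pow {δ : Module.End k A} {v : A} {c : k}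
    (h : ∀ b, δ (b * v) = δ b * v + c • b) {b : A} (hb : δ b = 0) (n : ℕ) :
    δ (b * v ^ (n + 1)) = ((n + 1 : ℕ) * c) • (b * v ^ n) := by
  induction n with
  | zero => simp [h, hb]
  | succ n ih =>
    rw [pow_succ, ← mul_assoc, h, ih, smul_mul_assoc, mul_assoc, ← pow_succ, ← add_smul]
    push_cast
    congr 1
    ring

/-- Let `x` be in `N` with leading term `b v ^ d`, `d > 0`. Then `δ x` is in `N` and has smaller
degree, so it is zero by induction. Applying `δ ^ d` gives `d! c ^ d b = 0`, and `d < p` forces `b =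
0`, so the degree of `x` drops. -/
lemma inf_powSpan_eq_bot {δ : Module.End k A} {v : A} {c : k} (hc : c ≠ 0)
    (h : ∀ b, δ (b * v) = δ b * v + c • b) (hB : ∀ b ∈ B, δ b = 0) (hN : ∀ x ∈ N, δ x ∈ N)
    (hNB : N ⊓ B = ⊥) {d : ℕ} (hd : d ≤ p) : N ⊓ B.powSpan v d = ⊥ := by
  have h1 (d : ℕ) : ∀ z ∈ B.powSpan v (d + 1), δ z ∈ B.powSpan v d := by
    induction d with
    | zero =>
      intro z hz
      obtain ⟨_, rfl, _, ⟨b, hb, rfl⟩, rfl⟩ := mem_sup.1 hz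
      rw [zero_add, LinearMap.mulRight_apply, pow_zero, mul_one, hB b hb]
      exact zero_mem _
    | succ d ih =>
      intro z hz
      obtain ⟨y, hy, _, ⟨b, hb, rfl⟩, rfl⟩ := mem_sup.1 hz
      rw [map_add, LinearMap.mulRight_apply, skewDerivation_mul_pow h (hB b hb)]
      exact add_mem (mem_sup_left (ih y hy))
        (mem_sup_right (smul_mem _ _ ⟨b, hb, rfl⟩))
  have h2 (d : ℕ) : ∀ z ∈ B.powSpan v d, (δ ^ d) z = 0 := by
    induction d with
    | zero => rintro _ rfl; exact map_zero _
    | succ d ih => intro z hz; rw [pow_succ, Module.End.mul_apply]; exact ih _ (h1 d z hz)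
  have h3 (d : ℕ) : ∀ b ∈ B, (δ ^ d) (b * v ^ d) = ((d.factorial : k) * c ^ d) • b := by
    induction d with
    | zero => simp
    | succ d ih =>
      intro b hb
      rw [pow_succ, Module.End.mul_apply, skewDerivation_mul_pow h (hB b hb), map_smul, ih b hb,
        smul_smul, Nat.factorial_succ]
      push_cast
      congr 1
      ring
  induction d with
  | zero => exact inf_bot_eq _
  | succ d ih =>
    rw [eq_bot_iff]
    rintro x ⟨hxN, hx⟩
    obtain ⟨y, hy, _, ⟨b, hb, rfl⟩, e⟩ := mem_sup.1 hx
    rw [LinearMap.mulRight_apply] at e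
    -- In degree zero applying `δ` gives no information, since `δ` kills `B`. Here the hypothesis on
    -- `N ⊓ B` is used.
    rcases Nat.eq_zero_or_pos d with rfl | hd0
    · obtain rfl : y = 0 := hy
      rw [zero_add, pow_zero, mul_one] at e
      rw [← hNB]
      exact ⟨hxN, e ▸ hb⟩
    · have hx0 : δ x = 0 := by
        rw [← mem_bot k (M := A), ← ih (by omega)]
        exact ⟨hN x hxN, h1 d x hx⟩
      have hx1 : (δ ^ d) x = 0 := by
        obtain ⟨d, rfl⟩ := Nat.exists_eq_succ_of_ne_zero hd0.ne'
        rw [pow_succ, Module.End.mul_apply, hx0, map_zero]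
      rw [← e, map_add, h2 d y hy, zero_add, h3 d b hb] at hx1
      have hf : (d.factorial : k) ≠ 0 := by
        rw [Ne, CharP.cast_eq_zero_iff k p, hp.out.dvd_factorial]
        omega
      rw [(smul_eq_zero.1 hx1).resolve_left (mul_ne_zero hf (pow_ne_zero d hc)), zero_mul,
        add_zero] at e
      rw [← ih (by omega)]
      exact ⟨hxN, e ▸ hy⟩

/-- The variables are peeled off one at a time: `δ i` kills the monomials that do not involve `u i`,
which therefore serve as coefficients for the powers of `u i`. -/
lemma inf_monomialSpan_eq_bot [DecidableEq ι] {u : ι → A} {δ : ι → Module.End k A} {c : k}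
    (hc : c ≠ 0) (h : ∀ i j b, δ i (b * u j) = δ i b * u j + if i = j then c • b else 0)
    (hB : ∀ i, ∀ b ∈ B, δ i b = 0) (hN : ∀ i, ∀ x ∈ N, δ i x ∈ N) (hNB : N ⊓ B = ⊥)
    {l : List ι} (hl : l.Nodup) : N ⊓ B.monomialSpan p u l = ⊥ := by
  have h1 (i : ι) (l : List ι) (hi : i ∉ l) : ∀ b ∈ B.monomialSpan p u l, δ i b = 0 := by
    induction l with
    | nil => exact hB i
    | cons j l ih =>
      refine powSpan_le (Z := LinearMap.ker (δ i)) (ih fun hl => hi (List.mem_cons_of_mem _ hl))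
        (fun z hz => ?_) p
      rw [LinearMap.mem_ker] at hz ⊢
      rw [h, hz, zero_mul, zero_add, if_neg (fun e : i = j => hi (e ▸ List.mem_cons_self))]
  induction l with
  | nil => exact hNB
  | cons i l ih =>
    rw [List.nodup_cons] at hl
    exact inf_powSpan_eq_bot hc (fun b => (h i i b).trans (by rw [if_pos rfl])) (h1 i l hl.1)
      (hN i) (ih hl.2) le_rfl

end Peel

end Submodule

end MonomialSpans

/-! ### Convolution of functionals and contractions. -/

section Convolution

open Coalgebra

variable {k A A' : Type*} [Field k] [Ring A] [Bialgebra k A] [Ring A'] [Bialgebra k A']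

/-- The convolution product of linear functionals on a coalgebra. -/
def dualConv (ξ η : A →ₗ[k] k) : A →ₗ[k] k :=
  LinearMap.mul' k k ∘ₗ TensorProduct.map ξ η ∘ₗ comul

/-- The left contraction `c ↦ ξ(c₁) c₂` by a linear functional `ξ`. -/
def leftContract (ξ : A →ₗ[k] k) : Module.End k A :=
  (TensorProduct.lid k A).toLinearMap ∘ₗ ξ.rTensor A ∘ₗ comul

/-- By this adjunction, the orthogonal of a set of functionals closed under convolution is stable
under contraction by its members. -/
lemma apply_leftContract (ξ η : A →ₗ[k] k) (c : A) : η (leftContract ξ c) = dualConv ξ η c := by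
  have h (z : A ⊗[k] A) : η (TensorProduct.lid k A (ξ.rTensor A z)) =
      LinearMap.mul' k k (TensorProduct.map ξ η z) := by
    induction z with
    | zero => simp
    | add x y hx hy => simp only [map_add, hx, hy]
    | tmul a b => simp
  exact h _

lemma leftContract_counit : leftContract (counit (R := k) (A := A)) = LinearMap.id := by
  ext c
  simp [leftContract]

lemma leftContract_one (ξ : A →ₗ[k] k) : leftContract ξ 1 = ξ 1 • (1 : A) := by
  simp [leftContract, Algebra.TensorProduct.one_def]

lemma leftContract_smul (r : k) (ξ : A →ₗ[k] k) : leftContract (r • ξ) = r • leftContract ξ := by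
  ext; simp [leftContract]

lemma leftContract_neg (ξ : A →ₗ[k] k) : leftContract (-ξ) = -leftContract ξ := by
  ext; simp [leftContract]

/-- When right translation by `b` turns `ξ` into a multiple of the counit, this is the skew
derivation rule required for peeling. -/
lemma leftContract_mul_of_primitive (ξ : A →ₗ[k] k) {b : A}
    (hb : comul (R := k) b = b ⊗ₜ 1 + 1 ⊗ₜ b) (a : A) :
    leftContract ξ (a * b) =
      leftContract (ξ ∘ₗ LinearMap.mulRight k b) a + leftContract ξ a * b := by
  have h (z : A ⊗[k] A) : TensorProduct.lid k A (ξ.rTensor A (z * (b ⊗ₜ 1 + 1 ⊗ₜ b))) =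
      TensorProduct.lid k A ((ξ ∘ₗ LinearMap.mulRight k b).rTensor A z) +
        TensorProduct.lid k A (ξ.rTensor A z) * b := by
    induction z with
    | zero => simp
    | add x y hx hy => rw [add_mul, map_add, map_add, hx, hy]; simp only [map_add, add_mul]; abel
    | tmul c d => simp [mul_add]
  exact (congrArg (fun z => TensorProduct.lid k A (ξ.rTensor A z))
    ((Bialgebra.comul_mul a b).trans (congrArg _ hb))).trans (h _)

lemma mul'_map_mul_tmul (ξ η : A →ₗ[k] k) (z : A ⊗[k] A) (c d : A) :
    LinearMap.mul' k k (TensorProduct.map ξ η (z * c ⊗ₜ d)) =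
      LinearMap.mul' k k (TensorProduct.map (ξ ∘ₗ LinearMap.mulRight k c)
        (η ∘ₗ LinearMap.mulRight k d) z) := by
  induction z with
  | zero => simp
  | add x y hx hy => simp only [add_mul, map_add, hx, hy]
  | tmul a b => simp

lemma dualConv_mul_of_groupLike (ξ η : A →ₗ[k] k) {g : A} (hg : comul (R := k) g = g ⊗ₜ g)
    (a : A) : dualConv ξ η (a * g) =
      dualConv (ξ ∘ₗ LinearMap.mulRight k g) (η ∘ₗ LinearMap.mulRight k g) a := by
  rw [dualConv, LinearMap.comp_apply, LinearMap.comp_apply, Bialgebra.comul_mul, hg,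
    mul'_map_mul_tmul]
  rfl

/-- With `dualConv_mul_of_groupLike`, this reduces identities between convolutions on `T(V) # kΓ` to
right translations by generators. -/
lemma dualConv_mul_of_skewPrimitive (ξ η : A →ₗ[k] k) {b g : A}
    (hb : comul (R := k) b = b ⊗ₜ 1 + g ⊗ₜ b) (a : A) : dualConv ξ η (a * b) =
      dualConv (ξ ∘ₗ LinearMap.mulRight k b) η a +
        dualConv (ξ ∘ₗ LinearMap.mulRight k g) (η ∘ₗ LinearMap.mulRight k b) a := by
  rw [dualConv, LinearMap.comp_apply, LinearMap.comp_apply, Bialgebra.comul_mul, hb, mul_add,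
    map_add, map_add, mul'_map_mul_tmul, mul'_map_mul_tmul, LinearMap.mulRight_one]
  rfl

lemma dualConv_counit_left (η : A →ₗ[k] k) : dualConv counit η = η := by
  ext c
  rw [← apply_leftContract, leftContract_counit, LinearMap.id_apply]

lemma dualConv_counit_right (ξ : A →ₗ[k] k) : dualConv ξ counit = ξ := by
  ext c
  have h (z : A ⊗[k] A) : LinearMap.mul' k k (TensorProduct.map ξ counit z) =
      ξ (TensorProduct.rid k A (counit.lTensor A z)) := by
    induction z with
    | zero => simp
    | add x y hx hy => simp only [map_add, hx, hy]
    | tmul a b => simp [mul_comm]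
  refine (h _).trans ?_
  simp

lemma dualConv_one (ξ η : A →ₗ[k] k) : dualConv ξ η 1 = ξ 1 * η 1 := by
  simp [dualConv, Algebra.TensorProduct.one_def]

lemma dualConv_add_left (ξ ξ' η : A →ₗ[k] k) :
    dualConv (ξ + ξ') η = dualConv ξ η + dualConv ξ' η := by
  ext; simp [dualConv, TensorProduct.map_add_left]

lemma dualConv_add_right (ξ η η' : A →ₗ[k] k) :
    dualConv ξ (η + η') = dualConv ξ η + dualConv ξ η' := by
  ext; simp [dualConv, TensorProduct.map_add_right]

lemma dualConv_smul_left (r : k) (ξ η : A →ₗ[k] k) : dualConv (r • ξ) η = r • dualConv ξ η := by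
  ext; simp [dualConv, TensorProduct.map_smul_left]

lemma dualConv_smul_right (r : k) (ξ η : A →ₗ[k] k) : dualConv ξ (r • η) = r • dualConv ξ η := by
  ext; simp [dualConv, TensorProduct.map_smul_right]

lemma dualConv_comp (ξ η : A' →ₗ[k] k) {f : A →ₐ[k] A'}
    (hf : ∀ a, Algebra.TensorProduct.map f f (comul (R := k) a) = comul (R := k) (f a)) :
    dualConv ξ η ∘ₗ f.toLinearMap = dualConv (ξ ∘ₗ f.toLinearMap) (η ∘ₗ f.toLinearMap) := by
  ext a
  have h (z : A ⊗[k] A) : LinearMap.mul' k k (TensorProduct.map ξ η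
      (Algebra.TensorProduct.map f f z)) = LinearMap.mul' k k (TensorProduct.map
        (ξ ∘ₗ f.toLinearMap) (η ∘ₗ f.toLinearMap) z) := by
    induction z with
    | zero => simp
    | add x y hx hy => simp only [map_add, hx, hy]
    | tmul a b => simp
  exact (congrArg (fun z => LinearMap.mul' k k (TensorProduct.map ξ η z)) (hf a).symm).trans (h _)

end Convolution

/-! ### Functionals of degree at most one, and descent to the Nichols algebra. -/

namespace YetterDrinfeld

open Coalgebra SkewMonoidAlgebra

variable {k Γ X : Type*} [Field k] [CommGroup Γ] (M : YetterDrinfeld k Γ X)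

/-- The linear functional on `T(V)` that is `f` on `V` and zero in all other degrees. -/
def degreeOne (f : (X →₀ k) →ₗ[k] k) : M.Tensor →ₗ[k] k :=
  TrivSqZeroExt.sndHom k k ∘ₗ
    (M.tensorLift (TrivSqZeroExt.inrHom k k ∘ₗ f) : M.Tensor →ₐ[k] DualNumber k).toLinearMap

lemma fst_tensorLift_inrHom (f : (X →₀ k) →ₗ[k] k) (u : M.Tensor) :
    TrivSqZeroExt.fst (M.tensorLift (TrivSqZeroExt.inrHom k k ∘ₗ f : _ →ₗ[k] DualNumber k) u) =
      M.tensorData.counit u := by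
  have h : (TrivSqZeroExt.fstHom k k k).comp
      (M.tensorLift (TrivSqZeroExt.inrHom k k ∘ₗ f : _ →ₗ[k] DualNumber k)) =
      M.tensorData.counit :=
    M.tensor_hom_ext fun v => by
      have : M.tensorData.counit (M.ι v) = 0 := M.tensorLift_ι 0 v
      rw [this, AlgHom.comp_apply, tensorLift_ι]
      simp
  exact DFunLike.congr_fun h u

lemma degreeOne_mul_ι (f : (X →₀ k) →ₗ[k] k) (u : M.Tensor) (v : X →₀ k) :
    M.degreeOne f (u * M.ι v) = M.tensorData.counit u * f v := by
  have h := M.fst_tensorLift_inrHom f u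
  simp only [degreeOne, LinearMap.comp_apply, AlgHom.toLinearMap_apply, map_mul, tensorLift_ι,
    TrivSqZeroExt.sndHom_apply, TrivSqZeroExt.snd_mul, TrivSqZeroExt.inrHom_apply,
    TrivSqZeroExt.snd_inr, TrivSqZeroExt.fst_inr, h]
  simp

lemma degreeOne_one (f : (X →₀ k) →ₗ[k] k) : M.degreeOne f 1 = 0 := by
  simp [degreeOne]

lemma counit_ι (v : X →₀ k) : M.tensorData.counit (M.ι v) = 0 := M.tensorLift_ι 0 v

lemma counit_eq_zero_of_mem_tensorGrading {n : ℕ} (hn : n ≠ 0) {u : M.Tensor}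
    (hu : u ∈ M.tensorGrading n) : M.tensorData.counit u = 0 := by
  obtain ⟨n, rfl⟩ := Nat.exists_eq_succ_of_ne_zero hn
  rw [tensorGrading, pow_succ] at hu
  refine Submodule.mul_induction_on hu ?_ (fun x y hx hy => by rw [map_add, hx, hy, add_zero])
  rintro a _ _ ⟨v, rfl⟩
  rw [map_mul, counit_ι, mul_zero]

lemma degreeOne_eq_zero_of_mem_tensorGrading (f : (X →₀ k) →ₗ[k] k) {n : ℕ} (hn : 2 ≤ n)
    {u : M.Tensor} (hu : u ∈ M.tensorGrading n) : M.degreeOne f u = 0 := by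
  obtain ⟨n, rfl⟩ := Nat.exists_eq_add_of_le' hn
  rw [tensorGrading, pow_succ] at hu
  refine Submodule.mul_induction_on hu ?_ (fun x y hx hy => by rw [map_add, hx, hy, add_zero])
  rintro a ha _ ⟨v, rfl⟩
  rw [degreeOne_mul_ι, M.counit_eq_zero_of_mem_tensorGrading (Nat.succ_ne_zero n) ha, zero_mul]

/-- Elements of the Nichols ideal have no components of degree zero or one, and `F` vanishes on all
the others. -/
lemma eq_zero_of_mem_nicholsIdeal {F : M.Tensor →ₗ[k] k}
    (hF : ∀ n, 2 ≤ n → ∀ u ∈ M.tensorGrading n, F u = 0) {u : M.Tensor}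
    (hu : u ∈ M.nicholsIdeal) : F u = 0 := by
  classical
  rw [← DirectSum.sum_support_decompose M.tensorGrading u, _root_.map_sum]
  refine Finset.sum_eq_zero fun n _ => ?_
  rcases Nat.lt_or_ge n 2 with hn | hn
  · have h := M.proj_eq_zero_of_mem_nicholsIdeal hu hn
    rw [GradedRing.proj_apply] at h
    rw [h, map_zero]
  · exact hF n hn _ (SetLike.coe_mem _)

/-- The linear functional `u # γ ↦ c(γ) F(u)` on `T(V) # kΓ`. -/
def smashFunctional (F : M.Tensor →ₗ[k] k) (c : Γ → k) :
    SkewMonoidAlgebra M.Tensor Γ →ₗ[k] k :=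
  Finsupp.lsum k (fun γ => c γ • F) ∘ₗ
    (coeffLinearEquiv (S := k) (k := M.Tensor) (G := Γ)).toLinearMap

lemma smashFunctional_apply (F : M.Tensor →ₗ[k] k) (c : Γ → k)
    (a : SkewMonoidAlgebra M.Tensor Γ) :
    M.smashFunctional F c a = a.coeff.sum fun γ u => c γ * F u := rfl

lemma smashFunctional_single (F : M.Tensor →ₗ[k] k) (c : Γ → k) (γ : Γ) (u : M.Tensor) :
    M.smashFunctional F c (single γ u) = c γ * F u := by
  rw [smashFunctional_apply, coeff_single, Finsupp.sum_single_index (by simp)]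

lemma smashFunctional_comp_mulRight_single_one (F : M.Tensor →ₗ[k] k) (c : Γ → k) (δ : Γ) :
    M.smashFunctional F c ∘ₗ LinearMap.mulRight k (single δ 1) =
      M.smashFunctional F (fun γ => c (γ * δ)) := by
  refine LinearMap.ext fun a => ?_
  induction a using SkewMonoidAlgebra.induction_on with
  | zero => simp only [map_zero]
  | add a b ha hb => simp only [map_add, ha, hb]
  | single γ u =>
    rw [LinearMap.comp_apply, LinearMap.mulRight_apply, single_mul_single, smul_one, mul_one,
      smashFunctional_single, smashFunctional_single]

/-- Multiplying `u # γ` by `v` produces `u (γ • v) # γ`. The value of `f` at `γ • v` thus becomes a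
function on the group. -/
lemma degreeOne_comp_mulRight_gen {f : (X →₀ k) →ₗ[k] k} {c c' : Γ → k} {v : X →₀ k}
    (h : ∀ γ, c γ * f (M.action γ v) = c' γ) :
    M.smashFunctional (M.degreeOne f) c ∘ₗ LinearMap.mulRight k (single 1 (M.ι v)) =
      M.smashFunctional M.tensorData.counit.toLinearMap c' := by
  refine LinearMap.ext fun a => ?_
  induction a using SkewMonoidAlgebra.induction_on with
  | zero => simp only [map_zero]
  | add a b ha hb => simp only [map_add, ha, hb]
  | single γ u =>
    rw [LinearMap.comp_apply, LinearMap.mulRight_apply, single_mul_single, smul_ι,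
      smashFunctional_single, smashFunctional_single, degreeOne_mul_ι, AlgHom.toLinearMap_apply,
      ← h, mul_comm (M.tensorData.counit u), mul_assoc, mul_one]

lemma counit_comp_mulRight_gen (c : Γ → k) (v : X →₀ k) :
    M.smashFunctional M.tensorData.counit.toLinearMap c ∘ₗ
      LinearMap.mulRight k (single 1 (M.ι v)) = 0 := by
  refine LinearMap.ext fun a => ?_
  induction a using SkewMonoidAlgebra.induction_on with
  | zero => simp only [map_zero]
  | add a b ha hb => simp only [map_add, ha, hb]
  | single γ u =>
    rw [LinearMap.comp_apply, LinearMap.mulRight_apply, single_mul_single, smul_ι,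
      smashFunctional_single, AlgHom.toLinearMap_apply, map_mul, counit_ι, mul_zero, mul_zero,
      LinearMap.zero_apply]

lemma counit_single (γ : Γ) (u : M.Tensor) :
    counit (R := k) (single γ u : SkewMonoidAlgebra M.Tensor Γ) = M.tensorData.counit u := by
  have e : (single γ u : SkewMonoidAlgebra M.Tensor Γ) = single 1 u * single γ 1 := by
    simp [single_mul_single]
  rw [e, Bialgebra.counit_mul, counit_single_one, mul_one]
  exact M.tensorData.counitHom_single u

lemma smashFunctional_counit_one :
    M.smashFunctional M.tensorData.counit.toLinearMap (fun _ : Γ => 1) = counit := by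
  refine LinearMap.ext fun a => ?_
  induction a using SkewMonoidAlgebra.induction_on with
  | zero => simp only [map_zero]
  | add a b ha hb => simp only [map_add, ha, hb]
  | single γ u => rw [smashFunctional_single, counit_single, one_mul, AlgHom.toLinearMap_apply]

lemma smashFunctional_add (F : M.Tensor →ₗ[k] k) (c c' : Γ → k) :
    M.smashFunctional F (fun γ => c γ + c' γ) =
      M.smashFunctional F c + M.smashFunctional F c' := by
  refine LinearMap.ext fun a => ?_
  induction a using SkewMonoidAlgebra.induction_on with
  | zero => simp only [map_zero]
  | add a b ha hb => simp only [map_add, ha, hb]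
  | single γ u => simp only [smashFunctional_single, LinearMap.add_apply, add_mul]

lemma smashFunctional_smul (F : M.Tensor →ₗ[k] k) (r : k) (c : Γ → k) :
    M.smashFunctional F (fun γ => r * c γ) = r • M.smashFunctional F c := by
  refine LinearMap.ext fun a => ?_
  induction a using SkewMonoidAlgebra.induction_on with
  | zero => simp only [map_zero]
  | add a b ha hb => simp only [map_add, ha, hb]
  | single γ u =>
    simp only [smashFunctional_single, LinearMap.smul_apply, smul_eq_mul, mul_assoc]

/-- The functional `ξ` on `T(V) # kΓ` factors through the bosonization of the Nichols algebra. -/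
def Descends (ξ : SkewMonoidAlgebra M.Tensor Γ →ₗ[k] k) : Prop :=
  ∃ η : M.Bosonization →ₗ[k] k, ξ = η ∘ₗ M.bosonMk.toLinearMap

variable {M}

lemma Descends.smul {ξ : SkewMonoidAlgebra M.Tensor Γ →ₗ[k] k} (r : k) (h : M.Descends ξ) :
    M.Descends (r • ξ) := by
  obtain ⟨η, rfl⟩ := h
  exact ⟨r • η, rfl⟩

lemma Descends.sub {ξ ξ' : SkewMonoidAlgebra M.Tensor Γ →ₗ[k] k} (h : M.Descends ξ)
    (h' : M.Descends ξ') : M.Descends (ξ - ξ') := by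
  obtain ⟨η, rfl⟩ := h
  obtain ⟨η', rfl⟩ := h'
  exact ⟨η - η', rfl⟩

/-- The projection is a coalgebra map. Hence new functionals that descend arise as convolutions of
those of degree one. -/
lemma Descends.dualConv {ξ ξ' : SkewMonoidAlgebra M.Tensor Γ →ₗ[k] k} (h : M.Descends ξ)
    (h' : M.Descends ξ') : M.Descends (dualConv ξ ξ') := by
  obtain ⟨η, rfl⟩ := h
  obtain ⟨η', rfl⟩ := h'
  exact ⟨_root_.dualConv η η', (dualConv_comp η η' M.map_bosonMk_comul).symm⟩

lemma Descends.apply_eq_zero {ξ : SkewMonoidAlgebra M.Tensor Γ →ₗ[k] k} (h : M.Descends ξ)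
    {a : SkewMonoidAlgebra M.Tensor Γ} (ha : M.bosonMk a = 0) : ξ a = 0 := by
  obtain ⟨η, rfl⟩ := h
  rw [LinearMap.comp_apply, AlgHom.toLinearMap_apply, ha, map_zero]

variable (M)

lemma descends_counit : M.Descends counit :=
  ⟨counit, LinearMap.ext fun a => (M.counit_bosonMk a).symm⟩

/-- An element of the kernel of the projection has all its coefficients in the Nichols ideal, so the
functional annihilates the kernel and factors. -/
lemma descends_smashFunctional {F : M.Tensor →ₗ[k] k}
    (hF : ∀ n, 2 ≤ n → ∀ u ∈ M.tensorGrading n, F u = 0) (c : Γ → k) :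
    M.Descends (M.smashFunctional F c) := by
  have h : M.smashFunctional F c ∈ (LinearMap.ker M.bosonMk.toLinearMap).dualAnnihilator := by
    rw [Submodule.mem_dualAnnihilator]
    intro a ha
    rw [smashFunctional_apply]
    refine Finset.sum_eq_zero fun γ _ => ?_
    have h1 := M.coeffAt_bosonMk γ a
    rw [show M.bosonMk a = 0 from ha, map_zero] at h1
    simp only
    rw [M.eq_zero_of_mem_nicholsIdeal hF (M.toNichols_eq_zero.1 h1.symm), mul_zero]
  rw [← LinearMap.range_dualMap_eq_dualAnnihilator_ker] at h
  obtain ⟨η, hη⟩ := h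
  exact ⟨η, hη.symm⟩

lemma descends_degreeOne (f : (X →₀ k) →ₗ[k] k) (c : Γ → k) :
    M.Descends (M.smashFunctional (M.degreeOne f) c) :=
  M.descends_smashFunctional (fun _ hn _ hu => M.degreeOne_eq_zero_of_mem_tensorGrading f hn hu) c

end YetterDrinfeld

/-! ### Relations in `L`, and functionals on `L`. -/

namespace BlockPointDatum

open Coalgebra YetterDrinfeld SkewMonoidAlgebra

attribute [local instance] LieRing.ofAssociativeRing

section LieFunctionals

variable {p : ℕ} [hp : Fact p.Prime] (D : BlockPointDatum p) (k : Type*) [Field k] [CharP k p]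

/-- The element `E_j` of `L`. -/
def eL (j : Fin D.t) : D.HopfL k := RestrictedEnveloping.ι k (D.E k j)

/-- The inclusion of `V(𝒢)` in `𝔩`. -/
def vLie : D.VG k →ₗ[k] D.LieL k := AbelianLie.inclLeft

/-- The inclusion of `V(𝒢)` in `L`. -/
def vL : D.VG k →ₗ[k] D.HopfL k :=
  (RestrictedEnveloping.ι k : D.LieL k →ₗ⁅k⁆ D.HopfL k).toLinearMap ∘ₗ D.vLie k

lemma vL_mem_span (u : D.VG k) : D.vL k u ∈
    Submodule.span k (Set.range fun w : D.Weight => D.vL k (Finsupp.single w 1)) := by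
  induction u using Finsupp.induction_linear with
  | zero => rw [map_zero]; exact zero_mem _
  | add u v hu hv => rw [map_add]; exact add_mem hu hv
  | single w c =>
    rw [← mul_one c, ← smul_eq_mul, ← Finsupp.smul_single, map_smul]
    exact Submodule.smul_mem _ c (Submodule.subset_span ⟨w, rfl⟩)

lemma ι_mem_span (x : D.LieL k) : RestrictedEnveloping.ι k x ∈ Submodule.span k
    (Set.range (D.eL k) ∪ Set.range fun w : D.Weight => D.vL k (Finsupp.single w 1)) := by
  let inclRight : (Fin D.t →₀ k) →ₗ[k] D.LieL k :=
    { toFun := fun e => ⟨0, AbelianLie.of e⟩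
      map_add' := fun e e' => by
        rw [LieAlgebra.SemiDirectSum.add_eq_mk]
        simp only [add_zero]
        rfl
      map_smul' := fun c e => by
        rw [RingHom.id_apply, LieAlgebra.SemiDirectSum.smul_eq_mk]
        simp only [smul_zero]
        rfl }
  have hx : x = D.vLie k (x.left : D.VG k) +
      inclRight (x.right : Fin D.t →₀ k) := by
    refine Eq.trans ?_ (LieAlgebra.SemiDirectSum.add_eq_mk _ _ _).symm
    exact congrArg₂ LieAlgebra.SemiDirectSum.mk (add_zero _).symm (zero_add _).symm
  have h1 (e : Fin D.t →₀ k) : RestrictedEnveloping.ι k (inclRight e) ∈ Submodule.span k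
      (Set.range (D.eL k) ∪ Set.range fun w : D.Weight => D.vL k (Finsupp.single w 1)) := by
    induction e using Finsupp.induction_linear with
    | zero => rw [map_zero, map_zero]; exact zero_mem _
    | add u v hu hv => rw [map_add, map_add]; exact add_mem hu hv
    | single j c =>
      rw [← mul_one c, ← smul_eq_mul, ← Finsupp.smul_single, map_smul, map_smul]
      exact Submodule.smul_mem _ c (Submodule.subset_span (Or.inl ⟨j, rfl⟩))
  rw [hx, map_add]
  exact add_mem (Submodule.span_mono Set.subset_union_right (D.vL_mem_span k _)) (h1 _)

lemma adjoin_L_eq_top : Algebra.adjoin k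
    (Set.range (D.eL k) ∪ Set.range fun w : D.Weight => D.vL k (Finsupp.single w 1)) = ⊤ := by
  rw [eq_top_iff, ← RestrictedEnveloping.adjoin_ι, Algebra.adjoin_le_iff]
  rintro _ ⟨x, rfl⟩
  exact Algebra.span_le_adjoin k _ (D.ι_mem_span k x)

lemma eL_mul_vL (j : Fin D.t) (u : D.VG k) :
    D.eL k j * D.vL k u = D.vL k u * D.eL k j + D.vL k (D.raise k j u) := by
  have h : RestrictedEnveloping.ι k ⁅D.E k j, (⟨u, 0⟩ : D.LieL k)⁆ =
      D.eL k j * D.vL k u - D.vL k u * D.eL k j := LieHom.map_lie _ _ _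
  rw [lie_E] at h
  exact (sub_eq_iff_eq_add'.1 h.symm)

lemma commute_eL (i j : Fin D.t) : Commute (D.eL k i) (D.eL k j) := by
  have h : RestrictedEnveloping.ι k ⁅D.E k i, D.E k j⁆ =
      D.eL k i * D.eL k j - D.eL k j * D.eL k i := LieHom.map_lie _ _ _
  have h0 : ⁅D.E k i, D.E k j⁆ = 0 := by
    rw [AbelianLie.bracket_eq]
    have : D.nAct k (Finsupp.single i 1) 0 - D.nAct k (Finsupp.single j 1) 0 = 0 := by simp
    exact congrArg (D.vLie k) this |>.trans (map_zero _)
  rw [h0, map_zero] at h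
  exact (sub_eq_zero.1 h.symm)

lemma commute_vL (u v : D.VG k) : Commute (D.vL k u) (D.vL k v) := by
  have h : RestrictedEnveloping.ι k ⁅D.vLie k u, D.vLie k v⁆ =
      D.vL k u * D.vL k v - D.vL k v * D.vL k u := LieHom.map_lie _ _ _
  have h0 : ⁅D.vLie k u, D.vLie k v⁆ = 0 := by
    refine (AbelianLie.bracket_eq (D.vLie k u) (D.vLie k v)).trans ?_
    have : D.nAct k 0 v - D.nAct k 0 u = 0 := by simp
    exact congrArg (D.vLie k) this |>.trans (map_zero _)
  rw [h0, map_zero] at h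
  exact (sub_eq_zero.1 h.symm)

lemma eL_pow (j : Fin D.t) : D.eL k j ^ p = 0 := by
  refine (RestrictedEnveloping.ι_pow k (D.E k j)).trans ?_
  have : (D.nAct k (Finsupp.single j 1) ^ (p - 1)) 0 = 0 := map_zero _
  have h : RestrictedLieAlgebra.pMap k (D.E k j) = 0 :=
    (congrArg (D.vLie k) this).trans (map_zero _)
  rw [h, map_zero]

lemma vL_pow (u : D.VG k) : D.vL k u ^ p = 0 := by
  refine (RestrictedEnveloping.ι_pow k (D.vLie k u)).trans ?_
  have : (D.nAct k 0 ^ (p - 1)) u = 0 := by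
    rw [map_zero, zero_pow, LinearMap.zero_apply]
    have := hp.out.two_le
    omega
  have h : RestrictedLieAlgebra.pMap k (D.vLie k u) = 0 :=
    (congrArg (D.vLie k) this).trans (map_zero _)
  rw [h, map_zero]

lemma comul_eL (j : Fin D.t) :
    comul (R := k) (D.eL k j) = D.eL k j ⊗ₜ 1 + 1 ⊗ₜ D.eL k j :=
  RestrictedEnveloping.comulHom_ι _

lemma comul_vL (u : D.VG k) : comul (R := k) (D.vL k u) = D.vL k u ⊗ₜ 1 + 1 ⊗ₜ D.vL k u :=
  RestrictedEnveloping.comulHom_ι _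

lemma counit_eL (j : Fin D.t) : counit (R := k) (D.eL k j) = 0 :=
  RestrictedEnveloping.counitHom_ι _

lemma counit_vL (u : D.VG k) : counit (R := k) (D.vL k u) = 0 :=
  RestrictedEnveloping.counitHom_ι _

/-- Linear maps from `L` are equal if they are equal at `1` and have equal right translates. -/
lemma eq_top_of_mul_mem_L {N : Submodule k (D.HopfL k)} (h1 : 1 ∈ N)
    (he : ∀ a ∈ N, ∀ j, a * D.eL k j ∈ N) (hv : ∀ a ∈ N, ∀ u, a * D.vL k u ∈ N) : N = ⊤ := by
  refine Submodule.eq_top_of_mul_mem_of_adjoin_eq_top (D.adjoin_L_eq_top k) N h1 ?_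
  rintro a ha _ (⟨j, rfl⟩ | ⟨w, rfl⟩)
  · exact he a ha j
  · exact hv a ha _

/-- The right action of `V(𝒢)` on `k ⊕ V(𝒢)`: `(c, u) · v = (0, -c v)`. -/
def rightActV : D.VG k →ₗ[k] (Module.End k (k × D.VG k))ᵐᵒᵖ :=
  (-1 : k) • ((MulOpposite.opLinearEquiv k (M := Module.End k (k × D.VG k))).toLinearMap ∘ₗ
    { toFun := fun v => LinearMap.inr k k (D.VG k) ∘ₗ
        LinearMap.toSpanSingleton k _ v ∘ₗ LinearMap.fst k k (D.VG k)
      map_add' := fun v w => by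
        rw [LinearMap.toSpanSingleton_add, LinearMap.add_comp, LinearMap.comp_add]
      map_smul' := fun c v => by
        rw [LinearMap.toSpanSingleton_smul, LinearMap.smul_comp, LinearMap.comp_smul,
          RingHom.id_apply] })

lemma rightActV_apply (v : D.VG k) (z : k × D.VG k) :
    (D.rightActV k v).unop z = (0, -(z.1 • v)) := by
  simp [rightActV]

/-- The right action of `𝔫` on `k ⊕ V(𝒢)`: `(c, u) · e = (0, -e u)`. -/
def rightActN : (Fin D.t →₀ k) →ₗ[k] (Module.End k (k × D.VG k))ᵐᵒᵖ :=
  (-1 : k) • ((MulOpposite.opLinearEquiv k (M := Module.End k (k × D.VG k))).toLinearMap ∘ₗ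
    { toFun := fun e => LinearMap.inr k k (D.VG k) ∘ₗ D.nAct k e ∘ₗ LinearMap.snd k k (D.VG k)
      map_add' := fun e e' => by rw [map_add, LinearMap.add_comp, LinearMap.comp_add]
      map_smul' := fun c e => by
        rw [map_smul, LinearMap.smul_comp, LinearMap.comp_smul, RingHom.id_apply] })

lemma rightActN_apply (e : Fin D.t →₀ k) (z : k × D.VG k) :
    (D.rightActN k e).unop z = (0, -(D.nAct k e z.2)) := by
  simp [rightActN]

lemma rightActN_pow_apply (e : Fin D.t →₀ k) {n : ℕ} (hn : n ≠ 0) (z : k × D.VG k) :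
    ((D.rightActN k e).unop ^ n) z = (0, (-1 : k) ^ n • (D.nAct k e ^ n) z.2) := by
  obtain ⟨n, rfl⟩ := Nat.exists_eq_succ_of_ne_zero hn
  clear hn
  induction n with
  | zero => simp [rightActN_apply]
  | succ n ih =>
    rw [pow_succ', Module.End.mul_apply, ih, rightActN_apply]
    refine Prod.ext rfl ?_
    change -(D.nAct k e ((-1 : k) ^ n.succ • (D.nAct k e ^ n.succ) z.2)) =
      (-1 : k) ^ (n.succ + 1) • (D.nAct k e ^ (n.succ + 1)) z.2
    rw [map_smul, pow_succ' (D.nAct k e) n.succ, Module.End.mul_apply, pow_succ' (-1 : k) n.succ,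
      neg_one_mul, neg_smul]

/-- The right action of `L` on `k ⊕ V(𝒢)`. -/
def rightAct : D.HopfL k →ₐ[k] (Module.End k (k × D.VG k))ᵐᵒᵖ :=
  AbelianLie.liftSemidirect (A := (Module.End k (k × D.VG k))ᵐᵒᵖ) (D.nAct_pow k)
    (w := D.rightActV k) (y := D.rightActN k)
    (fun u v => MulOpposite.unop_injective <| LinearMap.ext fun z => by
      simp only [MulOpposite.unop_mul, Module.End.mul_apply, rightActV_apply, zero_smul])
    (fun e e' => MulOpposite.unop_injective <| LinearMap.ext fun z => by
      have := LinearMap.congr_fun (D.nAct_commute k e e').eq z.2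
      simp only [Module.End.mul_apply] at this
      simp only [MulOpposite.unop_mul, Module.End.mul_apply, rightActN_apply, map_neg, this])
    (fun e u => MulOpposite.unop_injective <| LinearMap.ext fun z => by
      simp only [innerDer_apply, MulOpposite.unop_sub, MulOpposite.unop_mul, LinearMap.sub_apply,
        Module.End.mul_apply, rightActN_apply, rightActV_apply, zero_smul, map_neg, map_smul,
        neg_zero, neg_neg, Prod.mk_sub_mk, sub_zero, zero_sub])
    (fun u => MulOpposite.unop_injective <| LinearMap.ext fun z => by
      have h : D.rightActV k u ^ 2 = 0 := MulOpposite.unop_injective <| LinearMap.ext fun z => by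
        rw [pow_two, MulOpposite.unop_mul, Module.End.mul_apply, rightActV_apply, rightActV_apply,
          zero_smul, neg_zero]
        rfl
      rw [pow_eq_zero_of_le hp.out.two_le h])
    (fun e => MulOpposite.unop_injective <| LinearMap.ext fun z => by
      rw [MulOpposite.unop_pow, D.rightActN_pow_apply k e hp.out.ne_zero, nAct_pow,
        LinearMap.zero_apply, smul_zero]
      rfl)

lemma rightAct_eL (j : Fin D.t) (z : k × D.VG k) :
    (D.rightAct k (D.eL k j)).unop z = (0, -(D.raise k j z.2)) := by
  have h : D.rightAct k (D.eL k j) = D.rightActV k 0 + D.rightActN k (Finsupp.single j 1) :=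
    AbelianLie.liftSemidirect_ι (D.nAct_pow k) _ _ _ _ _ _
  rw [h, map_zero, zero_add, rightActN_apply, nAct_single, one_smul]

lemma rightAct_vL (u : D.VG k) (z : k × D.VG k) :
    (D.rightAct k (D.vL k u)).unop z = (0, -(z.1 • u)) := by
  have h : D.rightAct k (D.vL k u) = D.rightActV k u + D.rightActN k 0 :=
    AbelianLie.liftSemidirect_ι (D.nAct_pow k) _ _ _ _ _ _
  rw [h, map_zero, add_zero, rightActV_apply]

/-- The linear functional on `L` that maps `l` to the value of `f` at the `V(𝒢)`-component of
`(1, 0) · l`. -/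
def psi (f : D.VG k →ₗ[k] k) : D.HopfL k →ₗ[k] k :=
  f ∘ₗ LinearMap.snd k k (D.VG k) ∘ₗ LinearMap.applyₗ (1, 0) ∘ₗ
    (MulOpposite.opLinearEquiv k).symm.toLinearMap ∘ₗ (D.rightAct k).toLinearMap

lemma psi_apply (f : D.VG k →ₗ[k] k) (a : D.HopfL k) :
    D.psi k f a = f ((D.rightAct k a).unop (1, 0)).2 := rfl

lemma fst_rightAct (a : D.HopfL k) (z : k × D.VG k) :
    ((D.rightAct k a).unop z).1 = counit (R := k) a * z.1 := by
  let N : Submodule k (D.HopfL k) :=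
    { carrier := {a | ∀ z, ((D.rightAct k a).unop z).1 = counit (R := k) a * z.1}
      add_mem' := fun {a b} ha hb z => by
        rw [map_add, MulOpposite.unop_add, LinearMap.add_apply, Prod.fst_add, ha, hb, map_add,
          add_mul]
      zero_mem' := fun z => by simp
      smul_mem' := fun c a ha z => by
        rw [map_smul, MulOpposite.unop_smul, LinearMap.smul_apply, Prod.smul_fst, ha, map_smul,
          smul_mul_assoc] }
  have hN : N = ⊤ := by
    refine D.eq_top_of_mul_mem_L k (fun z => ?_) (fun a ha j z => ?_) (fun a ha u z => ?_)
    · simp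
    · rw [map_mul, MulOpposite.unop_mul, Module.End.mul_apply, rightAct_eL, Bialgebra.counit_mul,
        counit_eL, mul_zero, zero_mul]
    · rw [map_mul, MulOpposite.unop_mul, Module.End.mul_apply, rightAct_vL, Bialgebra.counit_mul,
        counit_vL, mul_zero, zero_mul]
  have : a ∈ N := hN ▸ Submodule.mem_top
  exact this z

lemma psi_one (f : D.VG k →ₗ[k] k) : D.psi k f 1 = 0 := by
  simp [psi_apply]

/-- For a right action the last factor acts last, so it is transposed onto `f`. This is why
identities for `psi` have to be proved for all `f` simultaneously. -/
lemma psi_mul_eL (f : D.VG k →ₗ[k] k) (a : D.HopfL k) (j : Fin D.t) :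
    D.psi k f (a * D.eL k j) = -D.psi k (f ∘ₗ D.raise k j) a := by
  rw [psi_apply, map_mul, MulOpposite.unop_mul, Module.End.mul_apply, rightAct_eL, psi_apply]
  simp

lemma psi_mul_vL (f : D.VG k →ₗ[k] k) (a : D.HopfL k) (u : D.VG k) :
    D.psi k f (a * D.vL k u) = -(f u * counit (R := k) a) := by
  rw [psi_apply, map_mul, MulOpposite.unop_mul, Module.End.mul_apply, rightAct_vL, fst_rightAct]
  simp [mul_comm]

lemma psi_comp_mulRight_eL (f : D.VG k →ₗ[k] k) (j : Fin D.t) :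
    D.psi k f ∘ₗ LinearMap.mulRight k (D.eL k j) = -D.psi k (f ∘ₗ D.raise k j) :=
  LinearMap.ext fun a => D.psi_mul_eL k f a j

lemma psi_comp_mulRight_vL (f : D.VG k →ₗ[k] k) (u : D.VG k) :
    D.psi k f ∘ₗ LinearMap.mulRight k (D.vL k u) = -(f u • counit) :=
  LinearMap.ext fun a => D.psi_mul_vL k f a u

/-- The linear map `e ↦ e_j ε` to the dual numbers. -/
def dualNumberMap (j : Fin D.t) : (Fin D.t →₀ k) →ₗ[k] DualNumber k :=
  TrivSqZeroExt.inrHom k k ∘ₗ Finsupp.lapply j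

/-- The algebra map from `L` to the dual numbers that maps `E_j` to `ε` and the other basis elements
of the Lie algebra to `0`. -/
def toDualNumber (j : Fin D.t) : D.HopfL k →ₐ[k] DualNumber k :=
  AbelianLie.liftSemidirect (D.nAct_pow k) (w := 0) (y := D.dualNumberMap k j)
    (fun _ _ => Commute.all _ _) (fun _ _ => Commute.all _ _)
    (fun _ _ => by simp [innerDer_apply])
    (fun _ => by rw [LinearMap.zero_apply, zero_pow hp.out.ne_zero])
    (fun e => by
      have h : D.dualNumberMap k j e ^ 2 = 0 := by simp [dualNumberMap, pow_two]
      exact pow_eq_zero_of_le hp.out.two_le h)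

lemma toDualNumber_eL (i j : Fin D.t) :
    D.toDualNumber k j (D.eL k i) = TrivSqZeroExt.inr (if i = j then 1 else 0) := by
  have h : D.toDualNumber k j (D.eL k i) = 0 + D.dualNumberMap k j (Finsupp.single i 1) :=
    AbelianLie.liftSemidirect_ι (D.nAct_pow k) _ _ _ _ _ _
  rw [h, zero_add]
  simp [dualNumberMap, Finsupp.single_apply]

lemma toDualNumber_vL (j : Fin D.t) (u : D.VG k) : D.toDualNumber k j (D.vL k u) = 0 := by
  have h : D.toDualNumber k j (D.vL k u) = 0 + D.dualNumberMap k j 0 :=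
    AbelianLie.liftSemidirect_ι (D.nAct_pow k) _ _ _ _ _ _
  rw [h, map_zero, add_zero]

/-- The linear functional on `L` that is an `ε`-derivation and maps `E_j` to `1` and the other basis
elements of the Lie algebra to `0`. -/
def coordE (j : Fin D.t) : D.HopfL k →ₗ[k] k :=
  TrivSqZeroExt.sndHom k k ∘ₗ (D.toDualNumber k j).toLinearMap

lemma coordE_one (j : Fin D.t) : D.coordE k j 1 = 0 := by
  simp [coordE]

lemma fst_toDualNumber (j : Fin D.t) (a : D.HopfL k) :
    TrivSqZeroExt.fst (D.toDualNumber k j a) = counit (R := k) a := by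
  have h : (TrivSqZeroExt.fstHom k k k).comp (D.toDualNumber k j) = Bialgebra.counitAlgHom k _ := by
    refine AlgHom.ext_of_adjoin_eq_top (D.adjoin_L_eq_top k) ?_
    rintro _ (⟨i, rfl⟩ | ⟨w, rfl⟩)
    · rw [AlgHom.comp_apply, toDualNumber_eL, Bialgebra.counitAlgHom_apply, counit_eL]
      exact TrivSqZeroExt.fst_inr k (if i = j then (1 : k) else 0)
    · simp only
      rw [AlgHom.comp_apply, toDualNumber_vL, Bialgebra.counitAlgHom_apply, counit_vL]
      simp
  exact DFunLike.congr_fun h a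

lemma coordE_comp_mulRight_eL (i j : Fin D.t) :
    D.coordE k j ∘ₗ LinearMap.mulRight k (D.eL k i) =
      (if i = j then 1 else 0 : k) • counit := by
  refine LinearMap.ext fun a => ?_
  simp only [coordE, LinearMap.comp_apply, LinearMap.mulRight_apply, AlgHom.toLinearMap_apply,
    map_mul, TrivSqZeroExt.sndHom_apply, TrivSqZeroExt.snd_mul, toDualNumber_eL,
    TrivSqZeroExt.snd_inr, TrivSqZeroExt.fst_inr, fst_toDualNumber]
  split_ifs <;> simp

lemma coordE_comp_mulRight_vL (j : Fin D.t) (u : D.VG k) :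
    D.coordE k j ∘ₗ LinearMap.mulRight k (D.vL k u) = 0 := by
  refine LinearMap.ext fun a => ?_
  simp only [coordE, LinearMap.comp_apply, LinearMap.mulRight_apply, AlgHom.toLinearMap_apply,
    map_mul, toDualNumber_vL, mul_zero, map_zero, LinearMap.zero_apply]

end LieFunctionals

end BlockPointDatum

/-! ### Zero and sign rules for convolution. -/

section ConvolutionLinear

variable {k A : Type*} [Field k] [Ring A] [Bialgebra k A]

lemma dualConv_zero_left (η : A →ₗ[k] k) : dualConv 0 η = 0 := by
  simpa using dualConv_smul_left (0 : k) 0 η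

lemma dualConv_zero_right (η : A →ₗ[k] k) : dualConv η 0 = 0 := by
  simpa using dualConv_smul_right (0 : k) η 0

lemma dualConv_neg_left (ξ η : A →ₗ[k] k) : dualConv (-ξ) η = -dualConv ξ η := by
  have h : -ξ = (-1 : k) • ξ := by ext; simp
  rw [h, dualConv_smul_left]
  ext; simp

lemma dualConv_neg_right (ξ η : A →ₗ[k] k) : dualConv ξ (-η) = -dualConv ξ η := by
  have h : -η = (-1 : k) • η := by ext; simp
  rw [h, dualConv_smul_right]
  ext; simp

end ConvolutionLinear

namespace YetterDrinfeld

open Coalgebra SkewMonoidAlgebra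

variable {k Γ X : Type*} [Field k] [CommGroup Γ] (M : YetterDrinfeld k Γ X)

/-- A family of functionals on `T(V) # kΓ` is zero if its values at products are determined by
its values at the left factors. -/
lemma forall_eq_zero_of_mul {F : Type*} {ζ : F → SkewMonoidAlgebra M.Tensor Γ →ₗ[k] k}
    (h1 : ∀ f, ζ f 1 = 0)
    (hx : ∀ a, (∀ f, ζ f a = 0) → ∀ f x, ζ f (a * single 1 (M.ι (Finsupp.single x 1))) = 0)
    (hγ : ∀ a, (∀ f, ζ f a = 0) → ∀ f γ, ζ f (a * single γ 1) = 0) (f : F) : ζ f = 0 := by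
  have h : (⨅ f, LinearMap.ker (ζ f)) = ⊤ := by
    refine Submodule.eq_top_of_mul_mem_of_adjoin_eq_top M.adjoin_tensor_eq_top _ ?_ ?_
    · simpa [Submodule.mem_iInf] using h1
    · intro a ha z hz
      simp only [Submodule.mem_iInf, LinearMap.mem_ker] at ha ⊢
      rcases hz with ⟨x, rfl⟩ | ⟨γ, rfl⟩
      · exact fun f => hx a ha f x
      · exact fun f => hγ a ha f γ
  refine LinearMap.ext fun a => ?_
  have ha : a ∈ ⨅ f, LinearMap.ker (ζ f) := h ▸ Submodule.mem_top
  exact (Submodule.mem_iInf _).1 ha f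

end YetterDrinfeld

/-! ### Raising, lowering and weight operators on `V(𝒢)`. -/

namespace BlockPointDatum

open Coalgebra YetterDrinfeld SkewMonoidAlgebra

section WeightOperators

variable {p : ℕ} (D : BlockPointDatum p) (k : Type*) [Field k]

/-- The weight `(h, m - e_j)`. -/
def lowerWeight (j : Fin D.t) (w : D.Weight) : D.Weight :=
  ⟨w.1, Function.update w.2 j ⟨w.2 j - 1, by omega⟩⟩

/-- The operator `v_{h, m} ↦ m_j (𝒢_hj + 1 - m_j) / 2 v_{h, m - e_j}` on `V(𝒢)`. -/
def lower (j : Fin D.t) : Module.End k (D.VG k) :=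
  Finsupp.linearCombination k fun w =>
    ((w.2 j : ℕ) * ((D.ghost w.1 j : k) + 1 - (w.2 j : ℕ)) / 2) •
      Finsupp.single (D.lowerWeight j w) (1 : k)

lemma lower_single (j : Fin D.t) (w : D.Weight) : D.lower k j (Finsupp.single w 1) =
    ((w.2 j : ℕ) * ((D.ghost w.1 j : k) + 1 - (w.2 j : ℕ)) / 2) •
      Finsupp.single (D.lowerWeight j w) (1 : k) := by
  simp [lower]

/-- The operator `v_{h, m} ↦ (m_j - 𝒢_hj / 2) v_{h, m}` on `V(𝒢)`. -/
def weightOp (j : Fin D.t) : Module.End k (D.VG k) :=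
  Finsupp.linearCombination k fun w =>
    ((w.2 j : ℕ) - (D.ghost w.1 j : k) / 2) • Finsupp.single w (1 : k)

lemma weightOp_single (j : Fin D.t) (w : D.Weight) : D.weightOp k j (Finsupp.single w 1) =
    ((w.2 j : ℕ) - (D.ghost w.1 j : k) / 2) • Finsupp.single w (1 : k) := by
  simp [weightOp]

/-- The weight `(h, m + e_j)`, for `m_j < 𝒢_hj`. -/
def raiseWeight (j : Fin D.t) (w : D.Weight) (hw : (w.2 j : ℕ) < D.ghost w.1 j) : D.Weight :=
  ⟨w.1, Function.update w.2 j ⟨w.2 j + 1, Nat.succ_lt_succ hw⟩⟩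

lemma raise_single_of_lt {j : Fin D.t} {w : D.Weight} (hw : (w.2 j : ℕ) < D.ghost w.1 j) :
    D.raise k j (Finsupp.single w 1) = Finsupp.single (D.raiseWeight j w hw) 1 := by
  rw [raise_single, raiseBasis, dif_pos hw]
  rfl

lemma raise_single_of_eq {j : Fin D.t} {w : D.Weight} (hw : (w.2 j : ℕ) = D.ghost w.1 j) :
    D.raise k j (Finsupp.single w 1) = 0 := by
  rw [raise_single, raiseBasis, dif_neg (by omega)]

lemma lt_or_eq_ghost (j : Fin D.t) (w : D.Weight) :
    (w.2 j : ℕ) < D.ghost w.1 j ∨ (w.2 j : ℕ) = D.ghost w.1 j := by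
  have := (w.2 j).2
  omega

lemma raiseWeight_self (j : Fin D.t) (w : D.Weight) (hw) :
    ((D.raiseWeight j w hw).2 j : ℕ) = w.2 j + 1 := by
  simp [raiseWeight]

lemma raiseWeight_of_ne {i j : Fin D.t} (hij : i ≠ j) (w : D.Weight) (hw) :
    (D.raiseWeight j w hw).2 i = w.2 i := by
  simp [raiseWeight, hij]

lemma lowerWeight_self (j : Fin D.t) (w : D.Weight) :
    ((D.lowerWeight j w).2 j : ℕ) = w.2 j - 1 := by
  simp [lowerWeight]

lemma lowerWeight_of_ne {i j : Fin D.t} (hij : i ≠ j) (w : D.Weight) :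
    (D.lowerWeight j w).2 i = w.2 i := by
  simp [lowerWeight, hij]

variable {D} in
lemma weight_ext {w w' : D.Weight} (h : w.1 = w'.1) (h' : ∀ j, (w.2 j : ℕ) = w'.2 j) : w = w' := by
  obtain ⟨h₁, m⟩ := w
  obtain ⟨h₂, m'⟩ := w'
  obtain rfl : h₁ = h₂ := h
  congr 1
  ext j
  exact h' j

lemma lowerWeight_raiseWeight (j : Fin D.t) (w : D.Weight) (hw) :
    D.lowerWeight j (D.raiseWeight j w hw) = w :=
  weight_ext rfl fun i => by
    rcases eq_or_ne i j with rfl | hij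
    · rw [lowerWeight_self, raiseWeight_self, Nat.add_sub_cancel]
    · rw [lowerWeight_of_ne _ hij, raiseWeight_of_ne _ hij]

lemma raiseWeight_lowerWeight (j : Fin D.t) (w : D.Weight) (h0 : (w.2 j : ℕ) ≠ 0) (hw) :
    D.raiseWeight j (D.lowerWeight j w) hw = w :=
  weight_ext rfl fun i => by
    rcases eq_or_ne i j with rfl | hij
    · rw [raiseWeight_self, lowerWeight_self]
      omega
    · rw [raiseWeight_of_ne _ hij, lowerWeight_of_ne _ hij]

/-- Together with `raise_comp_lower`, this is a relation of `sl₂` type for each block, up to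
normalization. The two relations drive the commutators of functionals below. -/
lemma weightOp_comp_raise (i j : Fin D.t) : D.weightOp k j ∘ₗ D.raise k i =
    D.raise k i ∘ₗ D.weightOp k j + (if i = j then 1 else 0 : k) • D.raise k i := by
  refine Finsupp.lhom_ext' fun w => LinearMap.ext_ring ?_
  simp only [LinearMap.comp_apply, LinearMap.add_apply, LinearMap.smul_apply,
    Finsupp.lsingle_apply]
  rcases D.lt_or_eq_ghost i w with hw | hw
  · rw [weightOp_single, map_smul, raise_single_of_lt _ _ hw, weightOp_single, ← add_smul]
    congr 1
    rcases eq_or_ne i j with rfl | hij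
    · rw [raiseWeight_self, if_pos rfl]
      simp only [raiseWeight]
      push_cast
      ring
    · rw [raiseWeight_of_ne _ hij.symm, if_neg hij, add_zero]
      rfl
  · rw [weightOp_single, map_smul, raise_single_of_eq _ _ hw]
    simp

/-- For `i = j` the diagonal entry is `m (𝒢 + 1 - m) / 2 - (m + 1) (𝒢 - m) / 2 = m - 𝒢 / 2`, which
explains the coefficients of `lower`. Operators in different blocks change different exponents. -/
lemma raise_comp_lower (h2 : (2 : k) ≠ 0) (i j : Fin D.t) : D.raise k i ∘ₗ D.lower k j =
    D.lower k j ∘ₗ D.raise k i + (if i = j then 1 else 0 : k) • D.weightOp k j := by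
  refine Finsupp.lhom_ext' fun w => LinearMap.ext_ring ?_
  simp only [LinearMap.comp_apply, LinearMap.add_apply, LinearMap.smul_apply,
    Finsupp.lsingle_apply]
  rw [weightOp_single, lower_single, map_smul]
  rcases eq_or_ne i j with rfl | hij
  · have e1 : ((w.2 i : ℕ) * ((D.ghost w.1 i : k) + 1 - (w.2 i : ℕ)) / 2) •
        D.raise k i (Finsupp.single (D.lowerWeight i w) 1) =
        ((w.2 i : ℕ) * ((D.ghost w.1 i : k) + 1 - (w.2 i : ℕ)) / 2) • Finsupp.single w 1 := by
      -- For `m_i = 0` the truncated subtraction in `lowerWeight` leaves the weight unchanged, but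
      -- the coefficient is zero.
      rcases Nat.eq_zero_or_pos (w.2 i) with h0 | h0
      · rw [h0]; simp
      · have hw : ((D.lowerWeight i w).2 i : ℕ) < D.ghost (D.lowerWeight i w).1 i := by
          rw [lowerWeight_self]
          have := (w.2 i).2
          change _ < D.ghost w.1 i
          omega
        rw [raise_single_of_lt _ _ hw, raiseWeight_lowerWeight _ _ _ h0.ne']
    rw [e1, if_pos rfl, one_smul]
    rcases D.lt_or_eq_ghost i w with hw | hw
    · rw [raise_single_of_lt _ _ hw, lower_single, lowerWeight_raiseWeight, ← add_smul,
        raiseWeight_self]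
      congr 1
      simp only [raiseWeight]
      push_cast
      field_simp
      ring
    · rw [raise_single_of_eq _ _ hw, map_zero, zero_add, hw]
      congr 1
      field_simp
      ring
  · rw [if_neg hij, zero_smul, add_zero]
    have hv : ((D.lowerWeight j w).2 i : ℕ) = w.2 i := by rw [lowerWeight_of_ne _ hij]
    rcases D.lt_or_eq_ghost i w with hw | hw
    · have hw' : ((D.lowerWeight j w).2 i : ℕ) < D.ghost (D.lowerWeight j w).1 i := hv ▸ hw
      rw [raise_single_of_lt _ _ hw, raise_single_of_lt _ _ hw', lower_single,
        raiseWeight_of_ne _ hij.symm]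
      have e : D.raiseWeight i (D.lowerWeight j w) hw' = D.lowerWeight j (D.raiseWeight i w hw) :=
        weight_ext rfl fun l => by
          rcases eq_or_ne l i with rfl | hl
          · rw [raiseWeight_self, lowerWeight_of_ne _ hij, lowerWeight_of_ne _ hij,
              raiseWeight_self]
          · rw [raiseWeight_of_ne _ hl]
            rcases eq_or_ne l j with rfl | hl'
            · rw [lowerWeight_self, lowerWeight_self, raiseWeight_of_ne _ hl]
            · rw [lowerWeight_of_ne _ hl', lowerWeight_of_ne _ hl', raiseWeight_of_ne _ hl]
      rw [e]
      rfl
    · have hw' : ((D.lowerWeight j w).2 i : ℕ) = D.ghost (D.lowerWeight j w).1 i := hv.trans hw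
      rw [raise_single_of_eq _ _ hw, raise_single_of_eq _ _ hw', map_zero, smul_zero]

/-- No other basis vector is lowered with nonzero coefficient to this weight. Transposed, `lower`
leads from the coordinate at `m - e_j` to the one at `m`. -/
lemma lapply_lowerWeight_comp_lower (j : Fin D.t) {w : D.Weight} (h0 : (w.2 j : ℕ) ≠ 0) :
    Finsupp.lapply (D.lowerWeight j w) ∘ₗ D.lower k j =
      ((w.2 j : ℕ) * ((D.ghost w.1 j : k) + 1 - (w.2 j : ℕ)) / 2) • Finsupp.lapply w := by
  refine Finsupp.lhom_ext' fun u => LinearMap.ext_ring ?_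
  simp only [LinearMap.comp_apply, LinearMap.smul_apply, Finsupp.lsingle_apply, lower_single,
    map_smul, Finsupp.lapply_apply]
  rcases eq_or_ne u w with rfl | hu
  · simp
  · rw [Finsupp.single_eq_of_ne hu.symm, smul_zero]
    -- If `u_j = 0`, then `lowerWeight` fixes `u` and could give the same weight. The coefficient is
    -- zero in this case.
    rcases Nat.eq_zero_or_pos (u.2 j) with hu0 | hu0
    · simp [hu0]
    · rw [Finsupp.single_eq_of_ne, smul_zero]
      intro e
      refine hu (weight_ext (congrArg Sigma.fst e).symm fun i => ?_)
      have e' (i : Fin D.t) : ((D.lowerWeight j w).2 i : ℕ) = (D.lowerWeight j u).2 i := by rw [e]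
      have e'' := e' i
      rcases eq_or_ne i j with rfl | hij
      · rw [lowerWeight_self, lowerWeight_self] at e''
        omega
      · rw [lowerWeight_of_ne _ hij, lowerWeight_of_ne _ hij] at e''
        exact e''.symm

lemma lapply_zero_comp_raise (h : Fin D.s) (j : Fin D.t) :
    (Finsupp.lapply (⟨h, 0⟩ : D.Weight) : D.VG k →ₗ[k] k) ∘ₗ D.raise k j = 0 := by
  refine Finsupp.lhom_ext' fun u => LinearMap.ext_ring ?_
  simp only [LinearMap.comp_apply, Finsupp.lsingle_apply, Finsupp.lapply_apply,
    LinearMap.zero_apply]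
  rcases D.lt_or_eq_ghost j u with hu | hu
  · rw [raise_single_of_lt _ _ hu, Finsupp.single_eq_of_ne]
    intro e
    have := D.raiseWeight_self j u hu
    rw [← e] at this
    simp at this
  · rw [raise_single_of_eq _ _ hu, Finsupp.zero_apply]

end WeightOperators

end BlockPointDatum

/-! ### Commutators of functionals on `T(𝒱) # kΓ`. -/

namespace BlockPointDatum

open Coalgebra YetterDrinfeld SkewMonoidAlgebra

section Projection

variable {p : ℕ} [hp : Fact p.Prime] (D : BlockPointDatum p) (k : Type*) [Field k] [CharP k p]

/-- The Hopf algebra `T(𝒱) # kΓ`. -/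
abbrev HopfT : Type _ := SkewMonoidAlgebra (D.braidedSpace k).Tensor D.Grp

/-- The generator of `T(𝒱) # kΓ` given by a basis element of `𝒱`. -/
abbrev genT (b : D.Basis) : D.HopfT k :=
  single 1 ((D.braidedSpace k).ι (Finsupp.single b 1))

/-- The images in `L` of the basis elements of `𝒱`. -/
def genL : D.Basis → D.HopfL k
  | Sum.inl (Sum.inl _) => 0
  | Sum.inl (Sum.inr h) => D.vL k (Finsupp.single ⟨h, 0⟩ 1)
  | Sum.inr j => D.eL k j

lemma linearCombination_genL_action (γ : D.Grp) (v : D.Basis →₀ k) :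
    Finsupp.linearCombination k (D.genL k) ((D.braidedSpace k).action γ v) =
      Finsupp.linearCombination k (D.genL k) v := by
  have h : Finsupp.linearCombination k (D.genL k) ∘ₗ (D.braidedSpace k).action γ =
      Finsupp.linearCombination k (D.genL k) := by
    refine Finsupp.lhom_ext' fun b => LinearMap.ext_ring ?_
    rcases b with i | j
    · simp [braidedSpace, actBasis]
    · simp [braidedSpace, actBasis, genL]
  exact LinearMap.congr_fun h v

/-- The algebra map `T(𝒱) # kΓ → L` with `x_j ↦ 0`, `y_j ↦ E_j`, `x_h ↦ v_h` and `γ ↦ 1`. -/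
def tensorProj : D.HopfT k →ₐ[k] D.HopfL k :=
  liftNCAlgHom ((D.braidedSpace k).tensorLift (Finsupp.linearCombination k (D.genL k))) 1
    (fun {u γ} => by
      have h : ((D.braidedSpace k).tensorLift (Finsupp.linearCombination k (D.genL k))).comp
          ((D.braidedSpace k).tensorAct γ) =
          (D.braidedSpace k).tensorLift (Finsupp.linearCombination k (D.genL k)) :=
        (D.braidedSpace k).tensor_hom_ext fun v => by
          have e : (D.braidedSpace k).tensorAct γ ((D.braidedSpace k).ι v) =
            (D.braidedSpace k).ι ((D.braidedSpace k).action γ v) := (D.braidedSpace k).smul_ι γ v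
          rw [AlgHom.comp_apply, e, tensorLift_ι, tensorLift_ι, linearCombination_genL_action]
      rw [MonoidHom.one_apply, mul_one, one_mul]
      exact DFunLike.congr_fun h u)

lemma tensorProj_gen (b : D.Basis) : D.tensorProj k (D.genT k b) = D.genL k b := by
  simp [tensorProj, liftNCAlgHom, liftNCRingHom]

lemma tensorProj_group (γ : D.Grp) : D.tensorProj k (single γ 1) = 1 := by
  simp [tensorProj, liftNCAlgHom, liftNCRingHom]

lemma comul_genT (b : D.Basis) : comul (R := k) (D.genT k b) =
    D.genT k b ⊗ₜ 1 + single ((D.braidedSpace k).deg b) 1 ⊗ₜ D.genT k b :=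
  (D.braidedSpace k).comul_single_gen b

lemma comul_genL (b : D.Basis) :
    comul (R := k) (D.genL k b) = D.genL k b ⊗ₜ 1 + 1 ⊗ₜ D.genL k b := by
  rcases b with (i | h) | j
  · simp [genL]
  · exact D.comul_vL k _
  · exact D.comul_eL k j

lemma counit_genL (b : D.Basis) : counit (R := k) (D.genL k b) = 0 := by
  rcases b with (i | h) | j
  · simp [genL]
  · exact D.counit_vL k _
  · exact D.counit_eL k j

lemma map_tensorProj_comul (a : D.HopfT k) :
    Algebra.TensorProduct.map (D.tensorProj k) (D.tensorProj k) (comul (R := k) a) =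
      comul (R := k) (D.tensorProj k a) := by
  have h : (Algebra.TensorProduct.map (D.tensorProj k) (D.tensorProj k)).comp
      (Bialgebra.comulAlgHom k _) = (Bialgebra.comulAlgHom k _).comp (D.tensorProj k) :=
    (D.braidedSpace k).algHom_ext_tensor
      (fun b => by
        rw [AlgHom.comp_apply, AlgHom.comp_apply, Bialgebra.comulAlgHom_apply,
          Bialgebra.comulAlgHom_apply, comul_genT, map_add, Algebra.TensorProduct.map_tmul,
          Algebra.TensorProduct.map_tmul, tensorProj_gen, tensorProj_group, map_one, comul_genL])
      (fun γ => by
        rw [AlgHom.comp_apply, AlgHom.comp_apply, Bialgebra.comulAlgHom_apply,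
          Bialgebra.comulAlgHom_apply, comul_single_one, Algebra.TensorProduct.map_tmul,
          tensorProj_group, Bialgebra.comul_one, Algebra.TensorProduct.one_def])
  exact DFunLike.congr_fun h a

lemma counit_tensorProj (a : D.HopfT k) :
    counit (R := k) (D.tensorProj k a) = counit (R := k) a := by
  have h : (Bialgebra.counitAlgHom k _).comp (D.tensorProj k) = Bialgebra.counitAlgHom k _ :=
    (D.braidedSpace k).algHom_ext_tensor
      (fun b => by
        rw [AlgHom.comp_apply, Bialgebra.counitAlgHom_apply, Bialgebra.counitAlgHom_apply,
          tensorProj_gen, counit_genL, counit_single_gen])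
      (fun γ => by
        rw [AlgHom.comp_apply, Bialgebra.counitAlgHom_apply, Bialgebra.counitAlgHom_apply,
          tensorProj_group, Bialgebra.counit_one, counit_single_one])
  exact DFunLike.congr_fun h a

/-- The coefficient of the basis element `b` of `𝒱`, as a functional on `T(𝒱) # kΓ`. -/
def coordT (b : D.Basis) : D.HopfT k →ₗ[k] k :=
  (D.braidedSpace k).smashFunctional ((D.braidedSpace k).degreeOne (Finsupp.lapply b)) fun _ => 1

/-- The functional `u # γ ↦ ε(u) shift_j(γ)` on `T(𝒱) # kΓ`. -/
def shiftT (j : Fin D.t) : D.HopfT k →ₗ[k] k :=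
  (D.braidedSpace k).smashFunctional (D.braidedSpace k).tensorData.counit.toLinearMap
    fun γ => D.shift k γ j

lemma coordT_one (b : D.Basis) : D.coordT k b 1 = 0 := by
  refine ((D.braidedSpace k).smashFunctional_single _ _ 1 1).trans ?_
  rw [degreeOne_one, mul_zero]

lemma shiftT_one (j : Fin D.t) : D.shiftT k j 1 = 0 := by
  refine ((D.braidedSpace k).smashFunctional_single _ _ 1 1).trans ?_
  rw [shift_one, zero_mul]

lemma coordT_comp_group (b : D.Basis) (γ : D.Grp) :
    D.coordT k b ∘ₗ LinearMap.mulRight k (single γ 1) = D.coordT k b :=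
  (D.braidedSpace k).smashFunctional_comp_mulRight_single_one _ _ γ

lemma shiftT_comp_group (j : Fin D.t) (γ : D.Grp) :
    D.shiftT k j ∘ₗ LinearMap.mulRight k (single γ 1) = D.shiftT k j + D.shift k γ j • counit := by
  refine ((D.braidedSpace k).smashFunctional_comp_mulRight_single_one _ _ γ).trans ?_
  simp only [shift_mul]
  rw [smashFunctional_add, ← smashFunctional_counit_one, ← smashFunctional_smul]
  simp only [mul_one]
  rfl

lemma shiftT_comp_gen (j : Fin D.t) (b : D.Basis) :
    D.shiftT k j ∘ₗ LinearMap.mulRight k (D.genT k b) = 0 :=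
  (D.braidedSpace k).counit_comp_mulRight_gen _ _

lemma coordT_comp_gen {b b' : D.Basis}
    (h : ∀ γ, D.actBasis k γ b' b = if b' = b then 1 else 0) :
    D.coordT k b ∘ₗ LinearMap.mulRight k (D.genT k b') =
      (if b' = b then 1 else 0 : k) • counit := by
  rw [← smashFunctional_counit_one, ← smashFunctional_smul]
  refine (D.braidedSpace k).degreeOne_comp_mulRight_gen fun γ => ?_
  rw [one_mul, mul_one, ← h γ]
  simp [braidedSpace]

lemma coordT_comp_genX (b : D.Basis) (i : D.Index) :
    D.coordT k b ∘ₗ LinearMap.mulRight k (D.genT k (Sum.inl i)) =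
      (if Sum.inl i = b then 1 else 0 : k) • counit :=
  D.coordT_comp_gen k fun γ => by simp [actBasis, Finsupp.single_apply]

lemma coordT_inr_comp_genY (i j : Fin D.t) :
    D.coordT k (Sum.inr j) ∘ₗ LinearMap.mulRight k (D.genT k (Sum.inr i)) =
      (if i = j then 1 else 0 : k) • counit := by
  refine (D.coordT_comp_gen k fun γ => ?_).trans ?_
  · simp [actBasis, Finsupp.single_apply]
  · simp

lemma coordT_point_comp_genY (h : Fin D.s) (i : Fin D.t) :
    D.coordT k (Sum.inl (Sum.inr h)) ∘ₗ LinearMap.mulRight k (D.genT k (Sum.inr i)) = 0 := by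
  refine (D.coordT_comp_gen k fun γ => ?_).trans ?_
  · simp [actBasis]
  · simp

/-- The coefficient of `x_j` in `γ • y_j` is the shift of `γ`. Thus stripping off a factor `y_j`
turns the coordinate of `x_j` into `shiftT`. -/
lemma coordT_block_comp_genY (i j : Fin D.t) :
    D.coordT k (Sum.inl (Sum.inl j)) ∘ₗ LinearMap.mulRight k (D.genT k (Sum.inr i)) =
      (if i = j then 1 else 0 : k) • D.shiftT k j := by
  rw [shiftT, ← smashFunctional_smul]
  refine (D.braidedSpace k).degreeOne_comp_mulRight_gen fun γ => ?_
  rcases eq_or_ne i j with rfl | hij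
  · simp [braidedSpace, actBasis]
  · simp [braidedSpace, actBasis, hij]

/-- The functional `psi` on `L`, regarded as a functional on `T(𝒱) # kΓ`. -/
def psiT (f : D.VG k →ₗ[k] k) : D.HopfT k →ₗ[k] k := D.psi k f ∘ₗ (D.tensorProj k).toLinearMap

lemma psiT_one (f : D.VG k →ₗ[k] k) : D.psiT k f 1 = 0 := by
  simp [psiT, psi_one]

lemma psiT_comp_group (f : D.VG k →ₗ[k] k) (γ : D.Grp) :
    D.psiT k f ∘ₗ LinearMap.mulRight k (single γ 1) = D.psiT k f := by
  refine LinearMap.ext fun a => ?_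
  simp [psiT, tensorProj_group]

lemma psiT_comp_genX_block (f : D.VG k →ₗ[k] k) (j : Fin D.t) :
    D.psiT k f ∘ₗ LinearMap.mulRight k (D.genT k (Sum.inl (Sum.inl j))) = 0 := by
  refine LinearMap.ext fun a => ?_
  rw [LinearMap.comp_apply, LinearMap.mulRight_apply, psiT, LinearMap.comp_apply,
    AlgHom.toLinearMap_apply, map_mul, tensorProj_gen]
  simp [genL]

lemma psiT_comp_genX_point (f : D.VG k →ₗ[k] k) (h : Fin D.s) :
    D.psiT k f ∘ₗ LinearMap.mulRight k (D.genT k (Sum.inl (Sum.inr h))) =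
      -(f (Finsupp.single ⟨h, 0⟩ 1) • counit) := by
  refine LinearMap.ext fun a => ?_
  rw [LinearMap.comp_apply, LinearMap.mulRight_apply, psiT, LinearMap.comp_apply,
    AlgHom.toLinearMap_apply, map_mul, tensorProj_gen]
  refine (D.psi_mul_vL k f _ _).trans ?_
  rw [counit_tensorProj]
  rfl

lemma psiT_comp_genY (f : D.VG k →ₗ[k] k) (j : Fin D.t) :
    D.psiT k f ∘ₗ LinearMap.mulRight k (D.genT k (Sum.inr j)) =
      -D.psiT k (f ∘ₗ D.raise k j) := by
  refine LinearMap.ext fun a => ?_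
  rw [LinearMap.comp_apply, LinearMap.mulRight_apply, psiT, LinearMap.comp_apply,
    AlgHom.toLinearMap_apply, map_mul, tensorProj_gen]
  exact D.psi_mul_eL k f _ j

lemma psiT_add (f f' : D.VG k →ₗ[k] k) : D.psiT k (f + f') = D.psiT k f + D.psiT k f' := rfl

lemma psiT_smul (c : k) (f : D.VG k →ₗ[k] k) : D.psiT k (c • f) = c • D.psiT k f := rfl

lemma psiT_zero : D.psiT k 0 = 0 := rfl

lemma dualConv_mul_group (ξ η : D.HopfT k →ₗ[k] k) (a : D.HopfT k) (γ : D.Grp) :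
    dualConv ξ η (a * single γ 1) = dualConv (ξ ∘ₗ LinearMap.mulRight k (single γ 1))
      (η ∘ₗ LinearMap.mulRight k (single γ 1)) a :=
  dualConv_mul_of_groupLike ξ η ((D.braidedSpace k).comul_single_one γ) a

lemma dualConv_mul_gen (ξ η : D.HopfT k →ₗ[k] k) (a : D.HopfT k) (b : D.Basis) :
    dualConv ξ η (a * D.genT k b) = dualConv (ξ ∘ₗ LinearMap.mulRight k (D.genT k b)) η a +
      dualConv (ξ ∘ₗ LinearMap.mulRight k (single ((D.braidedSpace k).deg b) 1))
        (η ∘ₗ LinearMap.mulRight k (D.genT k b)) a :=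
  dualConv_mul_of_skewPrimitive ξ η (D.comul_genT k b) a

lemma apply_mul (ξ : D.HopfT k →ₗ[k] k) (a b : D.HopfT k) :
    ξ (a * b) = (ξ ∘ₗ LinearMap.mulRight k b) a := rfl

lemma weightOp_single_zero (h2 : p ≠ 2) (h : Fin D.s) (j : Fin D.t) :
    D.weightOp k j (Finsupp.single ⟨h, 0⟩ 1) =
      ZMod.castHom (dvd_refl p) k (D.a h j) • Finsupp.single ⟨h, 0⟩ 1 := by
  rw [weightOp_single, D.castHom_a k h2]
  simp

lemma lower_single_zero (h : Fin D.s) (j : Fin D.t) :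
    D.lower k j (Finsupp.single ⟨h, 0⟩ 1) = 0 := by
  rw [lower_single]
  simp

/-- Both sides obey the same rules under right translation by generators: at `x_h` this is the value
`a_hj` of the weight operator on `v_h`, and at `y_i` it is `weightOp_comp_raise`. The lemma serves
the `y` case of `coordT_commutator`. -/
lemma shiftT_commutator (h2 : p ≠ 2) (j : Fin D.t) (f : D.VG k →ₗ[k] k) :
    dualConv (D.shiftT k j) (D.psiT k f) - dualConv (D.psiT k f) (D.shiftT k j) =
      D.psiT k (f ∘ₗ D.weightOp k j) := by
  rw [← sub_eq_zero]
  refine (D.braidedSpace k).forall_eq_zero_of_mul (ζ := fun f =>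
    dualConv (D.shiftT k j) (D.psiT k f) - dualConv (D.psiT k f) (D.shiftT k j) -
      D.psiT k (f ∘ₗ D.weightOp k j)) (fun f => ?_) (fun a ha f b => ?_) (fun a ha f γ => ?_) f
  · simp [dualConv_one, psiT_one, shiftT_one]
  · rcases b with (i | h) | i
    · simp only [LinearMap.sub_apply, dualConv_mul_gen, D.apply_mul k (D.psiT k _) a,
        shiftT_comp_gen,
        psiT_comp_genX_block, dualConv_zero_left, dualConv_zero_right, LinearMap.zero_apply]
      simp
    · simp only [LinearMap.sub_apply, dualConv_mul_gen, D.apply_mul k (D.psiT k _) a,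
        shiftT_comp_gen,
        psiT_comp_genX_point, psiT_comp_group, shiftT_comp_group, dualConv_zero_left,
        dualConv_zero_right, dualConv_neg_left, dualConv_neg_right, dualConv_smul_left,
        dualConv_smul_right, dualConv_counit_left, dualConv_counit_right, LinearMap.zero_apply,
        LinearMap.neg_apply, LinearMap.smul_apply, LinearMap.add_apply, LinearMap.comp_apply,
        D.weightOp_single_zero k h2, map_smul, smul_eq_mul]
      rw [show (D.braidedSpace k).deg (Sum.inl (Sum.inr h)) = D.grp (Sum.inr h) from rfl,
        shift_grp_point]
      ring
    · have h1 := ha (f ∘ₗ D.raise k i)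
      rw [LinearMap.comp_assoc, LinearMap.sub_apply, LinearMap.sub_apply] at h1
      simp only [LinearMap.sub_apply, dualConv_mul_gen, D.apply_mul k (D.psiT k _) a,
        shiftT_comp_gen,
        psiT_comp_genY, psiT_comp_group, shiftT_comp_group, dualConv_zero_left,
        dualConv_zero_right, dualConv_neg_left, dualConv_neg_right, dualConv_smul_left,
        dualConv_add_left, dualConv_counit_left, LinearMap.zero_apply,
        LinearMap.neg_apply, LinearMap.smul_apply, LinearMap.add_apply, smul_eq_mul]
      rw [LinearMap.comp_assoc, weightOp_comp_raise, LinearMap.comp_add, LinearMap.comp_smul,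
        psiT_add, psiT_smul, LinearMap.add_apply, LinearMap.smul_apply, smul_eq_mul,
        show (D.braidedSpace k).deg (Sum.inr i) = D.grp (Sum.inl i) from rfl, shift_grp_block]
      linear_combination -h1
  · have h1 := ha f
    rw [LinearMap.sub_apply, LinearMap.sub_apply] at h1
    simp only [LinearMap.sub_apply, dualConv_mul_group, D.apply_mul k (D.psiT k _) a,
      psiT_comp_group,
      shiftT_comp_group, dualConv_smul_left, dualConv_smul_right, dualConv_add_left,
      dualConv_add_right, dualConv_counit_left, dualConv_counit_right, LinearMap.smul_apply,
      LinearMap.add_apply, smul_eq_mul]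
    linear_combination h1

/-- Translation by `y_i` produces `shiftT_commutator` when `i = j`, and this term is matched by the
weight operator in `raise_comp_lower`. At `x_h` both sides vanish, since `lower` kills `v_h`. -/
lemma coordT_commutator (h2 : p ≠ 2) (j : Fin D.t) (f : D.VG k →ₗ[k] k) :
    dualConv (D.coordT k (Sum.inl (Sum.inl j))) (D.psiT k f) -
      dualConv (D.psiT k f) (D.coordT k (Sum.inl (Sum.inl j))) = D.psiT k (f ∘ₗ D.lower k j) := by
  rw [← sub_eq_zero]
  refine (D.braidedSpace k).forall_eq_zero_of_mul (ζ := fun f =>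
    dualConv (D.coordT k (Sum.inl (Sum.inl j))) (D.psiT k f) -
      dualConv (D.psiT k f) (D.coordT k (Sum.inl (Sum.inl j))) - D.psiT k (f ∘ₗ D.lower k j))
    (fun f => ?_) (fun a ha f b => ?_) (fun a ha f γ => ?_) f
  · simp [dualConv_one, psiT_one, coordT_one]
  · rcases b with (i | h) | i
    · simp only [LinearMap.sub_apply, dualConv_mul_gen, D.apply_mul k (D.psiT k _) a,
        coordT_comp_genX,
        psiT_comp_genX_block, psiT_comp_group, dualConv_zero_left, dualConv_zero_right,
        dualConv_smul_left, dualConv_smul_right, dualConv_counit_left, dualConv_counit_right,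
        LinearMap.zero_apply, LinearMap.smul_apply]
      ring
    · simp only [LinearMap.sub_apply, dualConv_mul_gen, D.apply_mul k (D.psiT k _) a,
        coordT_comp_genX,
        psiT_comp_genX_point, psiT_comp_group, coordT_comp_group,
        dualConv_neg_left, dualConv_neg_right, dualConv_smul_left,
        dualConv_smul_right, dualConv_counit_left, dualConv_counit_right,
        LinearMap.neg_apply, LinearMap.smul_apply, LinearMap.comp_apply,
        D.lower_single_zero k, map_zero, smul_eq_mul]
      ring
    · have h1 := ha (f ∘ₗ D.raise k i)
      have h3 := LinearMap.congr_fun (D.shiftT_commutator k h2 j f) a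
      rw [LinearMap.comp_assoc, D.raise_comp_lower k (two_ne_zero_of_char k h2), LinearMap.comp_add,
        LinearMap.comp_smul, psiT_add, psiT_smul, LinearMap.sub_apply, LinearMap.sub_apply,
        LinearMap.add_apply, LinearMap.smul_apply, smul_eq_mul] at h1
      rw [LinearMap.sub_apply] at h3
      simp only [LinearMap.sub_apply, dualConv_mul_gen, D.apply_mul k (D.psiT k _) a,
        coordT_block_comp_genY,
        psiT_comp_genY, psiT_comp_group, coordT_comp_group,
        dualConv_neg_left, dualConv_neg_right, dualConv_smul_left, dualConv_smul_right,
        LinearMap.neg_apply, LinearMap.smul_apply, smul_eq_mul, LinearMap.comp_assoc]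
      linear_combination -h1 + (if i = j then 1 else 0 : k) * h3
  · have h1 := ha f
    rw [LinearMap.sub_apply, LinearMap.sub_apply] at h1
    simp only [LinearMap.sub_apply, dualConv_mul_group, D.apply_mul k (D.psiT k _) a,
      psiT_comp_group,
      coordT_comp_group]
    exact h1

/-- No raising operator reaches `v_{h,0}`, so a factor `y_i` on the right contributes zero and the
functional sees only `x_h`. The sign is that of the right action defining `psi`. -/
lemma psiT_lapply_zero (h : Fin D.s) :
    D.psiT k (Finsupp.lapply ⟨h, 0⟩) = -D.coordT k (Sum.inl (Sum.inr h)) := by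
  rw [← sub_eq_zero]
  refine (D.braidedSpace k).forall_eq_zero_of_mul (F := Unit) (ζ := fun _ =>
    D.psiT k (Finsupp.lapply ⟨h, 0⟩) - -D.coordT k (Sum.inl (Sum.inr h)))
    (fun _ => ?_) (fun a ha _ b => ?_) (fun a ha _ γ => ?_) ()
  · simp [psiT_one, coordT_one]
  · rcases b with (i | h') | i
    · simp only [LinearMap.sub_apply, LinearMap.neg_apply, D.apply_mul k (D.psiT k _) a,
        D.apply_mul k (D.coordT k _) a, coordT_comp_genX,
        psiT_comp_genX_block]
      simp
    · simp only [LinearMap.sub_apply, LinearMap.neg_apply, D.apply_mul k (D.psiT k _) a,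
        D.apply_mul k (D.coordT k _) a, coordT_comp_genX,
        psiT_comp_genX_point]
      rcases eq_or_ne h h' with rfl | hh
      · simp
      · simp [hh, hh.symm]
    · simp only [LinearMap.sub_apply, LinearMap.neg_apply, D.apply_mul k (D.psiT k _) a,
        D.apply_mul k (D.coordT k _) a,
        coordT_point_comp_genY, psiT_comp_genY, lapply_zero_comp_raise, psiT_zero]
      simp
  · have h1 := ha ()
    simp only [LinearMap.sub_apply, LinearMap.neg_apply, D.apply_mul k (D.psiT k _) a,
      D.apply_mul k (D.coordT k _) a, coordT_comp_group,
      psiT_comp_group] at h1 ⊢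
    exact h1

/-- This exhibits the coordinate of `E_j` on `L` as one that descends, since its pull back has
degree one. -/
lemma coordE_comp_tensorProj (j : Fin D.t) :
    D.coordE k j ∘ₗ (D.tensorProj k).toLinearMap = D.coordT k (Sum.inr j) := by
  rw [← sub_eq_zero]
  refine (D.braidedSpace k).forall_eq_zero_of_mul (F := Unit) (ζ := fun _ =>
    D.coordE k j ∘ₗ (D.tensorProj k).toLinearMap - D.coordT k (Sum.inr j))
    (fun _ => ?_) (fun a ha _ b => ?_) (fun a ha _ γ => ?_) ()
  · simp [coordE_one, coordT_one]
  · rw [LinearMap.sub_apply, LinearMap.comp_apply, AlgHom.toLinearMap_apply, map_mul,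
      tensorProj_gen, D.apply_mul k (D.coordT k _)]
    rcases b with (i | h') | i
    · rw [coordT_comp_genX]
      simp [genL]
    · have h1 := LinearMap.congr_fun
        (D.coordE_comp_mulRight_vL k j (Finsupp.single ⟨h', 0⟩ 1)) (D.tensorProj k a)
      rw [coordT_comp_genX]
      rw [LinearMap.comp_apply, LinearMap.mulRight_apply] at h1
      simp [genL, h1]
    · have h1 := LinearMap.congr_fun (D.coordE_comp_mulRight_eL k i j) (D.tensorProj k a)
      rw [LinearMap.comp_apply, LinearMap.mulRight_apply, LinearMap.smul_apply,
        counit_tensorProj] at h1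
      rw [coordT_inr_comp_genY, genL, h1, LinearMap.smul_apply, sub_self]
  · have h1 := ha ()
    rw [LinearMap.sub_apply, LinearMap.comp_apply, AlgHom.toLinearMap_apply] at h1 ⊢
    rw [map_mul, tensorProj_group, mul_one, D.apply_mul k (D.coordT k _), coordT_comp_group]
    exact h1

lemma sum_lowerWeight (j : Fin D.t) {w : D.Weight} (hj : (w.2 j : ℕ) ≠ 0) :
    ∑ i, ((D.lowerWeight j w).2 i : ℕ) + 1 = ∑ i, (w.2 i : ℕ) := by
  rw [← Finset.add_sum_erase Finset.univ (fun i => (w.2 i : ℕ)) (Finset.mem_univ j),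
    ← Finset.add_sum_erase Finset.univ (fun i => ((D.lowerWeight j w).2 i : ℕ)) (Finset.mem_univ j),
    Finset.sum_congr rfl fun i hi => by rw [lowerWeight_of_ne _ (Finset.ne_of_mem_erase hi)],
    lowerWeight_self]
  omega

lemma descends_coordT (b : D.Basis) : (D.braidedSpace k).Descends (D.coordT k b) :=
  (D.braidedSpace k).descends_degreeOne _ _

/-- Induction on the sum of the exponents, by solving `coordT_commutator` for the functional at `w`.
The scalar `m_j (𝒢_hj + 1 - m_j) / 2` is invertible because both factors in the numerator lie
strictly between `0` and `p`. -/
lemma descends_psiT_lapply (h2 : p ≠ 2) (w : D.Weight) :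
    (D.braidedSpace k).Descends (D.psiT k (Finsupp.lapply w)) := by
  induction hn : ∑ j, (w.2 j : ℕ) generalizing w with
  | zero =>
    obtain ⟨h, m⟩ := w
    have hm : m = 0 := by
      funext j
      exact Fin.ext ((Finset.sum_eq_zero_iff.1 hn) j (Finset.mem_univ j))
    rw [hm, psiT_lapply_zero, ← neg_one_smul k]
    exact (D.descends_coordT k _).smul _
  | succ n ih =>
    obtain ⟨j, hj⟩ : ∃ j, (w.2 j : ℕ) ≠ 0 := by
      by_contra! h0
      rw [Finset.sum_eq_zero fun j _ => h0 j] at hn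
      omega
    have hd := ih (D.lowerWeight j w) (by
      have := D.sum_lowerWeight j hj
      omega)
    have hc : ((w.2 j : ℕ) * ((D.ghost w.1 j : k) + 1 - (w.2 j : ℕ)) / 2) ≠ 0 := by
      have hlt := (w.2 j).2
      have hg := D.ghost_lt w.1 j
      have hcast {n : ℕ} (h0 : n ≠ 0) (h1 : n < p) : (n : k) ≠ 0 := fun h =>
        absurd (Nat.le_of_dvd (Nat.pos_of_ne_zero h0) ((CharP.cast_eq_zero_iff k p n).1 h))
          (by omega)
      refine div_ne_zero (mul_ne_zero (hcast hj (by omega)) ?_) (two_ne_zero_of_char k h2)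
      have := hcast (n := D.ghost w.1 j + 1 - w.2 j) (by omega) (by omega)
      rwa [Nat.cast_sub (by omega), Nat.cast_add, Nat.cast_one] at this
    have e := D.coordT_commutator k h2 j (Finsupp.lapply (D.lowerWeight j w))
    rw [D.lapply_lowerWeight_comp_lower k j hj, psiT_smul] at e
    rw [← inv_smul_smul₀ hc (D.psiT k (Finsupp.lapply w)), ← e]
    exact (((D.descends_coordT k _).dualConv hd).sub (hd.dualConv (D.descends_coordT k _))).smul _

end Projection

end BlockPointDatum

/-! ### Algebra maps induced on a surjective image. -/

section Descend

variable {k A B C : Type*} [Field k] [Ring A] [Ring B] [Ring C] [Algebra k A] [Algebra k B]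
  [Algebra k C]

/-- The algebra map `B → C` that is induced by an algebra map `g : A → C` whose kernel contains the
kernel of a surjective algebra map `f : A → B`. -/
def AlgHom.descend (g : A →ₐ[k] C) {f : A →ₐ[k] B} (hf : Function.Surjective f)
    (h : ∀ a, f a = 0 → g a = 0) : B →ₐ[k] C :=
  { RingHom.liftOfSurjective (f : A →+* B) hf ⟨(g : A →+* C), fun a ha => h a ha⟩ with
    commutes' := fun r => by
      have e := RingHom.liftOfRightInverse_comp_apply (f : A →+* B) (Function.surjInv hf)
        (Function.rightInverse_surjInv hf) ⟨(g : A →+* C), fun a ha => h a ha⟩ (algebraMap k A r)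
      rw [RingHom.coe_coe, AlgHom.commutes] at e
      exact e.trans (g.commutes r) }

lemma AlgHom.descend_apply (g : A →ₐ[k] C) {f : A →ₐ[k] B} (hf : Function.Surjective f)
    (h : ∀ a, f a = 0 → g a = 0) (a : A) : g.descend hf h (f a) = g a :=
  RingHom.liftOfRightInverse_comp_apply (f : A →+* B) (Function.surjInv hf)
    (Function.rightInverse_surjInv hf) ⟨(g : A →+* C), fun a ha => h a ha⟩ a

end Descend

/-! ### Monomials in `L`, and the projection `H → L`. -/

namespace BlockPointDatum

open Coalgebra YetterDrinfeld SkewMonoidAlgebra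

attribute [local instance] LieRing.ofAssociativeRing

section Projection

variable {p : ℕ} [hp : Fact p.Prime] (D : BlockPointDatum p) (k : Type*) [Field k] [CharP k p]

/-- The span of the ordered monomials in the elements `E_j` of `L`. -/
def spanE : Submodule k (D.HopfL k) :=
  (Submodule.span k {1}).monomialSpan p (D.eL k) Finset.univ.toList

/-- The span of the ordered monomials in the elements `E_j` and `v_{h, m}` of `L`. -/
def spanEV : Submodule k (D.HopfL k) :=
  (D.spanE k).monomialSpan p (fun w : D.Weight => D.vL k (Finsupp.single w 1)) Finset.univ.toList

lemma spanE_mul_mem (j : Fin D.t) : ∀ z ∈ D.spanE k, z * D.eL k j ∈ D.spanE k :=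
  Submodule.monomialSpan_mul_mem (D.commute_eL k) (D.eL_pow k) _ j (by simp)

lemma spanEV_mul_mem (u : D.VG k) : ∀ z ∈ D.spanEV k, z * D.vL k u ∈ D.spanEV k := by
  intro z hz
  have h : Submodule.span k (Set.range fun w : D.Weight => D.vL k (Finsupp.single w 1)) ≤
      (D.spanEV k).comap (LinearMap.mulLeft k z) := by
    rw [Submodule.span_le]
    rintro _ ⟨w, rfl⟩
    exact Submodule.monomialSpan_mul_mem (u := fun w : D.Weight => D.vL k (Finsupp.single w 1))
      (fun _ _ => D.commute_vL k _ _) (fun _ => D.vL_pow k _) _ w (by simp) z hz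
  exact h (D.vL_mem_span k u)

lemma spanE_le_spanEV : D.spanE k ≤ D.spanEV k := Submodule.le_monomialSpan hp.out.ne_zero _

/-- Only the spanning half of a Poincaré-Birkhoff-Witt theorem is needed. A factor `E_j` on the
right is moved past the `v` by the commutation rule `eL_mul_vL`. -/
lemma spanEV_eq_top : D.spanEV k = ⊤ := by
  refine D.eq_top_of_mul_mem_L k ?_ (fun a ha j => ?_) fun a ha u => D.spanEV_mul_mem k u a ha
  · exact D.spanE_le_spanEV k
      (Submodule.le_monomialSpan hp.out.ne_zero _ (Submodule.mem_span_singleton_self 1))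
  · have h : D.spanEV k ≤ D.spanEV k ⊓ (D.spanEV k).comap (LinearMap.mulRight k (D.eL k j)) := by
      refine Submodule.monomialSpan_le (le_inf (D.spanE_le_spanEV k) fun b hb => ?_) ?_ _
      · exact D.spanE_le_spanEV k (D.spanE_mul_mem k j b hb)
      · rintro w z ⟨hz, hz'⟩
        refine ⟨D.spanEV_mul_mem k _ z hz, ?_⟩
        have e : z * D.vL k (Finsupp.single w 1) * D.eL k j =
            z * D.eL k j * D.vL k (Finsupp.single w 1) -
              z * D.vL k (D.raise k j (Finsupp.single w 1)) := by
          rw [mul_assoc, mul_assoc, eL_mul_vL, mul_add, add_sub_cancel_right]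
        refine Submodule.mem_comap.2 ?_
        rw [LinearMap.mulRight_apply, e]
        exact sub_mem (D.spanEV_mul_mem k _ _ hz') (D.spanEV_mul_mem k _ z hz)
    exact (h ha).2

/-- All `f` are treated at once, because a factor `E_j` replaces `f` by `f ∘ raise`. This makes
monomials in the `E_j` constants for the second peeling. -/
lemma leftContract_psi_of_mem_spanE (f : D.VG k →ₗ[k] k) {b : D.HopfL k} (hb : b ∈ D.spanE k) :
    leftContract (D.psi k f) b = 0 := by
  have h : D.spanE k ≤ ⨅ f, LinearMap.ker (leftContract (D.psi k f)) := by
    refine Submodule.monomialSpan_le ?_ (fun j z hz => ?_) _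
    · rw [Submodule.span_singleton_le_iff_mem]
      simp [Submodule.mem_iInf, leftContract_one, psi_one]
    · simp only [Submodule.mem_iInf, LinearMap.mem_ker] at hz ⊢
      intro f
      rw [leftContract_mul_of_primitive _ (D.comul_eL k j), hz, psi_comp_mulRight_eL,
        leftContract_neg, LinearMap.neg_apply, hz]
      simp
  exact (Submodule.mem_iInf _).1 (h hb) f

/-- The orthogonal in `L` of the functionals that descend to the bosonization. -/
def descentOrthogonal : Submodule k (D.HopfL k) :=
  ⨅ ξ : {ξ : D.HopfL k →ₗ[k] k //
    (D.braidedSpace k).Descends (ξ ∘ₗ (D.tensorProj k).toLinearMap)}, LinearMap.ker ξ.1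

lemma mem_descentOrthogonal {z : D.HopfL k} : z ∈ D.descentOrthogonal k ↔
    ∀ ξ : D.HopfL k →ₗ[k] k,
      (D.braidedSpace k).Descends (ξ ∘ₗ (D.tensorProj k).toLinearMap) → ξ z = 0 := by
  simp [descentOrthogonal, Submodule.mem_iInf]

/-- Pairing a contraction with `η` is pairing the element with a convolution, and functionals that
descend are closed under convolution. -/
lemma leftContract_mem_descentOrthogonal {ξ : D.HopfL k →ₗ[k] k}
    (hξ : (D.braidedSpace k).Descends (ξ ∘ₗ (D.tensorProj k).toLinearMap)) {z : D.HopfL k}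
    (hz : z ∈ D.descentOrthogonal k) : leftContract ξ z ∈ D.descentOrthogonal k := by
  rw [mem_descentOrthogonal] at hz ⊢
  intro η hη
  rw [apply_leftContract]
  refine hz _ ?_
  rw [dualConv_comp ξ η (D.map_tensorProj_comul k)]
  exact hξ.dualConv hη

/-- The counit excludes nonzero scalars, the coordinates of the `E_j` peel off the `E_j`, and the
functionals `psi` peel off the `v_{h,m}`. The monomials exhaust `L`, so nothing is left. -/
lemma descentOrthogonal_eq_bot (h2 : p ≠ 2) : D.descentOrthogonal k = ⊥ := by
  have h0 : D.descentOrthogonal k ⊓ Submodule.span k {1} = ⊥ := by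
    rw [eq_bot_iff]
    rintro z ⟨hz, hz'⟩
    obtain ⟨c, rfl⟩ := Submodule.mem_span_singleton.1 hz'
    have := (D.mem_descentOrthogonal k).1 hz counit (by
      have e : counit (R := k) (A := D.HopfL k) ∘ₗ (D.tensorProj k).toLinearMap = counit :=
        LinearMap.ext (D.counit_tensorProj k)
      rw [e]
      exact (D.braidedSpace k).descends_counit)
    rw [map_smul, Bialgebra.counit_one, smul_eq_mul, mul_one] at this
    simp [this]
  have h1 : D.descentOrthogonal k ⊓ D.spanE k = ⊥ :=
    Submodule.inf_monomialSpan_eq_bot (δ := fun j => leftContract (D.coordE k j)) one_ne_zero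
      (fun i j b => by
        rw [leftContract_mul_of_primitive _ (D.comul_eL k j), coordE_comp_mulRight_eL, add_comm,
          leftContract_smul, leftContract_counit]
        rcases eq_or_ne i j with rfl | hij
        · simp
        · simp [hij, hij.symm])
      (fun i b hb => by
        obtain ⟨c, rfl⟩ := Submodule.mem_span_singleton.1 hb
        rw [map_smul, leftContract_one, coordE_one, zero_smul, smul_zero])
      (fun i x hx => D.leftContract_mem_descentOrthogonal k (by
        rw [coordE_comp_tensorProj]
        exact D.descends_coordT k _) hx)
      h0 (Finset.nodup_toList _)
  -- The constant is `-1` because right translation by `v` turns `psi` into minus a multiple of the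
  -- counit.
  have h3 : D.descentOrthogonal k ⊓ D.spanEV k = ⊥ :=
    Submodule.inf_monomialSpan_eq_bot (c := -1)
      (δ := fun w => leftContract (D.psi k (Finsupp.lapply w))) (neg_ne_zero.2 one_ne_zero)
      (fun i j b => by
        rw [leftContract_mul_of_primitive _ (D.comul_vL k _), psi_comp_mulRight_vL, add_comm,
          leftContract_neg, leftContract_smul, leftContract_counit]
        rcases eq_or_ne i j with rfl | hij
        · simp
        · simp [hij])
      (fun i b hb => D.leftContract_psi_of_mem_spanE k _ hb)
      (fun i x hx => D.leftContract_mem_descentOrthogonal k (D.descends_psiT_lapply k h2 i) hx)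
      h1 (Finset.nodup_toList _)
  rwa [spanEV_eq_top, inf_top_eq] at h3

/-- Every functional that descends kills the image in `L` of an element of the kernel, and these
functionals separate the elements of `L`. -/
lemma tensorProj_eq_zero (h2 : p ≠ 2) {a : D.HopfT k} (ha : (D.braidedSpace k).bosonMk a = 0) :
    D.tensorProj k a = 0 := by
  rw [← Submodule.mem_bot k, ← D.descentOrthogonal_eq_bot k h2, mem_descentOrthogonal]
  exact fun ξ hξ => hξ.apply_eq_zero ha

/-- The algebra map underlying `π : H → L`. -/
def projAlgHom (h2 : p ≠ 2) : D.HopfH k →ₐ[k] D.HopfL k :=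
  (D.tensorProj k).descend (D.braidedSpace k).bosonMk_surjective
    fun _ ha => D.tensorProj_eq_zero k h2 ha

lemma projAlgHom_bosonMk (h2 : p ≠ 2) (a : D.HopfT k) :
    D.projAlgHom k h2 ((D.braidedSpace k).bosonMk a) = D.tensorProj k a :=
  AlgHom.descend_apply _ _ _ a

lemma projAlgHom_gen (h2 : p ≠ 2) (b : D.Basis) :
    D.projAlgHom k h2 ((D.braidedSpace k).bosonGen b) = D.genL k b := by
  rw [← bosonMk_gen, projAlgHom_bosonMk, tensorProj_gen]

lemma projAlgHom_group (h2 : p ≠ 2) (γ : D.Grp) :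
    D.projAlgHom k h2 ((D.braidedSpace k).bosonGroup γ) = 1 := by
  rw [← bosonMk_group, projAlgHom_bosonMk, tensorProj_group]

/-- The Hopf algebra map `π : H → L`. -/
def proj (h2 : p ≠ 2) : D.HopfH k →ₐc[k] D.HopfL k :=
  BialgHom.ofAlgHom (D.projAlgHom k h2)
    ((D.braidedSpace k).algHom_ext_boson
      (fun b => by
        rw [AlgHom.comp_apply, projAlgHom_gen]
        exact (D.counit_genL k b).trans ((D.braidedSpace k).counit_bosonGen b).symm)
      (fun γ => by
        rw [AlgHom.comp_apply, projAlgHom_group, map_one]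
        exact ((D.braidedSpace k).counit_bosonGroup γ).symm))
    ((D.braidedSpace k).algHom_ext_boson
      (fun b => by
        rw [AlgHom.comp_apply, AlgHom.comp_apply, projAlgHom_gen, Bialgebra.comulAlgHom_apply,
          Bialgebra.comulAlgHom_apply, comul_bosonGen, comul_genL, map_add,
          Algebra.TensorProduct.map_tmul, Algebra.TensorProduct.map_tmul, projAlgHom_gen,
          projAlgHom_group, map_one])
      (fun γ => by
        rw [AlgHom.comp_apply, AlgHom.comp_apply, projAlgHom_group, Bialgebra.comulAlgHom_apply,
          Bialgebra.comulAlgHom_apply, comul_bosonGroup, Bialgebra.comul_one,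
          Algebra.TensorProduct.map_tmul, projAlgHom_group, Algebra.TensorProduct.one_def]))

lemma proj_gen (h2 : p ≠ 2) (b : D.Basis) :
    D.proj k h2 ((D.braidedSpace k).bosonGen b) = D.genL k b := D.projAlgHom_gen k h2 b

lemma proj_group (h2 : p ≠ 2) (γ : D.Grp) :
    D.proj k h2 ((D.braidedSpace k).bosonGroup γ) = 1 := D.projAlgHom_group k h2 γ

end Projection

end BlockPointDatum

/-! ### Exactness and splitting from a colinear algebra section. -/

section CleftExtension

open Coalgebra

variable {k A C B : Type*} [Field k] [Ring A] [HopfAlgebra k A] [Ring C] [HopfAlgebra k C]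
  [Ring B] [HopfAlgebra k B]

/-- `s` is a colinear algebra section of the Hopf algebra map `π`, and `C` is the product of the
images of `s` and of the injective Hopf algebra map `ι` with `π ι = ε`. -/
structure IsColinearSection (ι : A →ₐc[k] C) (π : C →ₐc[k] B) (s : B →ₐ[k] C) : Prop where
  injective : Function.Injective ι
  proj_incl : ∀ a, π (ι a) = algebraMap k B (counit a)
  proj_section : ∀ b, π (s b) = b
  colinear : ∀ b, LinearMap.lTensor C (π : C →ₗ[k] B) (comul (R := k) (s b)) =
    LinearMap.rTensor B s.toLinearMap (comul (R := k) b)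
  span_incl_mul : Submodule.span k (Set.range fun z : A × B => ι z.1 * s z.2) = ⊤
  span_mul_incl : Submodule.span k (Set.range fun z : A × B => s z.2 * ι z.1) = ⊤

lemma lTensor_comul_mul (π : C →ₐc[k] B) (c d : C) :
    LinearMap.lTensor C (π : C →ₗ[k] B) (comul (R := k) (c * d)) =
      LinearMap.lTensor C (π : C →ₗ[k] B) (comul (R := k) c) *
        LinearMap.lTensor C (π : C →ₗ[k] B) (comul (R := k) d) := by
  rw [Bialgebra.comul_mul]
  exact map_mul (Algebra.TensorProduct.map (AlgHom.id k C) (π : C →ₐ[k] B)) _ _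

/-- The map `c ↦ c₁ s(S(π(c₂)))`. -/
def colinearRetract (π : C →ₐc[k] B) (s : B →ₐ[k] C) : C →ₗ[k] C :=
  LinearMap.mul' k C ∘ₗ (s.toLinearMap ∘ₗ HopfAlgebra.antipode k).lTensor C ∘ₗ
    (π : C →ₗ[k] B).lTensor C ∘ₗ comul

namespace IsColinearSection

variable {ι : A →ₐc[k] C} {π : C →ₐc[k] B} {s : B →ₐ[k] C}

lemma lTensor_comul_incl (hs : IsColinearSection ι π s) (a : A) :
    LinearMap.lTensor C (π : C →ₗ[k] B) (comul (R := k) (ι a)) = ι a ⊗ₜ 1 := by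
  have h (z : A ⊗[k] A) : LinearMap.lTensor C (π : C →ₗ[k] B)
      (TensorProduct.map (ι : A →ₗ[k] C) (ι : A →ₗ[k] C) z) =
        TensorProduct.map (ι : A →ₗ[k] C) (Algebra.linearMap k B)
          (counit.lTensor A z) := by
    induction z with
    | zero => simp
    | add x y hx hy => simp only [map_add, hx, hy]
    | tmul a b => simp [hs.proj_incl]
  rw [← CoalgHomClass.map_comp_comul_apply ι a]
  refine (h _).trans ?_
  rw [lTensor_counit_comul]
  simp

lemma lTensor_comul_mul_section (hs : IsColinearSection ι π s) (a : A) (b : B) :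
    LinearMap.lTensor C (π : C →ₗ[k] B) (comul (R := k) (ι a * s b)) =
      ι a ⊗ₜ 1 * LinearMap.rTensor B s.toLinearMap (comul (R := k) b) := by
  rw [lTensor_comul_mul, hs.lTensor_comul_incl, hs.colinear]

/-- By colinearity the value is `ι(a) s(b₁) s(S(b₂))`, and `s` is multiplicative. As the products
`ι(a) s(b)` span, the image is contained in that of `ι`, and the rule `ι(a) s(b) ↦ ε(b) a` is well
defined. -/
lemma colinearRetract_mul (hs : IsColinearSection ι π s) (a : A) (b : B) :
    colinearRetract π s (ι a * s b) = counit (R := k) b • ι a := by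
  have h (z : B ⊗[k] B) : LinearMap.mul' k C
      ((s.toLinearMap ∘ₗ HopfAlgebra.antipode k).lTensor C
        (ι a ⊗ₜ 1 * LinearMap.rTensor B s.toLinearMap z)) =
      ι a * s (LinearMap.mul' k B ((HopfAlgebra.antipode k).lTensor B z)) := by
    induction z with
    | zero => simp
    | add x y hx hy => simp only [map_add, mul_add, hx, hy]
    | tmul b c => simp [mul_assoc]
  rw [colinearRetract, LinearMap.comp_apply, LinearMap.comp_apply, LinearMap.comp_apply,
    hs.lTensor_comul_mul_section, h, HopfAlgebra.mul_antipode_lTensor_comul_apply, AlgHom.commutes,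
    Algebra.algebraMap_eq_smul_one, mul_smul_comm, mul_one]

lemma induction_incl_mul (hs : IsColinearSection ι π s) {N : Submodule k C}
    (h : ∀ a b, ι a * s b ∈ N) (c : C) : c ∈ N := by
  have : Submodule.span k (Set.range fun z : A × B => ι z.1 * s z.2) ≤ N := by
    rw [Submodule.span_le]
    rintro _ ⟨⟨a, b⟩, rfl⟩
    exact h a b
  exact this (hs.span_incl_mul ▸ Submodule.mem_top)

lemma induction_mul_incl (hs : IsColinearSection ι π s) {N : Submodule k C}
    (h : ∀ a b, s b * ι a ∈ N) (c : C) : c ∈ N := by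
  have : Submodule.span k (Set.range fun z : A × B => s z.2 * ι z.1) ≤ N := by
    rw [Submodule.span_le]
    rintro _ ⟨⟨a, b⟩, rfl⟩
    exact h a b
  exact this (hs.span_mul_incl ▸ Submodule.mem_top)

lemma colinearRetract_mem_range (hs : IsColinearSection ι π s) (c : C) :
    colinearRetract π s c ∈ LinearMap.range (ι : A →ₗ[k] C) :=
  hs.induction_incl_mul (N := (LinearMap.range (ι : A →ₗ[k] C)).comap (colinearRetract π s))
    (fun a b => by
      rw [Submodule.mem_comap, hs.colinearRetract_mul]
      exact Submodule.smul_mem _ _ ⟨a, rfl⟩) c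

lemma exists_retraction (hs : IsColinearSection ι π s) :
    ∃ r : C →ₗ[k] A, ∀ a b, r (ι a * s b) = counit (R := k) b • a := by
  refine ⟨(LinearEquiv.ofInjective (ι : A →ₗ[k] C) hs.injective).symm.toLinearMap ∘ₗ
    (colinearRetract π s).codRestrict _ hs.colinearRetract_mem_range, fun a b => ?_⟩
  rw [LinearMap.comp_apply, LinearEquiv.coe_coe, LinearEquiv.symm_apply_eq]
  exact Subtype.ext ((hs.colinearRetract_mul a b).trans
    (map_smul (ι : A →ₗ[k] C) (counit (R := k) b) a).symm)

/-- On a coinvariant `c` the formula `c₁ s(S(π(c₂)))` reduces to `c`, so `c` is in the image of the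
retraction. -/
lemma mem_range_iff (hs : IsColinearSection ι π s) (c : C) : c ∈ Set.range ι ↔
    LinearMap.lTensor C (π : C →ₗ[k] B) (comul (R := k) c) = c ⊗ₜ[k] (1 : B) := by
  constructor
  · rintro ⟨a, rfl⟩
    exact hs.lTensor_comul_incl a
  · intro h
    have e : colinearRetract π s c = c := by
      rw [colinearRetract, LinearMap.comp_apply, LinearMap.comp_apply, LinearMap.comp_apply, h]
      simp
    obtain ⟨a, ha⟩ := hs.colinearRetract_mem_range c
    exact ⟨a, ha.trans e⟩

/-- The element `c - s(π(c))` is always in the left ideal: for `c = s(b) ι(a)` it equals `s(b) ι(a -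
ε(a))`. For a left ideal, `ι(a)` has to stand on the right, hence the second spanning condition. -/
lemma eq_zero_iff (hs : IsColinearSection ι π s) (c : C) :
    π c = 0 ↔ c ∈ Ideal.span (ι '' {a | counit (R := k) a = 0}) := by
  constructor
  · intro h
    let J : Submodule k C := (Ideal.span (ι '' {a | counit (R := k) a = 0})).restrictScalars k
    have h1 : c - s (π c) ∈ J :=
      Submodule.mem_comap.1 <| hs.induction_mul_incl (N := J.comap
        (LinearMap.id - s.toLinearMap ∘ₗ (π : C →ₗ[k] B))) (fun a b => by
          have e : s b * ι a - s (π (s b * ι a)) =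
              s b * ι (a - algebraMap k A (counit a)) := by
            rw [map_mul π, hs.proj_section, hs.proj_incl, map_mul s, AlgHom.commutes, map_sub,
              mul_sub]
            congr 2
            exact (AlgHomClass.commutes ι _).symm
          refine Submodule.mem_comap.2 ?_
          refine (congrArg (· ∈ J) e).mpr (Ideal.mul_mem_left _ _ (Ideal.subset_span ⟨_, ?_, rfl⟩))
          simp) c
    rw [h, map_zero, sub_zero] at h1
    exact h1
  · intro h
    induction h using Submodule.span_induction with
    | mem x hx =>
      obtain ⟨a, ha, rfl⟩ := hx
      rw [hs.proj_incl, show counit (R := k) a = 0 from ha, map_zero]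
    | zero => exact map_zero π
    | add x y _ _ hx hy => rw [map_add, hx, hy, add_zero]
    | smul a x _ hx => rw [smul_eq_mul, map_mul, hx, mul_zero]

lemma isHopfExact (hs : IsColinearSection ι π s) : IsHopfExact ι π where
  injective := hs.injective
  surjective b := ⟨s b, hs.proj_section b⟩
  eq_zero_iff := hs.eq_zero_iff
  mem_range_iff := hs.mem_range_iff

lemma counit_section (hs : IsColinearSection ι π s) (b : B) :
    counit (R := k) (s b) = counit (R := k) b := by
  rw [← CoalgHomClass.counit_comp_apply π (s b), hs.proj_section]

/-- The convolution inverse of an algebra map is its composite with the antipode of the source.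
Dually, `isUnit_retraction` uses the antipode of the target. -/
lemma isUnit_section (s : B →ₐ[k] C) : IsUnit (WithConv.toConv s.toLinearMap) := by
  have h1 : WithConv.toConv s.toLinearMap *
      WithConv.toConv (s.toLinearMap ∘ₗ HopfAlgebra.antipode k) = 1 := by
    have h := LinearMap.algHom_comp_convMul_distrib s
      (WithConv.toConv (LinearMap.id : B →ₗ[k] B)) (WithConv.toConv (HopfAlgebra.antipode k))
    rw [LinearMap.id_mul_antipode] at h
    apply WithConv.ofConv_injective
    refine h.symm.trans (LinearMap.ext fun b => ?_)
    exact s.commutes _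
  have h2 : WithConv.toConv (s.toLinearMap ∘ₗ HopfAlgebra.antipode k) *
      WithConv.toConv s.toLinearMap = 1 := by
    have h := LinearMap.algHom_comp_convMul_distrib s
      (WithConv.toConv (HopfAlgebra.antipode k)) (WithConv.toConv (LinearMap.id : B →ₗ[k] B))
    rw [LinearMap.antipode_mul_id] at h
    apply WithConv.ofConv_injective
    refine h.symm.trans (LinearMap.ext fun b => ?_)
    exact s.commutes _
  exact ⟨⟨_, _, h1, h2⟩, rfl⟩

lemma isUnit_retraction (r : C →ₗc[k] A) : IsUnit (WithConv.toConv (r : C →ₗ[k] A)) := by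
  have e : (Algebra.linearMap k A ∘ₗ counit) ∘ₗ r.toLinearMap = Algebra.linearMap k A ∘ₗ counit :=
    LinearMap.ext fun c => congrArg (algebraMap k A) (CoalgHomClass.counit_comp_apply r c)
  have h1 : WithConv.toConv (r : C →ₗ[k] A) *
      WithConv.toConv (HopfAlgebra.antipode k ∘ₗ (r : C →ₗ[k] A)) = 1 := by
    have h := LinearMap.convMul_comp_coalgHom_distrib
      (WithConv.toConv (LinearMap.id : A →ₗ[k] A)) (WithConv.toConv (HopfAlgebra.antipode k)) r
    rw [LinearMap.id_mul_antipode] at h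
    apply WithConv.ofConv_injective
    exact h.symm.trans e
  have h2 : WithConv.toConv (HopfAlgebra.antipode k ∘ₗ (r : C →ₗ[k] A)) *
      WithConv.toConv (r : C →ₗ[k] A) = 1 := by
    have h := LinearMap.convMul_comp_coalgHom_distrib
      (WithConv.toConv (HopfAlgebra.antipode k)) (WithConv.toConv (LinearMap.id : A →ₗ[k] A)) r
    rw [LinearMap.antipode_mul_id] at h
    apply WithConv.ofConv_injective
    exact h.symm.trans e
  exact ⟨⟨_, _, h1, h2⟩, rfl⟩

/-- The sequence is split if `B` is generated by elements `x` with `ε(x) = 0` and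
`Δ(s(x)) = s(x) ⊗ g + 1 ⊗ s(x)`. -/
lemma isSplitHopfSequence (hs : IsColinearSection ι π s) {G : Set B}
    (hG : Algebra.adjoin k G = ⊤) (hc : ∀ x ∈ G, counit (R := k) x = 0)
    (hg : ∀ x ∈ G, ∃ g : C, comul (R := k) (s x) = s x ⊗ₜ g + 1 ⊗ₜ s x) :
    IsSplitHopfSequence ι π := by
  obtain ⟨r, hr⟩ := hs.exists_retraction
  have hrι (a : A) : r (ι a) = a := by simpa using hr a 1
  -- On `ι(a) s(b) s(x)` the retraction is `ε(b x) a`, and `ε(x) = 0`.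
  have hrm {x : B} (hx : x ∈ G) (c : C) : r (c * s x) = 0 :=
    hs.induction_incl_mul (N := LinearMap.ker (r ∘ₗ LinearMap.mulRight k (s x)))
      (fun a b => by
        rw [LinearMap.mem_ker, LinearMap.comp_apply, LinearMap.mulRight_apply, mul_assoc, ← map_mul,
          hr, Bialgebra.counit_mul, hc x hx, mul_zero, zero_smul]) c
  -- Each summand of `Δ(s(x))` has a tensor factor `s(x)`, so each is killed after multiplication on
  -- the left.
  have hrr {x : B} (hx : x ∈ G) (c : C) :
      TensorProduct.map r r (comul (R := k) (c * s x)) = 0 := by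
    obtain ⟨g, hg⟩ := hg x hx
    have h (z : C ⊗[k] C) : TensorProduct.map r r (z * (s x ⊗ₜ g + 1 ⊗ₜ s x)) = 0 := by
      induction z with
      | zero => simp
      | add y z hy hz => rw [add_mul, map_add, hy, hz, add_zero]
      | tmul a b => simp [mul_add, hrm hx]
    rw [Bialgebra.comul_mul, hg, h]
  have hcoalg (c : C) : TensorProduct.map r r (comul (R := k) c) = comul (R := k) (r c) := by
    refine hs.induction_incl_mul (N := LinearMap.ker
      (TensorProduct.map r r ∘ₗ comul - comul ∘ₗ r)) (fun a b => ?_) c |> sub_eq_zero.1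
    -- Compatibility with `Δ` is checked along the generation of `b`: at `b = 1` it is that of `ι`,
    -- and after a right factor from `G` both sides vanish.
    have hb : (LinearMap.ker ((TensorProduct.map r r ∘ₗ comul - comul ∘ₗ r) ∘ₗ
        LinearMap.mulLeft k (ι a) ∘ₗ s.toLinearMap)) = ⊤ := by
      refine Submodule.eq_top_of_mul_mem_of_adjoin_eq_top hG _ ?_ fun b _ x hx => ?_
      · have h (z : A ⊗[k] A) : TensorProduct.map r r
            (TensorProduct.map (ι : A →ₗ[k] C) (ι : A →ₗ[k] C) z) = z := by
          induction z with
          | zero => simp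
          | add x y hx hy => simp only [map_add, hx, hy]
          | tmul a b => simp [hrι]
        simp only [LinearMap.mem_ker, LinearMap.comp_apply, LinearMap.sub_apply,
          AlgHom.toLinearMap_apply, map_one, LinearMap.mulLeft_apply, mul_one]
        rw [hrι, ← CoalgHomClass.map_comp_comul_apply ι a, sub_eq_zero]
        exact h _
      · simp only [LinearMap.mem_ker, LinearMap.comp_apply, LinearMap.sub_apply,
          AlgHom.toLinearMap_apply, map_mul, LinearMap.mulLeft_apply]
        rw [← mul_assoc, hrr hx, hrm hx, map_zero, sub_zero]
    exact (hb ▸ Submodule.mem_top : b ∈ LinearMap.ker _)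
  have hcounit (c : C) : counit (R := k) (r c) = counit (R := k) c :=
    sub_eq_zero.1 <| LinearMap.mem_ker.1 <| hs.induction_incl_mul
        (N := LinearMap.ker (counit ∘ₗ r - counit)) (fun a b => by
      rw [LinearMap.mem_ker, LinearMap.sub_apply, LinearMap.comp_apply, hr, Bialgebra.counit_mul,
        hs.counit_section, CoalgHomClass.counit_comp_apply, map_smul, smul_eq_mul, mul_comm,
        sub_self]) c
  let r' : C →ₗc[k] A :=
    { r with
      counit_comp := LinearMap.ext hcounit
      map_comp_comul := LinearMap.ext hcoalg }
  refine ⟨s, r', ?_⟩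
  exact
    { section_one := map_one s
      proj_section := hs.proj_section
      section_colinear := hs.colinear
      section_isUnit := isUnit_section s
      counit_retraction := hcounit
      retraction_incl := hrι
      retraction_linear := fun a c =>
        hs.induction_incl_mul (N := LinearMap.ker
          (r ∘ₗ LinearMap.mulLeft k (ι a) - LinearMap.mulLeft k a ∘ₗ r)) (fun a' b => by
            rw [LinearMap.mem_ker, LinearMap.sub_apply, LinearMap.comp_apply, LinearMap.comp_apply,
              LinearMap.mulLeft_apply, LinearMap.mulLeft_apply, ← mul_assoc, ← map_mul, hr, hr,
              mul_smul_comm, sub_self]) c |> sub_eq_zero.1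
      retraction_isUnit := isUnit_retraction r'
      retraction_section := fun b => by
        have := hr 1 b
        rw [map_one, one_mul] at this
        rw [Algebra.algebraMap_eq_smul_one]
        exact this }

end IsColinearSection

end CleftExtension

/-! ### The exact sequence for `H`. -/

namespace BlockPointDatum

open Coalgebra YetterDrinfeld SkewMonoidAlgebra

attribute [local instance] LieRing.ofAssociativeRing

section Sequence

variable {p : ℕ} [hp : Fact p.Prime] (D : BlockPointDatum p) (k : Type*) [Field k] [CharP k p]

/-- The element `v_h` of `L`. -/
abbrev pointL (h : Fin D.s) : D.HopfL k := D.vL k (Finsupp.single ⟨h, 0⟩ 1)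

/-- The elements `E_j` and `v_h` of `L`. -/
def genSetL : Set (D.HopfL k) := Set.range (D.eL k) ∪ Set.range (D.pointL k)

/-- Each `v_{h,m}` is an iterated commutator of the `E_j` with `v_h`, by induction on the sum of the
exponents. -/
lemma adjoin_genSetL : Algebra.adjoin k (D.genSetL k) = ⊤ := by
  rw [eq_top_iff, ← D.adjoin_L_eq_top k, Algebra.adjoin_le_iff]
  have he (j : Fin D.t) : D.eL k j ∈ Algebra.adjoin k (D.genSetL k) :=
    Algebra.subset_adjoin (Or.inl ⟨j, rfl⟩)
  rintro _ (⟨j, rfl⟩ | ⟨w, rfl⟩)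
  · exact he j
  · change D.vL k (Finsupp.single w 1) ∈ Algebra.adjoin k (D.genSetL k)
    induction hn : ∑ j, (w.2 j : ℕ) generalizing w with
    | zero =>
      obtain ⟨h, m⟩ := w
      have hm : m = 0 := by
        funext j
        exact Fin.ext ((Finset.sum_eq_zero_iff.1 hn) j (Finset.mem_univ j))
      rw [hm]
      exact Algebra.subset_adjoin (Or.inr ⟨h, rfl⟩)
    | succ n ih =>
      obtain ⟨j, hj⟩ : ∃ j, (w.2 j : ℕ) ≠ 0 := by
        by_contra! h0
        rw [Finset.sum_eq_zero fun j _ => h0 j] at hn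
        omega
      have hd := ih (D.lowerWeight j w) (by
        have := D.sum_lowerWeight j hj
        omega)
      have hlt : ((D.lowerWeight j w).2 j : ℕ) < D.ghost (D.lowerWeight j w).1 j := by
        rw [lowerWeight_self]
        have := (w.2 j).2
        change _ < D.ghost w.1 j
        omega
      have e := D.eL_mul_vL k j (Finsupp.single (D.lowerWeight j w) 1)
      rw [raise_single_of_lt _ _ hlt, raiseWeight_lowerWeight _ _ _ hj] at e
      rw [← sub_eq_iff_eq_add'.2 e]
      exact sub_mem (mul_mem (he j) hd) (mul_mem hd (he j))

lemma algHom_ext_L {R : Type*} [Semiring R] [Algebra k R] {φ ψ : D.HopfL k →ₐ[k] R}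
    (he : ∀ j, φ (D.eL k j) = ψ (D.eL k j)) (hv : ∀ h, φ (D.pointL k h) = ψ (D.pointL k h)) :
    φ = ψ := by
  refine AlgHom.ext_of_adjoin_eq_top (D.adjoin_genSetL k) ?_
  rintro _ (⟨j, rfl⟩ | ⟨h, rfl⟩)
  · exact he j
  · exact hv h

lemma isCocomm_HopfL : IsCocomm k (D.HopfL k) where
  comm_comp_comul := by
    have h : (Algebra.TensorProduct.comm k (D.HopfL k) (D.HopfL k)).toAlgHom.comp
        (Bialgebra.comulAlgHom k _) = Bialgebra.comulAlgHom k _ :=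
      D.algHom_ext_L k
        (fun j => by
          rw [AlgHom.comp_apply, Bialgebra.comulAlgHom_apply, comul_eL, map_add, add_comm]
          rfl)
        (fun h => by
          rw [AlgHom.comp_apply, Bialgebra.comulAlgHom_apply, comul_vL, map_add, add_comm]
          rfl)
    exact LinearMap.ext fun a => DFunLike.congr_fun h a

lemma sectionL_eL (h2 : p ≠ 2) (j : Fin D.t) : D.sectionL k h2 (D.eL k j) = D.yNorm k j :=
  D.sectionL_E k h2 j

lemma sectionL_pointL (h2 : p ≠ 2) (h : Fin D.s) :
    D.sectionL k h2 (D.pointL k h) = D.xNorm k (Sum.inr h) := D.sectionL_v k h2 h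

lemma proj_yNorm (h2 : p ≠ 2) (j : Fin D.t) : D.proj k h2 (D.yNorm k j) = D.eL k j := by
  rw [yNorm_eq, map_mul, proj_group, one_mul]
  exact D.proj_gen k h2 (Sum.inr j)

lemma proj_xNorm (h2 : p ≠ 2) (h : Fin D.s) :
    D.proj k h2 (D.xNorm k (Sum.inr h)) = D.pointL k h := by
  rw [xNorm_eq, map_mul, proj_group, one_mul]
  exact D.proj_gen k h2 (Sum.inl (Sum.inr h))

lemma proj_sectionL (h2 : p ≠ 2) (b : D.HopfL k) : D.proj k h2 (D.sectionL k h2 b) = b := by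
  have h : (D.proj k h2 : D.HopfH k →ₐ[k] D.HopfL k).comp (D.sectionL k h2) = AlgHom.id k _ :=
    D.algHom_ext_L k
      (fun j => (congrArg _ (D.sectionL_eL k h2 j)).trans (D.proj_yNorm k h2 j))
      (fun j => (congrArg _ (D.sectionL_pointL k h2 j)).trans (D.proj_xNorm k h2 j))
  exact DFunLike.congr_fun h b

/-- Both sides are algebra maps, so generators suffice. The normalization by `g⁻¹` is essential: it
makes the second summand of the coproduct `1 ⊗ Z`, and the remaining group element is sent to `1` by
`π`. -/
lemma lTensor_comul_sectionL (h2 : p ≠ 2) (b : D.HopfL k) :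
    LinearMap.lTensor (D.HopfH k) (D.proj k h2 : D.HopfH k →ₗ[k] D.HopfL k)
      (comul (R := k) (D.sectionL k h2 b)) =
        LinearMap.rTensor (D.HopfL k) (D.sectionL k h2).toLinearMap (comul (R := k) b) := by
  have h : ((Algebra.TensorProduct.map (AlgHom.id k _)
      (D.proj k h2 : D.HopfH k →ₐ[k] D.HopfL k)).comp (Bialgebra.comulAlgHom k _)).comp
        (D.sectionL k h2) =
      (Algebra.TensorProduct.map (D.sectionL k h2) (AlgHom.id k _)).comp
        (Bialgebra.comulAlgHom k _) := by
    have hπ (a : D.HopfH k) : (D.proj k h2 : D.HopfH k →ₐ[k] D.HopfL k) a = D.proj k h2 a := rfl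
    refine D.algHom_ext_L k (fun j => ?_) fun j => ?_
    · rw [AlgHom.comp_apply, AlgHom.comp_apply, AlgHom.comp_apply, sectionL_eL,
        Bialgebra.comulAlgHom_apply, Bialgebra.comulAlgHom_apply, comul_yNorm, comul_eL, map_add,
        map_add, Algebra.TensorProduct.map_tmul, Algebra.TensorProduct.map_tmul,
        Algebra.TensorProduct.map_tmul, Algebra.TensorProduct.map_tmul, hπ, hπ, proj_yNorm,
        proj_group, sectionL_eL, map_one, map_one (D.sectionL k h2)]
      rfl
    · rw [AlgHom.comp_apply, AlgHom.comp_apply, AlgHom.comp_apply, sectionL_pointL,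
        Bialgebra.comulAlgHom_apply, Bialgebra.comulAlgHom_apply, comul_xNorm, comul_vL, map_add,
        map_add, Algebra.TensorProduct.map_tmul, Algebra.TensorProduct.map_tmul,
        Algebra.TensorProduct.map_tmul, Algebra.TensorProduct.map_tmul, hπ, hπ, proj_xNorm,
        proj_group, sectionL_pointL, map_one, map_one (D.sectionL k h2)]
      rfl
  exact DFunLike.congr_fun h b

lemma proj_inclK (h2 : p ≠ 2) (a : D.subalgebraK k) :
    D.proj k h2 (D.inclK k a) = algebraMap k _ (counit (R := k) a) := by
  have h : D.subalgebraK k ≤ AlgHom.equalizer (D.proj k h2 : D.HopfH k →ₐ[k] D.HopfL k)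
      ((Algebra.ofId k _).comp (Bialgebra.counitAlgHom k _)) := by
    refine Algebra.adjoin_le ?_
    rintro _ (⟨j, rfl⟩ | ⟨i, rfl⟩)
    · refine (D.proj_gen k h2 (Sum.inl (Sum.inl j))).trans ?_
      exact (map_zero (algebraMap k _)).symm.trans
        (congrArg _ ((D.braidedSpace k).counit_bosonGen (Sum.inl (Sum.inl j))).symm)
    · refine (D.proj_group k h2 (D.grp i)).trans ?_
      exact (map_one (algebraMap k _)).symm.trans
        (congrArg _ ((D.braidedSpace k).counit_bosonGroup (D.grp i)).symm)
  exact h a.2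

/-- A subspace of `H` is `H` if it contains `1` and is stable under multiplication from the left by
`K` and by the skew primitive elements that generate `H` over `K`. -/
lemma eq_top_of_mul_mem_left {N : Submodule k (D.HopfH k)} (h1 : 1 ∈ N)
    (hK : ∀ b ∈ D.subalgebraK k, ∀ a ∈ N, b * a ∈ N) (hy : ∀ j, ∀ a ∈ N, D.yNorm k j * a ∈ N)
    (hx : ∀ h, ∀ a ∈ N, D.xNorm k (Sum.inr h) * a ∈ N) : N = ⊤ := by
  refine Submodule.eq_top_of_mul_mem_left_of_adjoin_eq_top
    (D.braidedSpace k).adjoin_boson_eq_top N h1 ?_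
  rintro a ha _ (⟨b, rfl⟩ | ⟨γ, rfl⟩)
  · rcases b with (i | h) | j
    · exact hK _ (D.x_mem k i) a ha
    · rw [← bosonGroup_mul_normGen, mul_assoc]
      exact hK _ (D.grpElt_mem k _) _ (hx h a ha)
    · rw [← bosonGroup_mul_normGen, mul_assoc]
      exact hK _ (D.grpElt_mem k _) _ (hy j a ha)
  · exact hK _ (D.grpElt_mem k γ) a ha

/-- Right-handed version of `eq_top_of_mul_mem_left`. -/
lemma eq_top_of_mul_mem_right {N : Submodule k (D.HopfH k)} (h1 : 1 ∈ N)
    (hK : ∀ b ∈ D.subalgebraK k, ∀ a ∈ N, a * b ∈ N) (hy : ∀ j, ∀ a ∈ N, a * D.yNorm k j ∈ N)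
    (hx : ∀ h, ∀ a ∈ N, a * D.xNorm k (Sum.inr h) ∈ N) : N = ⊤ := by
  refine Submodule.eq_top_of_mul_mem_of_adjoin_eq_top
    (D.braidedSpace k).adjoin_boson_eq_top N h1 ?_
  rintro a ha _ (⟨b, rfl⟩ | ⟨γ, rfl⟩)
  · rcases b with (i | h) | j
    · exact hK _ (D.x_mem k i) a ha
    · rw [← bosonGroup_mul_normGen, ← mul_assoc]
      exact hx h _ (hK _ (D.grpElt_mem k _) a ha)
    · rw [← bosonGroup_mul_normGen, ← mul_assoc]
      exact hy j _ (hK _ (D.grpElt_mem k _) a ha)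
  · exact hK _ (D.grpElt_mem k γ) a ha

/-- The span is stable under left multiplication by generators: `Y_j b = b Y_j + ad(Y_j)(b)` with
`ad(Y_j)(b)` in `K`, and `X_h` commutes with `K`. -/
lemma span_inclK_mul_sectionL (h2 : p ≠ 2) : Submodule.span k
    (Set.range fun z : D.subalgebraK k × D.HopfL k => D.inclK k z.1 * D.sectionL k h2 z.2) = ⊤ := by
  set N := Submodule.span k
    (Set.range fun z : D.subalgebraK k × D.HopfL k => D.inclK k z.1 * D.sectionL k h2 z.2)
  have mem {b : D.HopfH k} (hb : b ∈ D.subalgebraK k) (l : D.HopfL k) :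
      b * D.sectionL k h2 l ∈ N := Submodule.subset_span ⟨(⟨b, hb⟩, l), rfl⟩
  have stable {c : D.HopfH k}
      (hc : ∀ b ∈ D.subalgebraK k, ∀ l, c * (b * D.sectionL k h2 l) ∈ N) :
      ∀ a ∈ N, c * a ∈ N := by
    have h : N ≤ N.comap (LinearMap.mulLeft k c) := by
      refine Submodule.span_le.2 ?_
      rintro _ ⟨⟨b, l⟩, rfl⟩
      exact hc b b.2 l
    exact fun a ha => h ha
  refine D.eq_top_of_mul_mem_left k ?_ (fun c hc => stable fun b hb l => ?_)
    (fun j => stable fun b hb l => ?_) (fun h => stable fun b hb l => ?_)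
  · have := mem (one_mem _) 1
    rwa [one_mul, map_one] at this
  · rw [← mul_assoc]
    exact mem (mul_mem hc hb) l
  · have e : D.yNorm k j * (b * D.sectionL k h2 l) =
        b * D.sectionL k h2 (D.eL k j * l) +
          innerDer k (D.yNorm k j) b * D.sectionL k h2 l := by
      rw [map_mul, sectionL_eL, innerDer_apply]
      noncomm_ring
    rw [e]
    exact add_mem (mem hb _) (mem (D.innerDer_yNorm_mem k h2 j hb) l)
  · rw [← mul_assoc, ← (D.commute_xNorm_of_mem k hb (Sum.inr h)).eq, mul_assoc,
      ← D.sectionL_pointL k h2, ← map_mul]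
    exact mem hb _

lemma span_sectionL_mul_inclK (h2 : p ≠ 2) : Submodule.span k
    (Set.range fun z : D.subalgebraK k × D.HopfL k => D.sectionL k h2 z.2 * D.inclK k z.1) = ⊤ := by
  set N := Submodule.span k
    (Set.range fun z : D.subalgebraK k × D.HopfL k => D.sectionL k h2 z.2 * D.inclK k z.1)
  have mem {b : D.HopfH k} (hb : b ∈ D.subalgebraK k) (l : D.HopfL k) :
      D.sectionL k h2 l * b ∈ N := Submodule.subset_span ⟨(⟨b, hb⟩, l), rfl⟩
  have stable {c : D.HopfH k}
      (hc : ∀ b ∈ D.subalgebraK k, ∀ l, D.sectionL k h2 l * b * c ∈ N) :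
      ∀ a ∈ N, a * c ∈ N := by
    have h : N ≤ N.comap (LinearMap.mulRight k c) := by
      refine Submodule.span_le.2 ?_
      rintro _ ⟨⟨b, l⟩, rfl⟩
      exact hc b b.2 l
    exact fun a ha => h ha
  refine D.eq_top_of_mul_mem_right k ?_ (fun c hc => stable fun b hb l => ?_)
    (fun j => stable fun b hb l => ?_) (fun h => stable fun b hb l => ?_)
  · have := mem (one_mem _) 1
    rwa [mul_one, map_one] at this
  · rw [mul_assoc]
    exact mem (mul_mem hb hc) l
  · have e : D.sectionL k h2 l * b * D.yNorm k j =
        D.sectionL k h2 (l * D.eL k j) * b -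
          D.sectionL k h2 l * innerDer k (D.yNorm k j) b := by
      rw [map_mul, sectionL_eL, innerDer_apply]
      noncomm_ring
    rw [e]
    exact sub_mem (mem hb _) (mem (D.innerDer_yNorm_mem k h2 j hb) l)
  · rw [mul_assoc, (D.commute_xNorm_of_mem k hb (Sum.inr h)).eq, ← mul_assoc,
      ← D.sectionL_pointL k h2, ← map_mul]
    exact mem hb _

lemma isColinearSection_sectionL (h2 : p ≠ 2) :
    IsColinearSection (D.inclK k) (D.proj k h2) (D.sectionL k h2) where
  injective := Subtype.val_injective
  proj_incl := D.proj_inclK k h2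
  proj_section := D.proj_sectionL k h2
  colinear := D.lTensor_comul_sectionL k h2
  span_incl_mul := D.span_inclK_mul_sectionL k h2
  span_mul_incl := D.span_sectionL_mul_inclK k h2

lemma isAbelianHopfExact (h2 : p ≠ 2) : IsAbelianHopfExact (D.inclK k) (D.proj k h2) where
  toIsHopfExact := (D.isColinearSection_sectionL k h2).isHopfExact
  mul_comm a b := Subtype.ext (D.commute_of_mem_of_mem k a.2 b.2).eq
  isCocomm := D.isCocomm_HopfL k

lemma isSplitHopfSequence (h2 : p ≠ 2) : IsSplitHopfSequence (D.inclK k) (D.proj k h2) := by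
  refine (D.isColinearSection_sectionL k h2).isSplitHopfSequence (D.adjoin_genSetL k) ?_ ?_
  · rintro _ (⟨j, rfl⟩ | ⟨h, rfl⟩)
    · exact D.counit_eL k j
    · exact D.counit_vL k _
  · rintro _ (⟨j, rfl⟩ | ⟨h, rfl⟩)
    · rw [sectionL_eL]
      exact ⟨_, D.comul_yNorm k j⟩
    · rw [sectionL_pointL]
      exact ⟨_, D.comul_xNorm k _⟩

/-- All of `Γ` lies in the algebra generated by the `g_i`, so the prescribed values determine the
map on every generator of the bosonization. -/
lemma eq_proj (h2 : p ≠ 2) {f : D.HopfH k →ₐ[k] D.HopfL k} (hg : ∀ i, f (D.g k i) = 1)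
    (hx : ∀ j, f (D.x k (Sum.inl j)) = 0) (hy : ∀ j, f (D.y k j) = D.eL k j)
    (hv : ∀ h, f (D.x k (Sum.inr h)) = D.pointL k h) : f = D.proj k h2 := by
  have h : D.subalgebraK k ≤ AlgHom.equalizer f (D.proj k h2 : D.HopfH k →ₐ[k] D.HopfL k) := by
    refine Algebra.adjoin_le ?_
    rintro _ (⟨j, rfl⟩ | ⟨i, rfl⟩)
    · exact (hx j).trans (D.proj_gen k h2 (Sum.inl (Sum.inl j))).symm
    · exact (hg i).trans (D.proj_group k h2 (D.grp i)).symm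
  refine (D.braidedSpace k).algHom_ext_boson (fun b => ?_) fun γ => h (D.grpElt_mem k γ)
  refine Eq.trans ?_ (D.proj_gen k h2 b).symm
  rcases b with (j | i) | j
  · exact hx j
  · exact hv i
  · exact hy j

end Sequence

end BlockPointDatum

end

theorem proposition5p2 {k : Type*} [Field k] {p : ℕ} [Fact p.Prime] [CharP k p] (hp : p ≠ 2)
    (D : BlockPointDatum p) :
    ∃ π : D.HopfH k →ₐc[k] D.HopfL k,
      (∀ i, π (D.g k i) = 1) ∧
      (∀ j, π (D.x k (Sum.inl j)) = 0) ∧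
      (∀ j, π (D.y k j) = RestrictedEnveloping.ι k (D.E k j)) ∧
      (∀ h, π (D.x k (Sum.inr h)) = RestrictedEnveloping.ι k (D.v k h)) ∧
      (∀ f : D.HopfH k →ₐ[k] D.HopfL k, (∀ i, f (D.g k i) = 1) →
        (∀ j, f (D.x k (Sum.inl j)) = 0) →
        (∀ j, f (D.y k j) = RestrictedEnveloping.ι k (D.E k j)) →
        (∀ h, f (D.x k (Sum.inr h)) = RestrictedEnveloping.ι k (D.v k h)) → f = π) ∧
      IsAbelianHopfExact (D.inclK k) π ∧ IsSplitHopfSequence (D.inclK k) π :=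
  ⟨D.proj k hp, fun i => D.proj_group k hp (D.grp i),
    fun j => D.proj_gen k hp (Sum.inl (Sum.inl j)), fun j => D.proj_gen k hp (Sum.inr j),
    fun h => D.proj_gen k hp (Sum.inl (Sum.inr h)), fun _ hg hx hy hv => D.eq_proj k hp hg hx hy hv,
    D.isAbelianHopfExact k hp, D.isSplitHopfSequence k hp⟩
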